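/- **Conventions.** A polynomial in $\mathbb Z[x_1,\dots,x_n]$ is given as an explicit sum of monomials, each an integer coefficient times a product of powers of variables; coefficients and exponents are written in binary, and the variables are listed explicitly (so $n$ counts in unary). Rational numbers are given as fractions of integers in binary. All reductions are polynomial-time many-one reductions (Turing machines, time measured in the length of the encoding). $\mathrm{ETR}$ is the problem of deciding whether a given sentence $\exists x_1\cdots\exists x_n\,\Phi(x_1,\dots,x_n)$ is true in $\mathbb R$, where $\Phi$ is a quantifier-free Boolean combination of polynomial equations and inequalities with integer coefficients. The class $\exists\mathbb R$ consists of all decision problems that reduce to $\mathrm{ETR}$. A problem is $\exists\mathbb R$-hard if every problem in $\exists\mathbb R$ reduces to it, and $\exists\mathbb R$-complete if it is $\exists\mathbb R$-hard and lies in $\exists\mathbb R$. $\textsc{Feas}$ is the problem: given $r\in\mathbb Z[y_1,\dots,y_m]$, is there $y\in\mathbb R^m$ with $r(y)=0$? Continuous Multi-Region Clustering (CMRC) is the following problem. *Instance:* a polynomial $f\in\mathbb Z[x_1,\dots,x_d]$, rational numbers $\theta>0$ and $\delta>0$, and an integer $k\ge 1$ written in unary. *Question:* are there points $p_1,\dots,p_k\in\mathbb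 R^d$ with $f(p_i)\ge\theta$ for all $i$ and $\|p_i-p_j\|\ge\delta$ (Euclidean norm) for all $i\ne j$? **Theorem.** CMRC is $\exists\mathbb R$-complete, that is: 1. CMRC lies in $\exists\mathbb R$; 2. CMRC is $\exists\mathbb R$-hard. Moreover, hardness holds already for $k=2$, $\theta=1$, $\delta=1$: $\textsc{Feas}$ reduces in polynomial time to the restriction of CMRC to the instances with $k=2$, $\theta=1$, $\delta=1$, and this restriction is $\exists\mathbb R$-hard. -/

import Mathlib

namespace RealComplexity

/-! ### Decision problems and polynomial-time many-one reductions -/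

/-- A decision problem: a type of instances, an injective encoding of the instances as words over
a finite alphabet, and the set of yes-instances.  Languages over a finite alphabet are the special
case in which every word is an instance and `encode` is the identity. -/
structure DecisionProblem where
  /-- the instances -/
  Instance : Type
  /-- the input alphabet -/
  Alphabet : Type
  /-- the alphabet is finite -/
  alphabetFintype : Fintype Alphabet
  /-- the encoding of instances as words -/
  encode : Instance → List Alphabet
  /-- different instances have different encodings -/
  encode_injective : Function.Injective encode
  /-- the yes-instances -/
  Yes : Instance → Prop

/-- Polynomial-time many-one reducibility: a map of instances that preserves and reflects
yes-instances, computed on the encodings by a Turing machine in polynomially many steps. -/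
def PolyReducible (P Q : DecisionProblem) : Prop :=
  ∃ f : P.Instance → Q.Instance,
    Nonempty (Turing.TM2ComputableInPolyTime P.encode Q.encode f) ∧
      ∀ x, P.Yes x ↔ Q.Yes (f x)

/-- The restriction of a problem to the instances that satisfy `S`, with the same encoding. -/
def DecisionProblem.restrict (P : DecisionProblem) (S : P.Instance → Prop) : DecisionProblem where
  Instance := {x : P.Instance // S x}
  Alphabet := P.Alphabet
  alphabetFintype := P.alphabetFintype
  encode x := P.encode x.1
  encode_injective _ _ h := Subtype.ext (P.encode_injective h)
  Yes x := P.Yes x.1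

/-! ### Words over a fixed finite alphabet -/

/-- The alphabet in which polynomials, formulas and parameters are written. -/
inductive Symbol
  | bit (b : Bool)
  | tally
  | plus
  | minus
  | item
  | close
  | eqZero
  | gtZero
  | geZero
  | neg
  | conj
  | disj
  deriving DecidableEq, Fintype

/-- Unary notation, terminated by `close`. -/
def encodeUnary (n : ℕ) : List Symbol :=
  List.replicate n Symbol.tally ++ [Symbol.close]

/-- Binary notation (least significant digit first, no superfluous digits), terminated by
`close`. -/
def encodeBinary (n : ℕ) : List Symbol :=
  (Computability.encodeNat n).map Symbol.bit ++ [Symbol.close]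

/-- Integers: a sign followed by the absolute value in binary. -/
def encodeInt (c : ℤ) : List Symbol :=
  (if c < 0 then Symbol.minus else Symbol.plus) :: encodeBinary c.natAbs

/-- Rational numbers: numerator and denominator in binary. -/
def encodeRat (q : ℚ) : List Symbol :=
  encodeInt q.num ++ encodeBinary q.den

/-- Lists: each entry is preceded by `item`, the list is terminated by `close`. -/
def encodeList {α : Type} (e : α → List Symbol) : List α → List Symbol
  | [] => [Symbol.close]
  | a :: l => Symbol.item :: (e a ++ encodeList e l)

/-! ### Polynomials, written as sums of monomials -/

/-- A written monomial in `n` variables: an integer coefficient and a list of powers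
`x_i ^ e`, given as pairs `(i, e)`. -/
abbrev Mono (n : ℕ) : Type := ℤ × List (Fin n × ℕ)

/-- A written polynomial in `n` variables: a sum of monomials. -/
abbrev Poly (n : ℕ) : Type := List (Mono n)

/-- The element of `ℤ[x_1, …, x_n]` denoted by a written monomial. -/
noncomputable def Mono.toMvPolynomial {n : ℕ} (a : Mono n) : MvPolynomial (Fin n) ℤ :=
  MvPolynomial.C a.1 * (a.2.map fun q => MvPolynomial.X q.1 ^ q.2).prod

/-- The element of `ℤ[x_1, …, x_n]` denoted by a written polynomial. -/
noncomputable def Poly.toMvPolynomial {n : ℕ} (p : Poly n) : MvPolynomial (Fin n) ℤ :=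
  (p.map Mono.toMvPolynomial).sum

/-- The value of a written polynomial at a real point. -/
noncomputable def Poly.eval {n : ℕ} (p : Poly n) (x : Fin n → ℝ) : ℝ :=
  MvPolynomial.aeval x p.toMvPolynomial

/-- Monomials: coefficients and exponents in binary, indices of variables in unary. -/
def encodeMono {n : ℕ} (a : Mono n) : List Symbol :=
  encodeInt a.1 ++ encodeList (fun q => encodeUnary q.1.val ++ encodeBinary q.2) a.2

/-- Polynomials are encoded monomial by monomial. -/
def encodePoly {n : ℕ} (p : Poly n) : List Symbol :=
  encodeList encodeMono p

/-! ### Quantifier-free formulas -/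

/-- Quantifier-free Boolean combinations of polynomial equations and inequalities with integer
coefficients in `n` variables. -/
inductive Formula (n : ℕ) : Type
  | eqZero (p : Poly n)
  | gtZero (p : Poly n)
  | geZero (p : Poly n)
  | neg (φ : Formula n)
  | conj (φ ψ : Formula n)
  | disj (φ ψ : Formula n)

/-- Truth of a formula at a real point. -/
def Formula.Holds {n : ℕ} (x : Fin n → ℝ) : Formula n → Prop
  | .eqZero p => p.eval x = 0
  | .gtZero p => 0 < p.eval x
  | .geZero p => 0 ≤ p.eval x
  | .neg φ => ¬ φ.Holds x
  | .conj φ ψ => φ.Holds x ∧ ψ.Holds x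
  | .disj φ ψ => φ.Holds x ∨ ψ.Holds x

/-- Formulas in prefix notation. -/
def encodeFormula {n : ℕ} : Formula n → List Symbol
  | .eqZero p => Symbol.eqZero :: encodePoly p
  | .gtZero p => Symbol.gtZero :: encodePoly p
  | .geZero p => Symbol.geZero :: encodePoly p
  | .neg φ => Symbol.neg :: encodeFormula φ
  | .conj φ ψ => Symbol.conj :: (encodeFormula φ ++ encodeFormula ψ)
  | .disj φ ψ => Symbol.disj :: (encodeFormula φ ++ encodeFormula ψ)

/-! ### The encodings are injective -/

/-- A map to words whose values can be recognized as initial segments of words. -/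
def PrefixInjective {α : Type} (e : α → List Symbol) : Prop :=
  ∀ ⦃a b : α⦄ ⦃s t : List Symbol⦄, e a ++ s = e b ++ t → a = b ∧ s = t

theorem PrefixInjective.injective {α : Type} {e : α → List Symbol} (h : PrefixInjective e) :
    Function.Injective e := fun a b hab =>
  (h (a := a) (b := b) (s := []) (t := []) (by rw [hab])).1

theorem append_close_inj {l m s t : List Symbol} (hl : Symbol.close ∉ l) (hm : Symbol.close ∉ m)
    (h : l ++ Symbol.close :: s = m ++ Symbol.close :: t) : l = m ∧ s = t := by
  induction l generalizing m with
  | nil =>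
    cases m with
    | nil => simpa using h
    | cons y m => simp at h hm; exact absurd h.1 hm.1
  | cons x l ih =>
    cases m with
    | nil => simp at h hl; exact absurd h.1.symm hl.1
    | cons y m =>
      simp only [List.cons_append, List.cons.injEq, List.mem_cons, not_or] at h hl hm
      obtain ⟨h1, h2⟩ := ih hl.2 hm.2 h.2
      exact ⟨by rw [h.1, h1], h2⟩

theorem prefixInjective_encodeUnary : PrefixInjective encodeUnary := by
  intro a b s t h
  simp only [encodeUnary, List.append_assoc, List.singleton_append] at h
  obtain ⟨h1, h2⟩ := append_close_inj (by simp [List.mem_replicate]) (by simp [List.mem_replicate]) h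
  exact ⟨by simpa using congrArg List.length h1, h2⟩

theorem prefixInjective_encodeBinary : PrefixInjective encodeBinary := by
  intro a b s t h
  simp only [encodeBinary, List.append_assoc, List.singleton_append] at h
  obtain ⟨h1, h2⟩ := append_close_inj (by simp) (by simp) h
  have hb : Function.Injective Symbol.bit := fun _ _ h => by simpa using h
  exact ⟨Computability.encodingNatBool.encode_injective (hb.list_map h1), h2⟩

theorem prefixInjective_encodeInt : PrefixInjective encodeInt := by
  intro a b s t h
  simp only [encodeInt, List.cons_append, List.cons.injEq] at h
  obtain ⟨h1, h2⟩ := prefixInjective_encodeBinary h.2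
  refine ⟨?_, h2⟩
  have h3 := h.1
  split_ifs at h3 <;> omega

theorem PrefixInjective.pair {α β γ : Type} {e : α → List Symbol} {e' : β → List Symbol}
    (h : PrefixInjective e) (h' : PrefixInjective e') {f : γ → α} {g : γ → β}
    (hfg : ∀ x y, f x = f y → g x = g y → x = y) :
    PrefixInjective fun x => e (f x) ++ e' (g x) := by
  intro x y s t hxy
  simp only [List.append_assoc] at hxy
  obtain ⟨h1, h2⟩ := h hxy
  obtain ⟨h3, h4⟩ := h' h2
  exact ⟨hfg x y h1 h3, h4⟩

theorem prefixInjective_encodeRat : PrefixInjective encodeRat :=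
  prefixInjective_encodeInt.pair prefixInjective_encodeBinary fun _ _ => Rat.ext

theorem PrefixInjective.list {α : Type} {e : α → List Symbol} (h : PrefixInjective e) :
    PrefixInjective (encodeList e) := by
  intro l
  induction l with
  | nil =>
    intro m s t hlm
    cases m with
    | nil => simpa [encodeList] using hlm
    | cons b m => simp [encodeList] at hlm
  | cons a l ih =>
    intro m s t hlm
    cases m with
    | nil => simp [encodeList] at hlm
    | cons b m =>
      simp only [encodeList, List.cons_append, List.cons.injEq, List.append_assoc,
        true_and] at hlm
      obtain ⟨h1, h2⟩ := h hlm
      obtain ⟨h3, h4⟩ := ih h2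
      exact ⟨by rw [h1, h3], h4⟩

theorem prefixInjective_encodeMono {n : ℕ} : PrefixInjective (encodeMono (n := n)) := by
  refine prefixInjective_encodeInt.pair (PrefixInjective.list ?_) fun _ _ => Prod.ext
  refine prefixInjective_encodeUnary.pair prefixInjective_encodeBinary
    (f := fun q : Fin n × ℕ => q.1.val) (g := Prod.snd) fun x y h1 h2 => ?_
  exact Prod.ext (Fin.ext h1) h2

theorem prefixInjective_encodePoly {n : ℕ} : PrefixInjective (encodePoly (n := n)) :=
  prefixInjective_encodeMono.list

theorem prefixInjective_encodeFormula {n : ℕ} : PrefixInjective (encodeFormula (n := n)) := by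
  intro φ
  induction φ with
  | eqZero p | gtZero p | geZero p =>
    intro ψ s t h
    cases ψ <;> simp only [encodeFormula, List.cons_append, List.cons.injEq, reduceCtorEq,
      false_and, true_and] at h
    obtain ⟨h1, h2⟩ := prefixInjective_encodePoly h
    exact ⟨by rw [h1], h2⟩
  | neg φ ih =>
    intro ψ s t h
    cases ψ <;> simp only [encodeFormula, List.cons_append, List.cons.injEq, reduceCtorEq,
      false_and, true_and] at h
    obtain ⟨h1, h2⟩ := ih h
    exact ⟨by rw [h1], h2⟩
  | conj φ φ' ih ih' | disj φ φ' ih ih' =>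
    intro ψ s t h
    cases ψ <;> simp only [encodeFormula, List.cons_append, List.cons.injEq, reduceCtorEq,
      false_and, true_and, List.append_assoc] at h
    obtain ⟨h1, h2⟩ := ih h
    obtain ⟨h3, h4⟩ := ih' h2
    exact ⟨by rw [h1, h3], h4⟩

/-! ### The existential theory of the reals -/

/-- An existential sentence `∃ x_1 … ∃ x_n, Φ(x_1, …, x_n)`: the number `n` of quantified
variables and the quantifier-free formula `Φ`. -/
structure ExistentialSentence where
  n : ℕ
  formula : Formula n

/-- The list of quantified variables (in unary), followed by the formula. -/
def encodeSentence (S : ExistentialSentence) : List Symbol :=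
  encodeUnary S.n ++ encodeFormula S.formula

theorem encodeSentence_injective : Function.Injective encodeSentence := by
  rintro ⟨n, φ⟩ ⟨m, ψ⟩ h
  obtain ⟨h1, h2⟩ := prefixInjective_encodeUnary h
  dsimp only at h1
  subst h1
  obtain rfl := prefixInjective_encodeFormula.injective h2
  rfl

/-- The existential theory of the reals: is a given existential sentence true in `ℝ`? -/
def ETR : DecisionProblem where
  Instance := ExistentialSentence
  Alphabet := Symbol
  alphabetFintype := inferInstance
  encode := encodeSentence
  encode_injective := encodeSentence_injective
  Yes S := ∃ x : Fin S.n → ℝ, S.formula.Holds x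

/-- The class `∃ℝ`: the problems that reduce to the existential theory of the reals. -/
def ExistsReal : Set DecisionProblem := {P | PolyReducible P ETR}

/-- Hardness for `∃ℝ` under polynomial-time many-one reductions. -/
def ExistsRealHard (P : DecisionProblem) : Prop := ∀ Q ∈ ExistsReal, PolyReducible Q P

/-- Completeness for `∃ℝ`. -/
def ExistsRealComplete (P : DecisionProblem) : Prop := P ∈ ExistsReal ∧ ExistsRealHard P

/-! ### The problem Feas -/

/-- An instance of Feas: a polynomial in `ℤ[y_1, …, y_m]`. -/
structure FeasInstance where
  m : ℕ
  r : Poly m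

/-- The list of variables (in unary), followed by the polynomial. -/
def encodeFeas (I : FeasInstance) : List Symbol :=
  encodeUnary I.m ++ encodePoly I.r

theorem encodeFeas_injective : Function.Injective encodeFeas := by
  rintro ⟨n, p⟩ ⟨m, q⟩ h
  obtain ⟨h1, h2⟩ := prefixInjective_encodeUnary h
  dsimp only at h1
  subst h1
  obtain rfl := prefixInjective_encodePoly.injective h2
  rfl

/-- Feas: does a given integer polynomial have a real zero? -/
def Feas : DecisionProblem where
  Instance := FeasInstance
  Alphabet := Symbol
  alphabetFintype := inferInstance
  encode := encodeFeas
  encode_injective := encodeFeas_injective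
  Yes I := ∃ y : Fin I.m → ℝ, I.r.eval y = 0

/-! ### Continuous Multi-Region Clustering -/

/-- An instance of Continuous Multi-Region Clustering: a polynomial `f ∈ ℤ[x_1, …, x_d]`,
rational numbers `θ > 0` and `δ > 0`, and an integer `k ≥ 1`. -/
structure CMRCInstance where
  d : ℕ
  k : ℕ
  θ : ℚ
  δ : ℚ
  f : Poly d
  one_le_k : 1 ≤ k
  θ_pos : 0 < θ
  δ_pos : 0 < δ

/-- The list of variables and the number of points in unary, the rational parameters as fractions
in binary, then the polynomial. -/
def encodeCMRC (I : CMRCInstance) : List Symbol :=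
  encodeUnary I.d ++ (encodeUnary I.k ++ (encodeRat I.θ ++ (encodeRat I.δ ++ encodePoly I.f)))

theorem encodeCMRC_injective : Function.Injective encodeCMRC := by
  rintro ⟨d, k, θ, δ, f, _, _, _⟩ ⟨d', k', θ', δ', f', _, _, _⟩ h
  obtain ⟨h1, h⟩ := prefixInjective_encodeUnary h
  obtain ⟨h2, h⟩ := prefixInjective_encodeUnary h
  obtain ⟨h3, h⟩ := prefixInjective_encodeRat h
  obtain ⟨h4, h⟩ := prefixInjective_encodeRat h
  dsimp only at h1 h2 h3 h4
  subst h1 h2 h3 h4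
  obtain rfl := prefixInjective_encodePoly.injective h
  rfl

/-- Continuous Multi-Region Clustering: are there `k` points of `ℝ^d`, pairwise at Euclidean
distance at least `δ`, at each of which `f` is at least `θ`? -/
def CMRC : DecisionProblem where
  Instance := CMRCInstance
  Alphabet := Symbol
  alphabetFintype := inferInstance
  encode := encodeCMRC
  encode_injective := encodeCMRC_injective
  Yes I := ∃ p : Fin I.k → EuclideanSpace ℝ (Fin I.d),
    (∀ i, (I.θ : ℝ) ≤ I.f.eval (p i).ofLp) ∧ ∀ i j, i ≠ j → (I.δ : ℝ) ≤ ‖p i - p j‖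

/-- The restriction of Continuous Multi-Region Clustering to `k = 2`, `θ = 1`, `δ = 1`. -/
def CMRCTwo : DecisionProblem :=
  CMRC.restrict fun I : CMRCInstance => I.k = 2 ∧ I.θ = 1 ∧ I.δ = 1

end RealComplexity

/-! Hardness rests on functions of the form `1` minus a sum of squares: such a function is at least
`1` exactly where all the squared polynomials vanish. Once the truth of an existential sentence is
expressed by a system of polynomial equations, it becomes the question whether such an `f` attains
`1`. One more coordinate that does not occur in `f` splits a solution into two points at distance
`1`, so `k = 2` and `θ = δ = 1` suffice (`yes_clusteringOfSentence`).

The equations describe a computation on the encoded sentence. A finite automaton determines the role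
of every symbol, and the truth value is computed from right to left: prefix notation then becomes
evaluation with a stack, binary coefficients are evaluated by Horner's rule, and powers by repeated
squaring. Every position of the word receives a block of real variables for the registers;
neighbouring blocks are tied by a bounded number of equations that depend only on the state and the
symbol. The stack of truth values is one real number with digits `0` and `2` in base `4`, and a
comparison with zero is expressed by writing the sum as a difference of two squares, one of which
vanishes. Soundness and solvability of one step are `represents_of_constraints` and
`exists_constraints`. Since the equations are local, the reduction is one pass over the word,
without parsing and without arithmetic on binary numbers.

For membership, the coordinates of all points are quantified, together with two variables that
linear equations force to equal `θ` and `δ`; the conditions become polynomial inequalities, with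
distances squared (`yes_sentenceOfClustering`). An instance of Feas is a sentence with a single
equation, so it reaches clustering by way of `ETR`.

Polynomial time is proved with a small language of programs on ranked stacks. The ranking makes
growth additive: a run enlarges the stacks of one rank by at most a polynomial in the total length
of the stacks of lower rank (`exists_tier_le`). This bounds the number of steps (`exists_cost_le`),
and programs compile to Turing machines (`reachesIn_code`). Hardness for the whole class follows
from hardness for `ETR` because polynomial-time machines can be composed
(`exists_comp_computableInPolyTime`). -/

open Function Turing StateTransition

namespace RealComplexity

/-! ### Reachability in a bounded number of steps -/

/-- `c'` is reached from `c` in at most `n` steps. -/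
def ReachesIn {σ : Type*} (f : σ → Option σ) (n : ℕ) (c c' : σ) : Prop :=
  ∃ k ≤ n, (flip bind f)^[k] (some c) = some c'

namespace ReachesIn

variable {σ : Type*} {f : σ → Option σ} {m n : ℕ} {a b c : σ}

theorem refl (f : σ → Option σ) (n : ℕ) (c : σ) : ReachesIn f n c c := ⟨0, Nat.zero_le _, rfl⟩

theorem trans (h₁ : ReachesIn f m a b) (h₂ : ReachesIn f n b c) : ReachesIn f (m + n) a c := by
  obtain ⟨k, hk, h₁⟩ := h₁
  obtain ⟨l, hl, h₂⟩ := h₂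
  refine ⟨l + k, by omega, ?_⟩
  rw [iterate_add_apply, h₁, h₂]

theorem mono (h : ReachesIn f m a b) (hmn : m ≤ n) : ReachesIn f n a b :=
  h.imp fun _ hk => ⟨hk.1.trans hmn, hk.2⟩

theorem single (h : f a = some b) : ReachesIn f 1 a b := ⟨1, le_rfl, h⟩

theorem head (h : f a = some b) (h' : ReachesIn f n b c) : ReachesIn f (n + 1) a c := by
  rw [Nat.add_comm]
  exact (single h).trans h'

end ReachesIn

/-- The choice of a computation that witnesses reachability. -/
noncomputable def ReachesIn.evalsToInTime {σ : Type*} {f : σ → Option σ} {n : ℕ} {c c' : σ}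
    (h : ReachesIn f n c c') : EvalsToInTime f c (some c') n where
  steps := h.choose
  evals_in_steps := h.choose_spec.2
  steps_le_m := h.choose_spec.1

theorem reachesIn_of_evalsToInTime {σ : Type*} {f : σ → Option σ} {n : ℕ} {c c' : σ}
    (h : EvalsToInTime f c (some c') n) : ReachesIn f n c c' :=
  ⟨h.steps, h.steps_le_m, h.evals_in_steps⟩

theorem eval_mono (P : Polynomial ℕ) : Monotone fun n => P.eval n := by
  intro m n h
  simp only [Polynomial.eval_eq_sum, Polynomial.sum]
  gcongr

/-! ### Programs on stacks -/

/-- Programs that manipulate stacks of letters: `copy r s` puts the contents of `r` on top of `s`,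
`cases r f` inspects the top of `r`, and `loop r f` empties the stack `r`, letter by letter, and
executes `f a` for every letter `a` that was removed. -/
inductive StackProg (R A : Type) : Type
  | skip
  | push (r : R) (a : A)
  | pop (r : R)
  | copy (r s : R)
  | seq (p q : StackProg R A)
  | cases (r : R) (f : Option A → StackProg R A)
  | loop (r : R) (f : A → StackProg R A)

namespace StackProg

variable {R A : Type}

section Semantics

variable [DecidableEq R]

/-- The effect of a loop with counter stack `r` and body `f`. -/
def loopRun (r : R) (f : A → (R → List A) → R → List A) : List A → (R → List A) → R → List A
  | [], ρ => update ρ r []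
  | a :: l, ρ => loopRun r f l (f a (update ρ r l))

/-- The effect of a program on the stacks. -/
def run : StackProg R A → (R → List A) → R → List A
  | skip, ρ => ρ
  | push r a, ρ => update ρ r (a :: ρ r)
  | pop r, ρ => update ρ r (ρ r).tail
  | copy r s, ρ => update ρ s (ρ r ++ ρ s)
  | seq p q, ρ => q.run (p.run ρ)
  | cases r f, ρ => (f (ρ r).head?).run ρ
  | loop r f, ρ => loopRun r (fun a => (f a).run) (ρ r) ρ

/-- The number of steps taken by a loop whose body `f` takes `c` steps. -/
def loopCost (r : R) (f : A → (R → List A) → R → List A) (c : A → (R → List A) → ℕ) :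
    List A → (R → List A) → ℕ
  | [], _ => 1
  | a :: l, ρ => c a (update ρ r l) + loopCost r f c l (f a (update ρ r l)) + 1

/-- The number of steps taken by a program. -/
def cost : StackProg R A → (R → List A) → ℕ
  | skip, _ => 0
  | push _ _, _ => 1
  | pop _, _ => 1
  | copy r _, ρ => 2 * (ρ r).length + 2
  | seq p q, ρ => p.cost ρ + q.cost (p.run ρ)
  | cases r f, ρ => (f (ρ r).head?).cost ρ + 1
  | loop r f, ρ => loopCost r (fun a => (f a).run) (fun a => (f a).cost) (ρ r) ρ

/-- The program changes only stacks of rank above `m`. -/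
def WritesAbove (rank : R → ℕ) (m : ℕ) : StackProg R A → Prop
  | skip => True
  | push r _ => m < rank r
  | pop r => m < rank r
  | copy _ s => m < rank s
  | seq p q => p.WritesAbove rank m ∧ q.WritesAbove rank m
  | cases _ f => ∀ o, (f o).WritesAbove rank m
  | loop r f => m < rank r ∧ ∀ a, (f a).WritesAbove rank m

/-- Stacks are copied only to stacks of higher rank, and the bodies of loops change only stacks of
higher rank than the counter. -/
def WellRanked (rank : R → ℕ) : StackProg R A → Prop
  | skip => True
  | push _ _ => True
  | pop _ => True
  | copy r s => rank r < rank s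
  | seq p q => p.WellRanked rank ∧ q.WellRanked rank
  | cases _ f => ∀ o, (f o).WellRanked rank
  | loop r f => ∀ a, (f a).WellRanked rank ∧ (f a).WritesAbove rank (rank r)

/-- With `m` the rank of a loop counter, this says that the body leaves the counter alone, so that
the loop makes exactly one turn for each letter the counter holds at the outset. -/
theorem run_eq_of_writesAbove {rank : R → ℕ} {m : ℕ} (p : StackProg R A)
    (hp : p.WritesAbove rank m) (ρ : R → List A) {r : R} (hr : rank r ≤ m) :
    p.run ρ r = ρ r := by
  induction p generalizing ρ with
  | skip => rfl
  | push s a | pop s | copy _ s =>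
    have : r ≠ s := by rintro rfl; simp only [WritesAbove] at hp; omega
    simp [run, this]
  | seq p q ihp ihq => rw [run, ihq hp.2, ihp hp.1]
  | cases s f ih => exact ih _ (hp _) ρ
  | loop s f ih =>
    have hs : r ≠ s := by rintro rfl; have := hp.1; omega
    rw [run]
    generalize ρ s = l
    induction l generalizing ρ with
    | nil => simp [loopRun, hs]
    | cons a l ihl => rw [loopRun, ihl, ih a (hp.2 a)]; simp [hs]

end Semantics

/-! ### Well-ranked programs run in polynomial time -/

section Growth

variable [Fintype R] (rank : R → ℕ)

/-- The total length of the stacks of rank `m`. -/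
def tier (m : ℕ) (ρ : R → List A) : ℕ := ∑ r with rank r = m, (ρ r).length

/-- The total length of the stacks of rank below `m`. -/
def lowSize (m : ℕ) (ρ : R → List A) : ℕ := ∑ i ∈ Finset.range m, tier rank i ρ

theorem lowSize_succ (m : ℕ) (ρ : R → List A) :
    lowSize rank (m + 1) ρ = lowSize rank m ρ + tier rank m ρ := Finset.sum_range_succ _ _

theorem lowSize_mono (ρ : R → List A) : Monotone fun m => lowSize rank m ρ := by
  intro m n h
  exact Finset.sum_le_sum_of_subset (Finset.range_mono h)

theorem tier_le_lowSize {m n : ℕ} (h : m < n) (ρ : R → List A) : tier rank m ρ ≤ lowSize rank n ρ :=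
  Finset.single_le_sum (f := fun i => tier rank i ρ) (fun _ _ => Nat.zero_le _)
    (Finset.mem_range.2 h)

theorem length_le_tier (r : R) (ρ : R → List A) : (ρ r).length ≤ tier rank (rank r) ρ :=
  Finset.single_le_sum (f := fun r => (ρ r).length) (fun _ _ => Nat.zero_le _) (by simp)

/-- A bound for the total length of the stacks of rank below `m` during a loop with at most `X`
turns, if `P i` bounds the growth of the stacks of rank `i` in one turn. -/
noncomputable def loopBound (P : ℕ → Polynomial ℕ) : ℕ → Polynomial ℕ
  | 0 => 0
  | m + 1 => loopBound P m + Polynomial.X + Polynomial.X * (P m).comp (loopBound P m)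

section

variable {rank}

/-- Induction on the rank: tier `m` started with at most `N` letters, and each of the `t ≤ N` turns
so far added at most the value of `P m` at the bound already known for the lower tiers. -/
theorem lowSize_le_loopBound {P : ℕ → Polynomial ℕ} {M N t : ℕ} {T : ℕ → ℕ} {ρ : R → List A}
    (hT : ∀ m < M, T m ≤ N) (ht : t ≤ N)
    (h : ∀ m ≤ M, tier rank m ρ ≤ T m + t * (P m).eval ((loopBound P m).eval N)) :
    ∀ m ≤ M, lowSize rank m ρ ≤ (loopBound P m).eval N := by
  intro m hm
  induction m with
  | zero => simp [lowSize]
  | succ m ih =>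
    have h1 := ih (by omega)
    have h2 := h m (by omega)
    have h3 := hT m hm
    rw [lowSize_succ]
    simp only [loopBound, Polynomial.eval_add, Polynomial.eval_mul, Polynomial.eval_X,
      Polynomial.eval_comp]
    have h4 := Nat.mul_le_mul_right ((P m).eval ((loopBound P m).eval N)) ht
    omega

/-- Serves sequential composition, where the bounds for the second program refer to the sizes after
the first. -/
theorem exists_lowSize_le {g : (R → List A) → R → List A}
    (h : ∀ m, ∃ P : Polynomial ℕ, ∀ ρ,
      tier rank m (g ρ) ≤ tier rank m ρ + P.eval (lowSize rank m ρ)) (m : ℕ) :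
    ∃ P : Polynomial ℕ, ∀ ρ, lowSize rank m (g ρ) ≤ P.eval (lowSize rank m ρ) := by
  induction m with
  | zero => exact ⟨0, fun ρ => by simp [lowSize]⟩
  | succ m ih =>
    obtain ⟨P, hP⟩ := ih
    obtain ⟨Q, hQ⟩ := h m
    refine ⟨P + Polynomial.X + Q, fun ρ => ?_⟩
    have e1 := hP ρ
    have e2 := hQ ρ
    have hle : lowSize rank m ρ ≤ lowSize rank (m + 1) ρ := lowSize_mono rank ρ (Nat.le_succ m)
    have e3 := eval_mono P hle
    have e4 := eval_mono Q hle
    have e5 := tier_le_lowSize rank (Nat.lt_add_one m) ρ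
    simp only [Polynomial.eval_add, Polynomial.eval_X] at *
    rw [lowSize_succ rank m (g ρ)]
    omega

end

variable [DecidableEq R]

theorem tier_update_of_le (m : ℕ) (ρ : R → List A) (r : R) (l : List A) (c : ℕ)
    (h : l.length ≤ (ρ r).length + c) :
    tier rank m (update ρ r l) ≤ tier rank m ρ + if rank r = m then c else 0 := by
  unfold tier
  calc ∑ s with rank s = m, (update ρ r l s).length
      ≤ ∑ s with rank s = m, ((ρ s).length + if s = r then c else 0) := by
        refine Finset.sum_le_sum fun s _ => ?_
        by_cases hs : s = r
        · subst hs; simpa using h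
        · simp [hs]
    _ = _ := by
        rw [Finset.sum_add_distrib, Finset.sum_ite_eq']
        simp

theorem tier_update_le (m : ℕ) (ρ : R → List A) (r : R) (l : List A)
    (h : l.length ≤ (ρ r).length) : tier rank m (update ρ r l) ≤ tier rank m ρ := by
  simpa using tier_update_of_le rank m ρ r l 0 (by simpa using h)

variable {rank}

/-- Induction on the remaining letters, with `t` turns already made. The invariant adds the same
amount to tier `m` in every turn, because the lower tiers stay below `loopBound` throughout. The
initial size `T M` of the top tier enters only as a summand and need not be at most `N`; growth
therefore stays additive when loops are nested. -/
theorem tier_loopRun_le {r : R} {f : A → (R → List A) → R → List A}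
    (hr : ∀ a ρ, f a ρ r = ρ r) {P : ℕ → Polynomial ℕ}
    (hP : ∀ m a ρ, tier rank m (f a ρ) ≤ tier rank m ρ + (P m).eval (lowSize rank m ρ))
    {c : A → (R → List A) → ℕ} {C : Polynomial ℕ} {M N : ℕ}
    (hC : ∀ a ρ, c a ρ ≤ C.eval (lowSize rank M ρ))
    {T : ℕ → ℕ} (hT : ∀ m < M, T m ≤ N) (l : List A) (t : ℕ) (ht : t + l.length ≤ N)
    (ρ : R → List A) (hl : ρ r = l)
    (h : ∀ m ≤ M, tier rank m ρ ≤ T m + t * (P m).eval ((loopBound P m).eval N)) :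
    (∀ m ≤ M, tier rank m (loopRun r f l ρ) ≤
      T m + N * (P m).eval ((loopBound P m).eval N)) ∧
    loopCost r f c l ρ ≤ 1 + l.length * (C.eval ((loopBound P M).eval N) + 1) := by
  induction l generalizing t ρ with
  | nil =>
    refine ⟨fun m hm => ?_, by simp [loopCost]⟩
    refine (tier_update_le rank m ρ r [] (by simp)).trans ((h m hm).trans ?_)
    have : t ≤ N := by simpa using ht
    gcongr
  | cons a l ih =>
    simp only [List.length_cons] at ht
    set ρ₁ := update ρ r l with hρ₁
    have h₁ : ∀ m ≤ M, tier rank m ρ₁ ≤ T m + t * (P m).eval ((loopBound P m).eval N) :=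
      fun m hm => (tier_update_le rank m ρ r l (by simp [hl])).trans (h m hm)
    have hb := lowSize_le_loopBound hT (by omega) h₁
    have h₂ : ∀ m ≤ M, tier rank m (f a ρ₁) ≤
        T m + (t + 1) * (P m).eval ((loopBound P m).eval N) := by
      intro m hm
      have e1 := hP m a ρ₁
      have e2 := h₁ m hm
      have e3 := eval_mono (P m) (hb m hm)
      simp only at e3
      rw [Nat.add_mul]
      omega
    obtain ⟨i1, i2⟩ := ih (t + 1) (by omega) (f a ρ₁) (by rw [hr, hρ₁]; simp) h₂
    refine ⟨i1, ?_⟩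
    have e1 := hC a ρ₁
    have e2 := eval_mono C (hb M le_rfl)
    simp only at e2
    rw [loopCost, ← hρ₁, List.length_cons, Nat.add_mul]
    omega

variable [Fintype A]

/-- The size of tier `m` itself has coefficient one in the bound; otherwise iteration could lead to
exponential growth. A copy obeys this because its source has lower rank, and a loop because its
counter, and hence the number of turns, belongs to a lower tier than the stacks that grow. -/
theorem exists_tier_le (p : StackProg R A) (hp : p.WellRanked rank) (m : ℕ) :
    ∃ P : Polynomial ℕ, ∀ ρ,
      tier rank m (p.run ρ) ≤ tier rank m ρ + P.eval (lowSize rank m ρ) := by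
  induction p generalizing m with
  | skip => exact ⟨0, fun ρ => by simp [run]⟩
  | push r a =>
    refine ⟨1, fun ρ => (tier_update_of_le rank m ρ r _ 1 (by simp)).trans ?_⟩
    simp only [Polynomial.eval_one]
    split_ifs <;> omega
  | pop r =>
    exact ⟨0, fun ρ => (tier_update_le rank m ρ r _ (by simp)).trans (by simp)⟩
  | copy r s =>
    refine ⟨Polynomial.X, fun ρ =>
      (tier_update_of_le rank m ρ s _ (ρ r).length (by simp [Nat.add_comm])).trans ?_⟩
    rw [Polynomial.eval_X]
    split_ifs with h
    · have hp : rank r < rank s := hp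
      have := (length_le_tier rank r ρ).trans (tier_le_lowSize rank (hp.trans_eq h) ρ)
      omega
    · omega
  | seq p q ihp ihq =>
    obtain ⟨P, hP⟩ := ihp hp.1 m
    obtain ⟨Q, hQ⟩ := ihq hp.2 m
    obtain ⟨B, hB⟩ := exists_lowSize_le (ihp hp.1) m
    refine ⟨P + Q.comp B, fun ρ => ?_⟩
    have e1 := hP ρ
    have e2 := hQ (p.run ρ)
    have e3 := eval_mono Q (hB ρ)
    simp only [Polynomial.eval_add, Polynomial.eval_comp, run] at *
    omega
  | cases r f ih =>
    choose P hP using fun o => ih o (hp o) m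
    -- There are finitely many branches, so the sum of their bounds dominates each of them.
    refine ⟨∑ o, P o, fun ρ => (hP _ ρ).trans ?_⟩
    rw [Polynomial.eval_finsetSum]
    gcongr
    exact Finset.single_le_sum (f := fun o => (P o).eval (lowSize rank m ρ))
      (fun _ _ => Nat.zero_le _) (Finset.mem_univ _)
  | loop r f ih =>
    choose Q hQ using fun i a => ih a (hp a).1 i
    have hP : ∀ i a ρ, tier rank i ((f a).run ρ) ≤
        tier rank i ρ + (∑ a, Q i a).eval (lowSize rank i ρ) := fun i a ρ => by
      refine (hQ i a ρ).trans ?_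
      rw [Polynomial.eval_finsetSum]
      gcongr
      exact Finset.single_le_sum (f := fun a => (Q i a).eval (lowSize rank i ρ))
        (fun _ _ => Nat.zero_le _) (Finset.mem_univ _)
    -- Up to the rank of the counter nothing grows: the body writes only above that rank, and the
    -- counter itself is emptied.
    by_cases hm : m ≤ rank r
    · refine ⟨0, fun ρ => ?_⟩
      rw [Polynomial.eval_zero, Nat.add_zero]
      refine Finset.sum_le_sum fun s hs => ?_
      simp only [Finset.mem_filter, Finset.mem_univ, true_and] at hs
      rw [run]
      suffices ∀ l : List A, l.length ≤ (ρ r).length →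
          (loopRun r (fun a => (f a).run) l ρ s).length ≤ (ρ s).length from this _ le_rfl
      intro l hl
      induction l generalizing ρ with
      | nil =>
        by_cases h : s = r
        · subst h; simp [loopRun]
        · simp [loopRun, h]
      | cons a l ihl =>
        have key := run_eq_of_writesAbove (f a) (hp a).2 (update ρ r l) (r := s) (by omega)
        have key' := run_eq_of_writesAbove (f a) (hp a).2 (update ρ r l) (r := r) le_rfl
        rw [loopRun]
        refine (ihl _ (by rw [key']; simp)).trans ?_
        rw [key]
        by_cases h : s = r
        · subst h; simp at hl ⊢; omega
        · simp [h]
    · push Not at hm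
      set P : ℕ → Polynomial ℕ := fun i => ∑ a, Q i a
      refine ⟨Polynomial.X * (P m).comp (loopBound P m), fun ρ => ?_⟩
      -- Only the half about growth is needed here, so the cost is taken to be zero.
      have := (tier_loopRun_le (rank := rank) (r := r) (f := fun a => (f a).run) (P := P)
        (fun a ρ => run_eq_of_writesAbove (f a) (hp a).2 ρ le_rfl) hP (c := fun _ _ => 0) (C := 0)
        (M := m) (N := lowSize rank m ρ) (by simp) (T := fun i => tier rank i ρ)
        (fun i hi => tier_le_lowSize rank hi ρ) (ρ r) 0
        (by simpa using (length_le_tier rank r ρ).trans (tier_le_lowSize rank hm ρ)) ρ rfl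
        (by simp)).1 m le_rfl
      simpa [run] using this

/-- With `M` above all ranks, `lowSize rank M` is the total length of all stacks. The number of
turns of a loop is at most this length, and the cost of a turn is bounded by means of the sizes that
`tier_loopRun_le` allows during the loop. -/
theorem exists_cost_le (p : StackProg R A) (hp : p.WellRanked rank) {M : ℕ}
    (hM : ∀ r, rank r < M) :
    ∃ C : Polynomial ℕ, ∀ ρ, p.cost ρ ≤ C.eval (lowSize rank M ρ) := by
  induction p with
  | skip => exact ⟨0, fun ρ => by simp [cost]⟩
  | push r a => exact ⟨1, fun ρ => by simp [cost]⟩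
  | pop r => exact ⟨1, fun ρ => by simp [cost]⟩
  | copy r s =>
    refine ⟨2 * Polynomial.X + 2, fun ρ => ?_⟩
    have := (length_le_tier rank r ρ).trans (tier_le_lowSize rank (hM r) ρ)
    simp [cost]
    omega
  | seq p q ihp ihq =>
    obtain ⟨P, hP⟩ := ihp hp.1
    obtain ⟨Q, hQ⟩ := ihq hp.2
    obtain ⟨B, hB⟩ := exists_lowSize_le (exists_tier_le p hp.1) M
    refine ⟨P + Q.comp B, fun ρ => ?_⟩
    have e1 := hP ρ
    have e2 := hQ (p.run ρ)
    have e3 := eval_mono Q (hB ρ)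
    simp only [Polynomial.eval_add, Polynomial.eval_comp, cost] at *
    omega
  | cases r f ih =>
    choose P hP using fun o => ih o (hp o)
    refine ⟨∑ o, P o + 1, fun ρ => ?_⟩
    rw [cost, Polynomial.eval_add, Polynomial.eval_finsetSum, Polynomial.eval_one]
    gcongr
    exact (hP _ ρ).trans (Finset.single_le_sum (f := fun o => (P o).eval (lowSize rank M ρ))
      (fun _ _ => Nat.zero_le _) (Finset.mem_univ _))
  | loop r f ih =>
    choose Q hQ using fun i a => exists_tier_le (f a) (hp a).1 i
    choose C hC using fun a => ih a (hp a).1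
    have hP : ∀ i a ρ, tier rank i ((f a).run ρ) ≤
        tier rank i ρ + (∑ a, Q i a).eval (lowSize rank i ρ) := fun i a ρ => by
      refine (hQ i a ρ).trans ?_
      rw [Polynomial.eval_finsetSum]
      gcongr
      exact Finset.single_le_sum (f := fun a => (Q i a).eval (lowSize rank i ρ))
        (fun _ _ => Nat.zero_le _) (Finset.mem_univ _)
    have hC' : ∀ a ρ, (f a).cost ρ ≤ (∑ a, C a).eval (lowSize rank M ρ) := fun a ρ => by
      refine (hC a ρ).trans ?_
      rw [Polynomial.eval_finsetSum]
      exact Finset.single_le_sum (f := fun a => (C a).eval (lowSize rank M ρ))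
        (fun _ _ => Nat.zero_le _) (Finset.mem_univ _)
    set P : ℕ → Polynomial ℕ := fun i => ∑ a, Q i a
    refine ⟨1 + Polynomial.X * ((∑ a, C a).comp (loopBound P M) + 1), fun ρ => ?_⟩
    have hl := (length_le_tier rank r ρ).trans (tier_le_lowSize rank (hM r) ρ)
    have := (tier_loopRun_le (rank := rank) (r := r) (f := fun a => (f a).run) (P := P)
        (fun a ρ => run_eq_of_writesAbove (f a) (hp a).2 ρ le_rfl) hP (M := M)
        (N := lowSize rank M ρ) hC' (T := fun i => tier rank i ρ)
        (fun i hi => tier_le_lowSize rank hi ρ) (ρ r) 0 (by simpa using hl) ρ rfl (by simp)).2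
    refine (show (loop r f).cost ρ ≤ _ from this).trans ?_
    simp only [Polynomial.eval_add, Polynomial.eval_mul, Polynomial.eval_X, Polynomial.eval_comp,
      Polynomial.eval_one]
    gcongr

end Growth


/-! ### Compilation of programs to Turing machines -/

/-- The labels of the machine that executes a program. -/
def Lab : StackProg R A → Type
  | skip => Empty
  | push _ _ => Unit
  | pop _ => Unit
  | copy _ _ => Bool
  | seq p q => p.Lab ⊕ q.Lab
  | cases _ f => Option (Σ o, (f o).Lab)
  | loop _ f => Option (Σ a, (f a).Lab)

theorem finite_lab [Finite A] (p : StackProg R A) : Finite p.Lab := by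
  induction p with
  | skip => exact inferInstanceAs (Finite Empty)
  | push | pop => exact inferInstanceAs (Finite Unit)
  | copy => exact inferInstanceAs (Finite Bool)
  | seq p q ihp ihq => exact inferInstanceAs (Finite (p.Lab ⊕ q.Lab))
  | cases r f ih => exact inferInstanceAs (Finite (Option (Σ o, (f o).Lab)))
  | loop r f ih => exact inferInstanceAs (Finite (Option (Σ a, (f a).Lab)))

/-- The label at which the execution of a program starts, if its labels are embedded in `Λ` by
`e` and the execution goes on at `next`. -/
def start {Λ : Type} : (p : StackProg R A) → (p.Lab → Λ) → Λ → Λ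
  | skip, _, next => next
  | push _ _, e, _ => e ()
  | pop _, e, _ => e ()
  | copy _ _, e, _ => e false
  | seq p q, e, next => p.start (fun l => e (.inl l)) (q.start (fun l => e (.inr l)) next)
  | cases _ _, e, _ => e none
  | loop _ _, e, _ => e none

/-- The stacks of the machine: the scratch stack and the stacks of the program. -/
def store (t : List A) (ρ : R → List A) : Option R → List A
  | none => t
  | some r => ρ r

/-- Emptying a list of stacks. -/
def clear (l : List R) : StackProg R A := l.foldr (fun r p => seq (loop r fun _ => skip) p) skip

theorem wellRanked_clear (rank : R → ℕ) (l : List R) :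
    (clear l : StackProg R A).WellRanked rank := by
  induction l with
  | nil => trivial
  | cons r l ih => exact ⟨fun _ => ⟨trivial, trivial⟩, ih⟩

variable [DecidableEq R]

theorem run_clear (l : List R) (ρ : R → List A) :
    (clear l).run ρ = fun r => if r ∈ l then [] else ρ r := by
  have key : ∀ (r : R) (m : List A) (ρ : R → List A),
      loopRun r (fun _ => (skip : StackProg R A).run) m ρ = update ρ r [] := by
    intro r m
    induction m with
    | nil => intro ρ; rfl
    | cons a m ih => intro ρ; rw [loopRun, ih]; simp [run]
  induction l generalizing ρ with
  | nil => simp [clear, run]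
  | cons s l ih =>
    rw [clear, List.foldr_cons, run, ← clear, ih, run, key]
    funext r
    by_cases h : r = s
    · subst h; simp
    · simp [h]

theorem update_store_some (t : List A) (ρ : R → List A) (r : R) (l : List A) :
    update (store t ρ) (some r) l = store t (update ρ r l) := by
  funext k
  cases k with
  | none => simp [store]
  | some s => by_cases h : s = r <;> simp [store, h]

theorem update_store_none (t : List A) (ρ : R → List A) (l : List A) :
    update (store t ρ) none l = store l ρ := by
  funext k
  cases k <;> simp [store]

variable [Inhabited A]

/-- The machine statements that execute a program. The stack `none` is a scratch stack. -/
def code {Λ : Type} : (p : StackProg R A) → (p.Lab → Λ) → Λ → p.Lab →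
    TM2.Stmt (fun _ : Option R => A) Λ (Option A)
  | skip, _, _ => fun l => l.elim
  | push r a, _, next => fun _ => .push (some r) (fun _ => a) (.goto fun _ => next)
  | pop r, _, next => fun _ => .pop (some r) (fun v _ => v) (.goto fun _ => next)
  | copy r s, e, next => fun l =>
    match l with
    | false => .pop (some r) (fun _ o => o) (.branch Option.isSome
        (.push none (fun v => v.getD default) (.goto fun _ => e false))
        (.goto fun _ => e true))
    | true => .pop none (fun _ o => o) (.branch Option.isSome
        (.push (some r) (fun v => v.getD default)
          (.push (some s) (fun v => v.getD default) (.goto fun _ => e true)))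
        (.goto fun _ => next))
  | seq p q, e, next => fun l =>
    match l with
    | .inl l => p.code (fun l => e (.inl l)) (q.start (fun l => e (.inr l)) next) l
    | .inr l => q.code (fun l => e (.inr l)) next l
  | cases r f, e, next => fun l =>
    match l with
    | none => .peek (some r) (fun _ o => o)
        (.goto fun v => (f v).start (fun l => e (some ⟨v, l⟩)) next)
    | some ⟨o, l⟩ => (f o).code (fun l => e (some ⟨o, l⟩)) next l
  | loop r f, e, next => fun l =>
    match l with
    | none => .pop (some r) (fun _ o => o) (.goto fun v =>
        match v with
        | none => next
        | some a => (f a).start (fun l => e (some ⟨a, l⟩)) (e none))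
    | some ⟨a, l⟩ => (f a).code (fun l => e (some ⟨a, l⟩)) (e none) l

theorem step_of_eq {K Λ σ : Type} [DecidableEq K] {Γ : K → Type} {M : Λ → TM2.Stmt Γ Λ σ} {l : Λ}
    {q : TM2.Stmt Γ Λ σ} (h : M l = q) (v : σ) (S : ∀ k, List (Γ k)) :
    TM2.step M ⟨some l, v, S⟩ = some (TM2.stepAux q v S) := by
  rw [TM2.step, h]

/-- Reading a stack destroys it, so its letters go to the scratch stack and from there back to `r`
and onto `s` at once. The two reversals cancel, and the scratch stack is empty again. Each phase
takes one step per letter and one more to notice that its source is empty. -/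
theorem reachesIn_copy {Λ : Type} {r s : R} (hrs : r ≠ s) (e : Bool → Λ) (next : Λ)
    (M : Λ → TM2.Stmt (fun _ : Option R => A) Λ (Option A))
    (hf : M (e false) = (copy r s).code e next false)
    (ht : M (e true) = (copy r s).code e next true)
    (ρ : R → List A) (v : Option A) :
    ∃ v', ReachesIn (TM2.step M) (2 * (ρ r).length + 2) ⟨some (e false), v, store [] ρ⟩
      ⟨some next, v', store [] (update ρ s (ρ r ++ ρ s))⟩ := by
  have first : ∀ (l t : List A) (v : Option A) (ρ : R → List A), ρ r = l →
      ReachesIn (TM2.step M) (l.length + 1) ⟨some (e false), v, store t ρ⟩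
        ⟨some (e true), none, store (l.reverse ++ t) (update ρ r [])⟩ := by
    intro l
    induction l with
    | nil =>
      intro t v ρ h
      refine ReachesIn.single ?_
      rw [step_of_eq hf]
      simp only [code, TM2.stepAux, store, h, List.head?_nil, Option.isSome_none, cond_false,
        List.tail_nil, update_store_some, List.reverse_nil, List.nil_append]
    | cons a l ih =>
      intro t v ρ h
      have := ih (a :: t) (some a) (update ρ r l) (by simp)
      rw [update_idem] at this
      refine ReachesIn.head (b := ⟨some (e false), some a, store (a :: t) (update ρ r l)⟩)
        ?_ ?_
      · rw [step_of_eq hf]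
        simp only [code, TM2.stepAux, store, h, List.head?_cons, Option.isSome_some, cond_true,
          List.tail_cons, update_store_some, update_store_none, Option.getD_some]
      · simpa using this
  have second : ∀ (t : List A) (v : Option A) (ρ : R → List A),
      ReachesIn (TM2.step M) (t.length + 1) ⟨some (e true), v, store t ρ⟩
        ⟨some next, none, store [] (update (update ρ r (t.reverse ++ ρ r)) s
          (t.reverse ++ ρ s))⟩ := by
    intro t
    induction t with
    | nil =>
      intro v ρ
      refine ReachesIn.single ?_
      rw [step_of_eq ht]
      simp [code, store, update_store_none]
    | cons a t ih =>
      intro v ρ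
      have := ih (some a) (update (update ρ r (a :: ρ r)) s (a :: ρ s))
      refine ReachesIn.head
        (b := ⟨some (e true), some a, store t (update (update ρ r (a :: ρ r)) s (a :: ρ s))⟩)
        ?_ ?_
      · rw [step_of_eq ht]
        simp only [code, TM2.stepAux, store, List.head?_cons, Option.isSome_some, cond_true,
          List.tail_cons, update_store_some, update_store_none, Option.getD_some,
          update_of_ne hrs.symm]
      · refine Eq.mp ?_ this
        congr 3
        funext x
        by_cases h1 : x = s
        · subst h1; simp
        · by_cases h2 : x = r
          · subst h2; simp [h1]
          · simp [h1, h2]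
  refine ⟨none, ?_⟩
  have h := (first (ρ r) [] v ρ rfl).trans (second _ none _)
  refine Eq.mp ?_ (h.mono (n := 2 * (ρ r).length + 2) (by simp; omega))
  congr 3
  funext x
  by_cases h1 : x = s
  · subst h1; simp [hrs.symm]
  · by_cases h2 : x = r
    · subst h2; simp [h1]
    · simp [h1]

/-- The embedding of the labels and the continuation `next` have to vary in the induction: in a
sequence the first part continues at the start of the second, and the body of a loop continues at
the head of the loop. The ranking guarantees that the two stacks of a copy differ and that a body
does not touch the counter. -/
theorem reachesIn_code {Λ : Type} {rank : R → ℕ} (p : StackProg R A) (hp : p.WellRanked rank)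
    (e : p.Lab → Λ) (next : Λ) (M : Λ → TM2.Stmt (fun _ : Option R => A) Λ (Option A))
    (hM : ∀ l, M (e l) = p.code e next l) (ρ : R → List A) (v : Option A) :
    ∃ v', ReachesIn (TM2.step M) (p.cost ρ) ⟨some (p.start e next), v, store [] ρ⟩
      ⟨some next, v', store [] (p.run ρ)⟩ := by
  induction p generalizing next ρ v with
  | skip => exact ⟨v, ReachesIn.refl _ _ _⟩
  | push r a =>
    refine ⟨v, ReachesIn.single ?_⟩
    rw [start, step_of_eq (hM ())]
    simp only [code, TM2.stepAux, update_store_some, store, run]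
  | pop r =>
    refine ⟨v, ReachesIn.single ?_⟩
    rw [start, step_of_eq (hM ())]
    simp only [code, TM2.stepAux, update_store_some, store, run]
  | copy r s =>
    refine reachesIn_copy ?_ e next M (hM false) (hM true) ρ v
    rintro rfl
    exact lt_irrefl _ hp
  | seq p q ihp ihq =>
    obtain ⟨v₁, h₁⟩ := ihp hp.1 (fun l => e (.inl l)) (q.start (fun l => e (.inr l)) next)
      (fun l => hM (.inl l)) ρ v
    obtain ⟨v₂, h₂⟩ := ihq hp.2 (fun l => e (.inr l)) next (fun l => hM (.inr l)) (p.run ρ) v₁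
    exact ⟨v₂, h₁.trans h₂⟩
  | cases r f ih =>
    obtain ⟨v₁, h₁⟩ := ih (ρ r).head? (hp _) (fun l => e (some ⟨_, l⟩)) next
      (fun l => (hM (some ⟨_, l⟩)).trans (by simp only [code])) ρ (ρ r).head?
    refine ⟨v₁, ReachesIn.head ?_ h₁⟩
    rw [start, step_of_eq (hM none)]
    simp only [code, TM2.stepAux, store]
  | loop r f ih =>
    rw [run, cost]
    suffices ∀ (l : List A) (ρ : R → List A) (v : Option A), ρ r = l →
        ∃ v', ReachesIn (TM2.step M) (loopCost r (fun a => (f a).run) (fun a => (f a).cost) l ρ)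
          ⟨some (e none), v, store [] ρ⟩
          ⟨some next, v', store [] (loopRun r (fun a => (f a).run) l ρ)⟩ from this _ _ _ rfl
    intro l
    induction l with
    | nil =>
      intro ρ v h
      refine ⟨none, ReachesIn.single ?_⟩
      rw [step_of_eq (hM none)]
      simp only [code, TM2.stepAux, store, h, List.head?_nil, List.tail_nil, update_store_some,
        loopRun]
    | cons a l ihl =>
      intro ρ v h
      obtain ⟨v₁, h₁⟩ := ih a (hp a).1 (fun l => e (some ⟨a, l⟩)) (e none)
        (fun l => (hM (some ⟨a, l⟩)).trans (by simp only [code])) (update ρ r l) (some a)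
      obtain ⟨v₂, h₂⟩ := ihl ((f a).run (update ρ r l)) v₁
        (by rw [run_eq_of_writesAbove (f a) (hp a).2 _ le_rfl]; simp)
      refine ⟨v₂, ReachesIn.head ?_ (h₁.trans h₂)⟩
      rw [step_of_eq (hM none)]
      simp only [code, TM2.stepAux, store, h, List.head?_cons, List.tail_cons,
        update_store_some]

/-- The machine that executes a program, with input on the stack `i` and output on the
stack `o`. -/
noncomputable def machine [Fintype R] [Fintype A] (p : StackProg R A) (i o : R) : FinTM2 where
  K := Option R
  k₀ := some i
  k₁ := some o
  Γ := fun _ => A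
  Λ := Option p.Lab
  main := p.start some none
  ΛFin := @Fintype.ofFinite _ (have := p.finite_lab; inferInstance)
  σ := Option A
  initialState := none
  Γk₀Fin := ‹Fintype A›
  m l :=
    match l with
    | none => .load (fun _ => none) .halt
    | some l => p.code some none l

/-- A function that is computed by a well-ranked program is computed by a Turing machine in
polynomial time. -/
theorem computableInPolyTime [Fintype R] [Fintype A] {rank : R → ℕ} (p : StackProg R A)
    (hp : p.WellRanked rank) (i o : R) {α β : Type} {ea : α → List A} {eb : β → List A}
    {f : α → β} (h : ∀ a, p.run (update (fun _ => []) i (ea a)) o = eb (f a)) :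
    Nonempty (TM2ComputableInPolyTime ea eb f) := by
  classical
  -- A final configuration in the sense of `haltList` has all stacks except the output empty.
  let q : StackProg R A := seq p (clear ((Finset.univ.erase o).toList))
  have hq : q.WellRanked rank := ⟨hp, wellRanked_clear _ _⟩
  have hrun : ∀ a, q.run (update (fun _ => []) i (ea a)) = update (fun _ => []) o (eb (f a)) := by
    intro a
    rw [run, run_clear]
    funext r
    by_cases hr : r = o
    · subst hr; simp [h]
    · simp [hr]
  obtain ⟨M, hM⟩ : ∃ M, ∀ r, rank r < M :=
    ⟨Finset.univ.sup rank + 1, fun r => Nat.lt_succ_of_le (Finset.le_sup (Finset.mem_univ r))⟩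
  obtain ⟨C, hC⟩ := exists_cost_le q hq hM
  refine ⟨{ tm := q.machine i o, inputAlphabet := Equiv.refl A, outputAlphabet := Equiv.refl A,
            time := C + 1, outputsFun := fun a => ReachesIn.evalsToInTime ?_ }⟩
  obtain ⟨v, hv⟩ := reachesIn_code q hq some none (q.machine i o).m (fun _ => rfl)
    (update (fun _ => []) i (ea a)) none
  have hsize : lowSize rank M (update (fun _ => []) i (ea a)) ≤ (ea a).length := by
    have h0 : ∀ m, tier rank m (update (fun _ => []) i (ea a)) ≤
        if rank i = m then (ea a).length else 0 := fun m => by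
      have := tier_update_of_le rank m (fun _ => []) i (ea a) (ea a).length (by simp)
      simpa [tier] using this
    refine (Finset.sum_le_sum fun m _ => h0 m).trans ?_
    rw [Finset.sum_ite_eq]
    split_ifs <;> simp
  -- The extra label `none` resets the internal state, as `haltList` demands, and halts; this is the
  -- additional step in `C + 1`.
  have hstep : ReachesIn (TM2.step (q.machine i o).m) 1
      ⟨some none, v, store [] (q.run (update (fun _ => []) i (ea a)))⟩
      ⟨none, none, store [] (update (fun _ => []) o (eb (f a)))⟩ := by
    rw [hrun]
    exact ReachesIn.single rfl
  have hstore : ∀ (j : R) (l : List A) (k : Option R), store [] (update (fun _ => []) j l) k =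
      if k = some j then l else [] := by
    intro j l k
    cases k with
    | none => simp [store]
    | some k => by_cases hk : k = j <;> simp [store, hk]
  have hinit : initList (q.machine i o) (List.map (Equiv.refl A).invFun (ea a)) =
      ⟨some (q.start some none), none, store [] (update (fun _ => []) i (ea a))⟩ := by
    rw [initList]
    congr 1
    funext k
    by_cases hk : k = some i
    · subst hk
      exact (dif_pos rfl).trans ((List.map_id _).trans (by simp [store]))
    · exact (dif_neg hk).trans ((hstore i _ k).trans (if_neg hk)).symm
  have hhalt : haltList (q.machine i o) (List.map (Equiv.refl A).invFun (eb (f a))) =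
      ⟨none, none, store [] (update (fun _ => []) o (eb (f a)))⟩ := by
    rw [haltList]
    congr 1
    funext k
    by_cases hk : k = some o
    · subst hk
      exact (dif_pos rfl).trans ((List.map_id _).trans (by simp [store]))
    · exact (dif_neg hk).trans ((hstore o _ k).trans (if_neg hk)).symm
  rw [hinit, hhalt]
  refine (hv.trans hstep).mono ?_
  have e1 := hC (update (fun _ => []) i (ea a))
  have e2 := eval_mono C hsize
  simp only [Polynomial.eval_add, Polynomial.eval_one] at *
  omega

end StackProg


/-! ### Composition of polynomial-time computations -/

theorem initList_stk_self (tm : FinTM2) (s : List (tm.Γ tm.k₀)) :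
    (initList tm s).stk tm.k₀ = s := dif_pos rfl

theorem initList_stk_of_ne (tm : FinTM2) (s : List (tm.Γ tm.k₀)) {k : tm.K} (h : k ≠ tm.k₀) :
    (initList tm s).stk k = [] := dif_neg h

theorem haltList_stk_self (tm : FinTM2) (s : List (tm.Γ tm.k₁)) :
    (haltList tm s).stk tm.k₁ = s := dif_pos rfl

theorem haltList_stk_of_ne (tm : FinTM2) (s : List (tm.Γ tm.k₁)) {k : tm.K} (h : k ≠ tm.k₁) :
    (haltList tm s).stk k = [] := dif_neg h

/-! ### Running a machine as a part of a larger machine -/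

section Lift

variable {K K' Λ Λ' σ σ' : Type} [DecidableEq K] [DecidableEq K'] {Γ : K' → Type}

/-- Execution of a statement as a part of a larger machine: `ι` embeds the stacks, `get` and `put`
access the internal state, `lab` embeds the labels, and instead of halting the machine goes on
with `fin`. -/
def liftStmt (ι : K → K') (get : σ' → σ) (put : σ → σ' → σ') (lab : Λ → Λ')
    (fin : TM2.Stmt Γ Λ' σ') : TM2.Stmt (fun k => Γ (ι k)) Λ σ → TM2.Stmt Γ Λ' σ'
  | .push k f q => .push (ι k) (fun s => f (get s)) (liftStmt ι get put lab fin q)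
  | .peek k f q => .peek (ι k) (fun s o => put (f (get s) o) s) (liftStmt ι get put lab fin q)
  | .pop k f q => .pop (ι k) (fun s o => put (f (get s) o) s) (liftStmt ι get put lab fin q)
  | .load f q => .load (fun s => put (f (get s)) s) (liftStmt ι get put lab fin q)
  | .branch f q₁ q₂ => .branch (fun s => f (get s)) (liftStmt ι get put lab fin q₁)
      (liftStmt ι get put lab fin q₂)
  | .goto f => .goto fun s => lab (f (get s))
  | .halt => fin

/-- The configuration `c'` of the larger machine, obtained from `c₀` by executing a part that is
in configuration `c`. -/
structure LiftRel (ι : K → K') (put : σ → σ' → σ') (lab : Λ → Λ') (l : Option Λ')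
    (c₀ : TM2.Cfg Γ Λ' σ') (c : TM2.Cfg (fun k => Γ (ι k)) Λ σ) (c' : TM2.Cfg Γ Λ' σ') :
    Prop where
  lab_eq : c'.l = c.l.elim l (fun x => some (lab x))
  var_eq : c'.var = put c.var c₀.var
  stk_eq : ∀ k, c'.stk (ι k) = c.stk k
  stk_eq_of_not_mem : ∀ k, k ∉ Set.range ι → c'.stk k = c₀.stk k

variable {ι : K → K'} (hι : Injective ι) {get : σ' → σ} {put : σ → σ' → σ'}
  (hget : ∀ a s, get (put a s) = a) (hput : ∀ a b s, put a (put b s) = put a s)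
  {lab : Λ → Λ'} {fin : TM2.Stmt Γ Λ' σ'} {l : Option Λ'}
  (hfin : ∀ v S, TM2.stepAux fin v S = ⟨l, v, S⟩)

include hι hget hput hfin

/-- Since `ι` is injective, writing on one embedded stack does not disturb another, and the stacks
outside its range are never touched. The only deviation is at `halt`, where `fin` leads to the label
`l`. -/
theorem liftRel_stepAux (c₀ : TM2.Cfg Γ Λ' σ') (q : TM2.Stmt (fun k => Γ (ι k)) Λ σ) (v : σ)
    (S : ∀ k, List (Γ (ι k))) (S' : ∀ k, List (Γ k)) (hS : ∀ k, S' (ι k) = S k)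
    (hS' : ∀ k, k ∉ Set.range ι → S' k = c₀.stk k) :
    LiftRel ι put lab l c₀ (TM2.stepAux q v S)
      (TM2.stepAux (liftStmt ι get put lab fin q) (put v c₀.var) S') := by
  have hupd : ∀ (k : K) (m : List (Γ (ι k))) (S : ∀ k, List (Γ (ι k))) (S' : ∀ k, List (Γ k)),
      (∀ k, S' (ι k) = S k) → ∀ j, update S' (ι k) m (ι j) = update S k m j := by
    intro k m S S' hS j
    by_cases h : j = k
    · subst h; simp
    · simp [h, hι.ne h, hS]
  have hupd' : ∀ (k : K) (m : List (Γ (ι k))) (S' : ∀ k, List (Γ k)),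
      (∀ k, k ∉ Set.range ι → S' k = c₀.stk k) →
      ∀ j, j ∉ Set.range ι → update S' (ι k) m j = c₀.stk j := by
    intro k m S' hS' j hj
    rw [update_of_ne, hS' j hj]
    rintro rfl
    exact hj ⟨k, rfl⟩
  induction q generalizing v S S' with
  | push k f q ih =>
    simp only [liftStmt, TM2.stepAux, hget, hS]
    exact ih _ _ _ (hupd k _ S S' hS) (hupd' k _ S' hS')
  | peek k f q ih =>
    simp only [liftStmt, TM2.stepAux, hget, hput, hS]
    exact ih _ _ _ hS hS'
  | pop k f q ih =>
    simp only [liftStmt, TM2.stepAux, hget, hput, hS]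
    exact ih _ _ _ (hupd k _ S S' hS) (hupd' k _ S' hS')
  | load f q ih =>
    simp only [liftStmt, TM2.stepAux, hget, hput]
    exact ih _ _ _ hS hS'
  | branch f q₁ q₂ ih₁ ih₂ =>
    simp only [liftStmt, TM2.stepAux, hget]
    cases f v
    · exact ih₂ _ _ _ hS hS'
    · exact ih₁ _ _ _ hS hS'
  | goto f => exact ⟨by simp [liftStmt, hget], rfl, hS, hS'⟩
  | halt => exact ⟨by simp [liftStmt, hfin], by simp [liftStmt, hfin],
      by simpa [liftStmt, hfin] using hS, by simpa [liftStmt, hfin] using hS'⟩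

/-- A halted configuration has no successor, so the part can halt only in the last of the `n` steps.
Before that its label is embedded by `lab`, and the two machines move in lockstep. -/
theorem LiftRel.iterate {M : Λ → TM2.Stmt (fun k => Γ (ι k)) Λ σ} {M' : Λ' → TM2.Stmt Γ Λ' σ'}
    (hM : ∀ x, M' (lab x) = liftStmt ι get put lab fin (M x)) {c₀ : TM2.Cfg Γ Λ' σ'} (n : ℕ)
    {c d : TM2.Cfg (fun k => Γ (ι k)) Λ σ} {c' : TM2.Cfg Γ Λ' σ'}
    (h : LiftRel ι put lab l c₀ c c') (hd : (flip bind (TM2.step M))^[n] (some c) = some d) :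
    ∃ d', (flip bind (TM2.step M'))^[n] (some c') = some d' ∧ LiftRel ι put lab l c₀ d d' := by
  induction n generalizing c c' with
  | zero =>
    obtain rfl : c = d := by simpa using hd
    exact ⟨c', rfl, h⟩
  | succ n ih =>
    rw [iterate_succ_apply] at hd
    obtain ⟨lb, v, S⟩ := c
    cases lb with
    | none =>
      have hnone : ∀ n, (flip bind (TM2.step M))^[n] none = none := fun n =>
        iterate_fixed rfl n
      have : flip bind (TM2.step M) (some ⟨none, v, S⟩) = none := rfl
      rw [this, hnone] at hd
      cases hd
    | some x =>
      have e1 : flip bind (TM2.step M) (some ⟨some x, v, S⟩) =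
        some (TM2.stepAux (M x) v S) := rfl
      rw [e1] at hd
      obtain ⟨lb', v', S'⟩ := c'
      obtain ⟨h1, h2, h3, h4⟩ := h
      simp only [Option.elim_some] at h1 h2 h3 h4
      subst h1 h2
      have key := liftRel_stepAux hι hget hput hfin (lab := lab) c₀ (M x) v S S' h3 h4
      obtain ⟨d', hd', hr⟩ := ih key hd
      refine ⟨d', ?_, hr⟩
      rw [iterate_succ_apply, ← hd', ← hM]
      rfl

end Lift

/-! The length of the stacks grows linearly with the number of steps. -/

section StackGrowth

variable {K Λ σ : Type} [DecidableEq K] {Γ : K → Type}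

/-- The maximal number of letters that a statement pushes. -/
def pushCount : TM2.Stmt Γ Λ σ → ℕ
  | .push _ _ q => pushCount q + 1
  | .peek _ _ q => pushCount q
  | .pop _ _ q => pushCount q
  | .load _ q => pushCount q
  | .branch _ q₁ q₂ => pushCount q₁ + pushCount q₂
  | .goto _ => 0
  | .halt => 0

theorem length_stepAux_le (q : TM2.Stmt Γ Λ σ) (v : σ) (S : ∀ k, List (Γ k)) (k : K) :
    ((TM2.stepAux q v S).stk k).length ≤ (S k).length + pushCount q := by
  induction q generalizing v S with
  | push j f q ih =>
    refine (ih _ _).trans ?_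
    by_cases h : k = j
    · subst h; simp [pushCount, Nat.add_assoc, Nat.add_comm]
    · simp [h, pushCount, ← Nat.add_assoc]
  | peek j f q ih => exact ih _ _
  | pop j f q ih =>
    refine (ih _ _).trans ?_
    by_cases h : k = j
    · subst h; simp [pushCount]
    · simp [h, pushCount]
  | load f q ih => exact ih _ _
  | branch f q₁ q₂ ih₁ ih₂ =>
    have h1 := ih₁ v S
    have h2 := ih₂ v S
    simp only [TM2.stepAux, pushCount]
    cases f v <;> simp only [cond_true, cond_false] <;> omega
  | goto f => simp [pushCount]
  | halt => simp [pushCount]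

/-- Bounds the output of the first of two composed machines by a polynomial in the length of its
input, and with it the running time of the second. -/
theorem length_iterate_le {M : Λ → TM2.Stmt Γ Λ σ} {B : ℕ} (hB : ∀ l, pushCount (M l) ≤ B) (n : ℕ)
    {c d : TM2.Cfg Γ Λ σ} (h : (flip bind (TM2.step M))^[n] (some c) = some d) (k : K) :
    (d.stk k).length ≤ (c.stk k).length + n * B := by
  induction n generalizing d with
  | zero =>
    obtain rfl : c = d := by simpa using h
    simp
  | succ n ih =>
    rw [iterate_succ_apply'] at h
    cases hc : (flip bind (TM2.step M))^[n] (some c) with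
    | none => rw [hc] at h; cases h
    | some e =>
      rw [hc] at h
      obtain ⟨lb, v, S⟩ := e
      cases lb with
      | none => cases h
      | some x =>
        have h : some (TM2.stepAux (M x) v S) = some d := h
        obtain rfl := Option.some.inj h
        have h1 := ih hc
        have h2 := length_stepAux_le (M x) v S k
        have h3 := hB x
        rw [Nat.add_mul]
        simp only at h1
        omega

end StackGrowth

/-- A loop that moves the letters of the stack `a` to the stack `b`. -/
theorem reachesIn_move {K Λ σ : Type} [DecidableEq K] {Γ : K → Type} {M : Λ → TM2.Stmt Γ Λ σ}
    {a b : K} (hab : a ≠ b) (g : Γ a → Γ b) {get : σ → Option (Γ a)}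
    {put : Option (Γ a) → σ → σ} (hget : ∀ o s, get (put o s) = o)
    (hput : ∀ o o' s, put o (put o' s) = put o s) {e : Option (Γ a) → Λ} {next : Λ}
    (hnone : M (e none) = .pop a (fun s o => put o s)
      (.goto fun s => (get s).elim next fun x => e (some x)))
    (hsome : ∀ x, M (e (some x)) = .push b (fun _ => g x) (.goto fun _ => e none))
    (l : List (Γ a)) (v : σ) (S : ∀ k, List (Γ k)) (hl : S a = l) :
    ∃ S', ReachesIn (TM2.step M) (2 * l.length + 1) ⟨some (e none), v, S⟩
      ⟨some next, put none v, S'⟩ ∧ S' a = [] ∧ S' b = (l.map g).reverse ++ S b ∧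
      ∀ k, k ≠ a → k ≠ b → S' k = S k := by
  induction l generalizing v S with
  | nil =>
    refine ⟨S, ReachesIn.single ?_, hl, rfl, fun _ _ _ => rfl⟩
    rw [StackProg.step_of_eq hnone]
    simp only [TM2.stepAux, hl, hget, List.head?_nil, Option.elim_none, List.tail_nil]
    rw [← hl, update_eq_self]
  | cons x l ih =>
    obtain ⟨S', h1, h2, h3, h4⟩ :=
      ih (put (some x) v) (update (update S a l) b (g x :: S b)) (by simp [hab])
    rw [hput] at h1
    refine ⟨S', ReachesIn.head (b := ⟨some (e (some x)), put (some x) v, update S a l⟩) ?_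
      (ReachesIn.head (b := ⟨some (e none), put (some x) v,
        update (update S a l) b (g x :: S b)⟩) ?_ h1), h2, ?_, fun k ha hb => ?_⟩
    · rw [StackProg.step_of_eq hnone]
      simp only [TM2.stepAux, hl, hget, List.head?_cons, Option.elim_some, List.tail_cons]
    · rw [StackProg.step_of_eq (hsome x)]
      simp only [TM2.stepAux, update_of_ne hab.symm]
    · rw [h3]
      simp
    · rw [h4 k ha hb]
      simp [ha, hb]

/-! ### The composite of two machines -/

section Comp

variable (M₁ M₂ : FinTM2) (g : M₁.Γ M₁.k₁ → M₂.Γ M₂.k₀)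

/-- The alphabets of the stacks of the composite machine. -/
abbrev CompΓ : M₁.K ⊕ Unit ⊕ M₂.K → Type :=
  Sum.elim M₁.Γ (Sum.elim (fun _ => M₁.Γ M₁.k₁) M₂.Γ)

/-- The labels of the composite machine. -/
abbrev CompΛ : Type :=
  M₁.Λ ⊕ (Option (M₁.Γ M₁.k₁) ⊕ Option (M₁.Γ M₁.k₁)) ⊕ M₂.Λ

/-- The internal states of the composite machine. -/
abbrev Compσ : Type := M₁.σ × Option (M₁.Γ M₁.k₁) × M₂.σ

/-- The statements of the composite machine: the first machine is run, its output is moved to the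
input stack of the second machine by way of an auxiliary stack, and the second machine is run. -/
def compStmt : CompΛ M₁ M₂ → TM2.Stmt (CompΓ M₁ M₂) (CompΛ M₁ M₂) (Compσ M₁ M₂)
  | .inl l => liftStmt (K := M₁.K) (σ := M₁.σ) Sum.inl Prod.fst (fun a s => (a, s.2)) Sum.inl
      (.goto fun _ => .inr (.inl (.inl none))) (M₁.m l)
  | .inr (.inl (.inl none)) => .pop (.inl M₁.k₁) (fun s o => (s.1, o, s.2.2))
      (.goto fun s => s.2.1.elim (.inr (.inl (.inr none))) fun x => .inr (.inl (.inl (some x))))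
  | .inr (.inl (.inl (some x))) => .push (.inr (.inl ())) (fun _ => x)
      (.goto fun _ => .inr (.inl (.inl none)))
  | .inr (.inl (.inr none)) => .pop (.inr (.inl ())) (fun s o => (s.1, o, s.2.2))
      (.goto fun s => s.2.1.elim (.inr (.inr M₂.main)) fun x => .inr (.inl (.inr (some x))))
  | .inr (.inl (.inr (some x))) => .push (.inr (.inr M₂.k₀)) (fun _ => g x)
      (.goto fun _ => .inr (.inl (.inr none)))
  | .inr (.inr l) => liftStmt (K := M₂.K) (σ := M₂.σ) (fun k => .inr (.inr k)) (fun s => s.2.2)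
      (fun a s => (s.1, s.2.1, a)) (fun l => .inr (.inr l)) .halt (M₂.m l)

/-- The composite machine. -/
def compMachine [Fintype (M₁.Γ M₁.k₁)] : FinTM2 where
  K := M₁.K ⊕ Unit ⊕ M₂.K
  kDecidableEq := inferInstance
  kFin := letI := M₁.kFin; letI := M₂.kFin; inferInstance
  k₀ := .inl M₁.k₀
  k₁ := .inr (.inr M₂.k₁)
  Γ := CompΓ M₁ M₂
  Λ := CompΛ M₁ M₂
  main := .inl M₁.main
  ΛFin := letI := M₁.ΛFin; letI := M₂.ΛFin; inferInstance
  σ := Compσ M₁ M₂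
  initialState := (M₁.initialState, none, M₂.initialState)
  σFin := letI := M₁.σFin; letI := M₂.σFin; inferInstance
  Γk₀Fin := M₁.Γk₀Fin
  m := compStmt M₁ M₂ g

/-- Moving a word from one stack to another reverses it, which is why the output of the first
machine passes through an auxiliary stack; each of the two moves takes `2 * y.length + 1` steps.
Since `haltList` prescribes the initial state and empty stacks beside the output, nothing is left
behind that could spoil the final configuration of the composite. -/
theorem reachesIn_compMachine [Fintype (M₁.Γ M₁.k₁)] {x : List (M₁.Γ M₁.k₀)}
    {y : List (M₁.Γ M₁.k₁)} {z : List (M₂.Γ M₂.k₁)} {m n : ℕ}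
    (h₁ : ReachesIn M₁.step m (initList M₁ x) (haltList M₁ y))
    (h₂ : ReachesIn M₂.step n (initList M₂ (y.map g)) (haltList M₂ z)) :
    ReachesIn (compMachine M₁ M₂ g).step (m + (4 * y.length + 2) + n)
      (initList (compMachine M₁ M₂ g) x) (haltList (compMachine M₁ M₂ g) z) := by
  obtain ⟨k₁, hk₁, h₁⟩ := h₁
  obtain ⟨k₂, hk₂, h₂⟩ := h₂
  set C := compMachine M₁ M₂ g with hC
  have hrel₁ : LiftRel (K := M₁.K) (Γ := CompΓ M₁ M₂) Sum.inl
      (fun (a : M₁.σ) (s : Compσ M₁ M₂) => (a, s.2)) Sum.inl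
      (some (.inr (.inl (.inl none)))) (initList C x) (initList M₁ x) (initList C x) := by
    refine ⟨rfl, rfl, fun k => ?_, fun _ _ => rfl⟩
    by_cases hk : k = M₁.k₀
    · subst hk
      exact (initList_stk_self C x).trans (initList_stk_self M₁ x).symm
    · exact (initList_stk_of_ne C x fun h => hk (Sum.inl.inj h)).trans
        (initList_stk_of_ne M₁ x hk).symm
  obtain ⟨⟨l₁, v₁, S₁⟩, hd₁, e1, e2, e3, e4⟩ := LiftRel.iterate (M' := compStmt M₁ M₂ g)
    Sum.inl_injective (get := Prod.fst) (put := fun (a : M₁.σ) (s : Compσ M₁ M₂) => (a, s.2))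
    (lab := Sum.inl) (fun _ _ => rfl) (fun _ _ _ => rfl)
    (fin := .goto fun _ => .inr (.inl (.inl none))) (fun _ _ => rfl) (fun _ => rfl) k₁ hrel₁ h₁
  obtain rfl : l₁ = some (.inr (.inl (.inl none))) := e1
  obtain rfl : v₁ = (M₁.initialState, none, M₂.initialState) := e2
  have hS₁ : S₁ (.inl M₁.k₁) = y := (e3 M₁.k₁).trans (haltList_stk_self M₁ y)
  have hS₁' : ∀ k, k ≠ M₁.k₁ → S₁ (.inl k) = [] := fun k hk =>
    (e3 k).trans (haltList_stk_of_ne M₁ y hk)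
  have hS₁'' : ∀ k, S₁ (.inr k) = [] := fun k =>
    (e4 (.inr k) (fun ⟨_, h⟩ => nomatch h)).trans (initList_stk_of_ne C x (fun h => nomatch h))
  obtain ⟨S₂, move₁, a1, a2, a3⟩ := reachesIn_move (M := compStmt M₁ M₂ g) (a := .inl M₁.k₁)
    (b := .inr (.inl ())) (fun h => nomatch h)
    (fun x => x) (get := fun s => s.2.1) (put := fun o s => (s.1, o, s.2.2)) (fun _ _ => rfl)
    (fun _ _ _ => rfl) (e := fun o => .inr (.inl (.inl o))) (next := .inr (.inl (.inr none)))
    rfl (fun _ => rfl) y (M₁.initialState, none, M₂.initialState) S₁ hS₁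
  rw [hS₁'', List.append_nil] at a2
  replace a2 : S₂ (.inr (.inl ())) = y.reverse := a2.trans (congrArg List.reverse (List.map_id y))
  obtain ⟨S₃, move₂, b1, b2, b3⟩ := reachesIn_move (M := compStmt M₁ M₂ g) (a := .inr (.inl ()))
    (b := .inr (.inr M₂.k₀)) (fun h => nomatch h)
    g (get := fun s => s.2.1) (put := fun o s => (s.1, o, s.2.2)) (fun _ _ => rfl)
    (fun _ _ _ => rfl) (e := fun o => .inr (.inl (.inr o))) (next := .inr (.inr M₂.main))
    rfl (fun _ => rfl) y.reverse (M₁.initialState, none, M₂.initialState) S₂ a2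
  have s1 : ∀ k, S₃ (.inl k) = [] := by
    intro k
    refine (b3 (.inl k) (fun h => nomatch h) (fun h => nomatch h)).trans ?_
    by_cases hk : k = M₁.k₁
    · subst hk
      exact a1
    · exact (a3 (.inl k) (fun h => hk (Sum.inl.inj h)) (fun h => nomatch h)).trans (hS₁' k hk)
  have s3 : S₃ (.inr (.inr M₂.k₀)) = y.map g := by
    have h1 : (List.map g y.reverse).reverse = y.map g := by
      rw [List.map_reverse, List.reverse_reverse]
    have h2 : S₂ (.inr (.inr M₂.k₀)) = [] :=
      (a3 (.inr (.inr M₂.k₀)) (fun h => nomatch h) (fun h => nomatch h)).trans (hS₁'' _)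
    exact b2.trans ((congrArg₂ (fun u v : List (M₂.Γ M₂.k₀) => u ++ v) h1 h2).trans (List.append_nil _))
  have s4 : ∀ k, k ≠ M₂.k₀ → S₃ (.inr (.inr k)) = [] := fun k hk =>
    (b3 (.inr (.inr k)) (fun h => nomatch h) (fun h => hk (Sum.inr.inj (Sum.inr.inj h)))).trans
      ((a3 (.inr (.inr k)) (fun h => nomatch h) (fun h => nomatch h)).trans (hS₁'' _))
  let c : TM2.Cfg (CompΓ M₁ M₂) (CompΛ M₁ M₂) (Compσ M₁ M₂) :=
    ⟨some (.inr (.inr M₂.main)), (M₁.initialState, none, M₂.initialState), S₃⟩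
  have hrel₂ : LiftRel (K := M₂.K) (K' := M₁.K ⊕ Unit ⊕ M₂.K) (Λ := M₂.Λ) (Γ := CompΓ M₁ M₂)
      (fun k => .inr (.inr k)) (fun (a : M₂.σ) (s : Compσ M₁ M₂) => (s.1, s.2.1, a))
      (fun l => .inr (.inr l)) none c (initList M₂ (y.map g)) c := by
    refine ⟨rfl, rfl, fun k => ?_, fun _ _ => rfl⟩
    by_cases hk : k = M₂.k₀
    · subst hk
      exact s3.trans (initList_stk_self M₂ _).symm
    · exact (s4 k hk).trans (initList_stk_of_ne M₂ _ hk).symm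
  obtain ⟨⟨l₂, v₂, S₄⟩, hd₂, f1, f2, f3, f4⟩ := LiftRel.iterate (M' := compStmt M₁ M₂ g)
    (Sum.inr_injective.comp Sum.inr_injective)
    (get := fun s : Compσ M₁ M₂ => s.2.2) (put := fun a s => (s.1, s.2.1, a))
    (lab := fun l => Sum.inr (Sum.inr l)) (fun _ _ => rfl) (fun _ _ _ => rfl) (fin := .halt)
    (fun _ _ => rfl) (fun _ => rfl) k₂ hrel₂ h₂
  obtain rfl : l₂ = none := f1
  obtain rfl : v₂ = (M₁.initialState, none, M₂.initialState) := f2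
  have hfinal : (⟨none, (M₁.initialState, none, M₂.initialState), S₄⟩ :
      TM2.Cfg (CompΓ M₁ M₂) (CompΛ M₁ M₂) (Compσ M₁ M₂)) = haltList C z := by
    have : S₄ = (haltList C z).stk := by
      funext k
      match k with
      | .inl k =>
        exact ((f4 _ (fun ⟨_, h⟩ => nomatch h)).trans (s1 k)).trans (haltList_stk_of_ne C z
          (k := .inl k) (fun h => nomatch h)).symm
      | .inr (.inl ()) =>
        exact ((f4 _ (fun ⟨_, h⟩ => nomatch h)).trans b1).trans (haltList_stk_of_ne C z
          (k := .inr (.inl ())) (fun h => nomatch h)).symm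
      | .inr (.inr k) =>
        by_cases hk : k = M₂.k₁
        · subst hk
          exact ((f3 _).trans (haltList_stk_self M₂ z)).trans (haltList_stk_self C z).symm
        · exact ((f3 _).trans (haltList_stk_of_ne M₂ z hk)).trans (haltList_stk_of_ne C z
            fun h => hk (Sum.inr.inj (Sum.inr.inj h))).symm
    rw [this]
    rfl
  have hd₂' := hd₂.trans (congrArg some hfinal)
  refine ReachesIn.trans (ReachesIn.trans ⟨k₁, hk₁, hd₁⟩ ?_) ⟨k₂, hk₂, hd₂'⟩
  have hrev : y.reverse.length = y.length := List.length_reverse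
  have hle : 2 * y.length + 1 + (2 * y.reverse.length + 1) ≤ 4 * y.length + 2 := by omega
  exact (move₁.trans move₂).mono hle

end Comp

theorem exists_comp_computableInPolyTime {α β γ A B C : Type} {ea : α → List A} {eb : β → List B}
    {ec : γ → List C} {f : α → β} {f' : β → γ} (h₁ : TM2ComputableInPolyTime ea eb f)
    (h₂ : TM2ComputableInPolyTime eb ec f') :
    Nonempty (TM2ComputableInPolyTime ea ec (f' ∘ f)) := by
  let := h₂.tm.Γk₀Fin
  -- The composite stores letters of this alphabet in its labels and states, so it must be finite.
  -- It is in bijection with the input alphabet of the second machine.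
  let _ : Fintype (h₁.tm.Γ h₁.tm.k₁) :=
    Fintype.ofEquiv _ (h₂.inputAlphabet.trans h₁.outputAlphabet.symm)
  let := h₁.tm.ΛFin
  set g : h₁.tm.Γ h₁.tm.k₁ → h₂.tm.Γ h₂.tm.k₀ := fun x =>
    h₂.inputAlphabet.symm (h₁.outputAlphabet x) with hg
  set B := ∑ l, pushCount (h₁.tm.m l) with hB
  have hB' : ∀ l, pushCount (h₁.tm.m l) ≤ B := fun l =>
    Finset.single_le_sum (f := fun l => pushCount (h₁.tm.m l)) (fun _ _ => Nat.zero_le _)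
      (Finset.mem_univ l)
  set L : Polynomial ℕ := Polynomial.X + h₁.time * Polynomial.C B with hL
  refine ⟨{ tm := compMachine h₁.tm h₂.tm g, inputAlphabet := h₁.inputAlphabet,
            outputAlphabet := h₂.outputAlphabet,
            time := h₁.time + (4 * L + 2) + h₂.time.comp L,
            outputsFun := fun a => ReachesIn.evalsToInTime ?_ }⟩
  have r₁ := reachesIn_of_evalsToInTime (h₁.outputsFun a)
  have r₂ := reachesIn_of_evalsToInTime (h₂.outputsFun (f a))
  have hlen : (eb (f a)).length ≤ L.eval (ea a).length := by
    obtain ⟨k, hk, hr⟩ := r₁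
    have := length_iterate_le hB' k hr h₁.tm.k₁
    rw [haltList_stk_self, List.length_map] at this
    refine this.trans ?_
    simp only [hL, Polynomial.eval_add, Polynomial.eval_X, Polynomial.eval_mul, Polynomial.eval_C]
    gcongr
    -- The output stack starts empty unless it is also the input stack.
    by_cases h : h₁.tm.k₁ = h₁.tm.k₀
    · have : ∀ k, k = h₁.tm.k₀ → ((initList h₁.tm
          (List.map h₁.inputAlphabet.invFun (ea a))).stk k).length = (ea a).length := by
        rintro k rfl
        rw [initList_stk_self, List.length_map]
      exact (this _ h).le
    · rw [initList_stk_of_ne _ _ h]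
      simp
  have key := reachesIn_compMachine h₁.tm h₂.tm g r₁
    (y := List.map h₁.outputAlphabet.invFun (eb (f a))) (n := h₂.time.eval (eb (f a)).length)
    (z := List.map h₂.outputAlphabet.invFun (ec (f' (f a)))) (by
      convert r₂ using 2
      simp [hg, Function.comp_def])
  refine key.mono ?_
  have e1 := eval_mono h₂.time hlen
  simp only [Polynomial.eval_add, Polynomial.eval_mul, Polynomial.eval_comp, List.length_map,
    Polynomial.eval_ofNat] at *
  omega

theorem PolyReducible.trans {P Q S : DecisionProblem} (h₁ : PolyReducible P Q)
    (h₂ : PolyReducible Q S) : PolyReducible P S := by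
  obtain ⟨f, ⟨hf⟩, hf'⟩ := h₁
  obtain ⟨g, ⟨hg⟩, hg'⟩ := h₂
  exact ⟨g ∘ f, exists_comp_computableInPolyTime hf hg, fun x => (hf' x).trans (hg' _)⟩


/-! ### Written polynomials in variables indexed by natural numbers -/

/-- A sum of monomials in the variables `x_0, x_1, …`. -/
abbrev NatPoly : Type := List (ℤ × List (ℕ × ℕ))

/-- The encoding of a power of a variable. -/
def encodePower (q : ℕ × ℕ) : List Symbol := encodeUnary q.1 ++ encodeBinary q.2

/-- The encoding of a monomial. -/
def encodeNatMono (a : ℤ × List (ℕ × ℕ)) : List Symbol := encodeInt a.1 ++ encodeList encodePower a.2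

/-- The encoding of a sum of monomials. -/
def encodeNatPoly (p : NatPoly) : List Symbol := encodeList encodeNatMono p

/-- The value of a sum of monomials. -/
noncomputable def NatPoly.eval (p : NatPoly) (y : ℕ → ℝ) : ℝ :=
  (p.map fun a => (a.1 : ℝ) * (a.2.map fun q => y q.1 ^ q.2).prod).sum

theorem NatPoly.eval_cons (a : ℤ × List (ℕ × ℕ)) (p : NatPoly) (y : ℕ → ℝ) :
    NatPoly.eval (a :: p) y = a.1 * (a.2.map fun q => y q.1 ^ q.2).prod + NatPoly.eval p y := by
  simp [NatPoly.eval]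

theorem NatPoly.eval_append (p q : NatPoly) (y : ℕ → ℝ) :
    NatPoly.eval (p ++ q) y = NatPoly.eval p y + NatPoly.eval q y := by
  simp [NatPoly.eval]

/-- The written polynomial in variables indexed by natural numbers that is given by a written
polynomial in `n` variables. -/
def Poly.toNatPoly {n : ℕ} (p : Poly n) : NatPoly :=
  p.map fun a => (a.1, a.2.map fun q => (q.1.val, q.2))

/-- The written polynomial in `n` variables that is given by a written polynomial in variables
indexed by natural numbers below `n`. -/
def NatPoly.toPoly (p : NatPoly) (n : ℕ) [NeZero n] : Poly n :=
  p.map fun a => (a.1, a.2.map fun q => (Fin.ofNat n q.1, q.2))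

theorem encodeList_map {α β : Type} (e : β → List Symbol) (f : α → β) (l : List α) :
    encodeList e (l.map f) = encodeList (fun a => e (f a)) l := by
  induction l with
  | nil => rfl
  | cons a l ih => simp [encodeList, ih]

theorem encodeList_eq_flatMap {α : Type} (e : α → List Symbol) (l : List α) :
    encodeList e l = l.flatMap (fun a => Symbol.item :: e a) ++ [Symbol.close] := by
  induction l with
  | nil => rfl
  | cons a l ih => simp [encodeList, ih]

theorem encodePoly_eq {n : ℕ} (p : Poly n) : encodePoly p = encodeNatPoly p.toNatPoly := by
  rw [encodePoly, encodeNatPoly, Poly.toNatPoly, encodeList_map]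
  congr 1
  funext a
  rw [encodeMono, encodeNatMono, encodeList_map]
  rfl

theorem Poly.eval_eq {n : ℕ} (p : Poly n) (x : Fin n → ℝ) (y : ℕ → ℝ)
    (h : ∀ i : Fin n, y i = x i) : p.eval x = p.toNatPoly.eval y := by
  have hm : ∀ a : Mono n, MvPolynomial.aeval x a.toMvPolynomial =
      (a.1 : ℝ) * (a.2.map fun q => x q.1 ^ q.2).prod := by
    intro a
    simp [Mono.toMvPolynomial, map_list_prod, Function.comp_def]
  simp [Poly.eval, Poly.toMvPolynomial, Poly.toNatPoly, NatPoly.eval, map_list_sum,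
    Function.comp_def, hm, h]

/-- `Fin.ofNat` reduces indices modulo `n`, which is harmless when all of them lie below `n`. -/
theorem toNatPoly_toPoly {n : ℕ} [NeZero n] {p : NatPoly} (h : ∀ a ∈ p, ∀ q ∈ a.2, q.1 < n) :
    (p.toPoly n).toNatPoly = p := by
  rw [Poly.toNatPoly, NatPoly.toPoly, List.map_map]
  refine (List.map_congr_left fun a ha => ?_).trans (List.map_id p)
  simp only [comp_apply, List.map_map, id]
  refine Prod.ext rfl ((List.map_congr_left fun q hq => ?_).trans (List.map_id a.2))
  exact Prod.ext (Nat.mod_eq_of_lt (h a ha q hq)) rfl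

theorem NatPoly.eval_toPoly {n : ℕ} [NeZero n] {p : NatPoly}
    (h : ∀ a ∈ p, ∀ q ∈ a.2, q.1 < n) (x : Fin n → ℝ) (y : ℕ → ℝ)
    (hy : ∀ i : Fin n, y i = x i) : (p.toPoly n).eval x = p.eval y := by
  rw [Poly.eval_eq _ x y hy, toNatPoly_toPoly h]

theorem encodePoly_toPoly {n : ℕ} [NeZero n] {p : NatPoly}
    (h : ∀ a ∈ p, ∀ q ∈ a.2, q.1 < n) : encodePoly (p.toPoly n) = encodeNatPoly p := by
  rw [encodePoly_eq, toNatPoly_toPoly h]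

/-- The number with given binary digits, least significant digit first. -/
def ofBits : List Bool → ℕ
  | [] => 0
  | b :: l => b.toNat + 2 * ofBits l

theorem ofBits_encodeNat (n : ℕ) : ofBits (Computability.encodeNat n) = n := by
  have h : ∀ m : PosNum, ofBits (Computability.encodePosNum m) = m := by
    intro m
    induction m with
    | one => rfl
    | bit0 m ih => rw [Computability.encodePosNum, ofBits, ih, PosNum.cast_bit0]; simp; omega
    | bit1 m ih => rw [Computability.encodePosNum, ofBits, ih, PosNum.cast_bit1]; simp; omega
  have h' : ∀ m : Num, ofBits (Computability.encodeNum m) = m := by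
    intro m
    cases m with
    | zero => rfl
    | pos m => exact h m
  rw [Computability.encodeNat, h']
  exact Num.to_of_nat n

theorem encodeBinary_one : encodeBinary 1 = [Symbol.bit true, Symbol.close] := rfl

/-! ### Programs that write words -/

namespace StackProg

variable {R A : Type}

/-- Writing a word on the stack `o`; the word consists of letters and of contents of stacks. -/
def write (o : R) (t : List (A ⊕ R)) : StackProg R A :=
  t.foldr (fun x p => seq (x.elim (push o) fun r => copy r o) p) skip

/-- The word that is written by `write`. -/
def expand (ρ : R → List A) (t : List (A ⊕ R)) : List A :=
  t.flatMap fun x => x.elim (fun a => [a]) fun r => (ρ r).reverse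

/-- The last letter written is on top of `o`, so a copied stack contributes its letters to the word
from bottom to top; this is the reversal in `expand`. -/
theorem run_write [DecidableEq R] {o : R} {t : List (A ⊕ R)} (h : ∀ r, .inr r ∈ t → r ≠ o)
    (ρ : R → List A) :
    (write o t).run ρ = update ρ o ((expand ρ t).reverse ++ ρ o) := by
  induction t generalizing ρ with
  | nil => simp [write, run, expand]
  | cons x t ih =>
    have key : ∀ l, expand (update ρ o l) t = expand ρ t := by
      intro l
      simp only [expand]
      refine List.flatMap_congr fun y hy => ?_
      cases y with
      | inl a => rfl
      | inr r => simp [update_of_ne (h r (List.mem_cons_of_mem _ hy))]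
    have e : write o (x :: t) = seq (x.elim (push o) fun r => copy r o) (write o t) := rfl
    rw [e, run]
    cases x with
    | inl a =>
      rw [ih fun r hr => h r (List.mem_cons_of_mem _ hr)]
      simp only [Sum.elim_inl, run, key, update_idem, update_self]
      simp [expand]
    | inr r =>
      rw [ih fun r hr => h r (List.mem_cons_of_mem _ hr)]
      simp only [Sum.elim_inr, run, key, update_idem, update_self]
      simp [expand]

theorem wellRanked_write {rank : R → ℕ} {o : R} {t : List (A ⊕ R)}
    (h : ∀ r, .inr r ∈ t → rank r < rank o) : (write o t).WellRanked rank := by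
  induction t with
  | nil => trivial
  | cons x t ih =>
    refine ⟨?_, ih fun r hr => h r (List.mem_cons_of_mem _ hr)⟩
    cases x with
    | inl a => trivial
    | inr r => exact h r List.mem_cons_self

theorem writesAbove_write {rank : R → ℕ} {m : ℕ} {o : R} (h : m < rank o) (t : List (A ⊕ R)) :
    (write o t).WritesAbove rank m := by
  induction t with
  | nil => trivial
  | cons x t ih =>
    refine ⟨?_, ih⟩
    cases x with
    | inl a => exact h
    | inr r => exact h

variable [DecidableEq R]

theorem loopRun_push {r s : R} (hrs : r ≠ s) (l : List A) (ρ : R → List A) :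
    loopRun r (fun a => (push s a : StackProg R A).run) l ρ =
      update (update ρ r []) s (l.reverse ++ ρ s) := by
  induction l generalizing ρ with
  | nil =>
    simp only [loopRun, List.reverse_nil, List.nil_append]
    rw [eq_update_iff]
    simp [hrs.symm]
  | cons a l ih =>
    rw [loopRun, ih]
    funext x
    by_cases h1 : x = s
    · subst h1; simp [run, hrs.symm]
    · by_cases h2 : x = r
      · subst h2; simp [h1]
      · simp [run, h1, h2]

end StackProg


/-! ### Reading encoded sentences symbol by symbol

An encoded sentence is read from left to right by a finite automaton, which determines the meaning
of every symbol. With this information, the truth value of the sentence is computed from right to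
left with a stack of truth values and a few real registers. -/

/-- The states of the automaton that reads encoded sentences. -/
inductive Lex
  | header
  | formula
  | terms
  | sign
  | coeff
  | factors
  | index
  | expo
  deriving DecidableEq

/-- The transitions of the automaton. -/
def Lex.next : Lex → Symbol → Lex
  | header, .close => formula
  | formula, .eqZero => terms
  | formula, .gtZero => terms
  | formula, .geZero => terms
  | terms, .item => sign
  | terms, .close => formula
  | sign, _ => coeff
  | coeff, .close => factors
  | factors, .item => index
  | factors, .close => terms
  | index, .close => expo
  | expo, .close => factors
  | q, _ => q

/-- The index of the variable whose power is being read. -/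
def Lex.nextIndex : Lex → Symbol → ℕ → ℕ
  | factors, .item, _ => 0
  | index, .tally, j => j + 1
  | _, _, j => j

/-- The registers of the evaluation: truth values of subformulas, the values of a sum, a product
and a coefficient, and a power of a variable. -/
structure Registers where
  stack : List Bool
  sum : ℝ
  prod : ℝ
  coeff : ℝ
  power : ℝ

open Classical in
/-- One step of the evaluation; `x` is the value of the variable whose power is being read. -/
noncomputable def evalStep (x : ℝ) : Lex → Symbol → Registers → Registers
  | .formula, .eqZero, r => { r with stack := decide (r.sum = 0) :: r.stack }
  | .formula, .gtZero, r => { r with stack := decide (0 < r.sum) :: r.stack }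
  | .formula, .geZero, r => { r with stack := decide (0 ≤ r.sum) :: r.stack }
  | .formula, .neg, ⟨b :: l, S, M, V, P⟩ => ⟨(!b) :: l, S, M, V, P⟩
  | .formula, .conj, ⟨a :: b :: l, S, M, V, P⟩ => ⟨(a && b) :: l, S, M, V, P⟩
  | .formula, .disj, ⟨a :: b :: l, S, M, V, P⟩ => ⟨(a || b) :: l, S, M, V, P⟩
  | .terms, .item, r => { r with sum := r.sum + r.prod }
  | .terms, .close, r => { r with sum := 0 }
  | .sign, .plus, r => { r with prod := r.coeff * r.prod }
  | .sign, .minus, r => { r with prod := -(r.coeff * r.prod) }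
  | .coeff, .bit b, r => { r with coeff := b.toNat + 2 * r.coeff }
  | .coeff, .close, r => { r with coeff := 0 }
  | .factors, .item, r => { r with prod := r.power * r.prod }
  | .factors, .close, r => { r with prod := 1 }
  | .expo, .bit true, r => { r with power := r.power * r.power * x }
  | .expo, .bit false, r => { r with power := r.power * r.power }
  | .expo, .close, r => { r with power := 1 }
  | _, _, r => r

/-- The symbol is admissible in the given state, and the stack is large enough. -/
def StepOK : Lex → Symbol → Registers → Prop
  | .formula, .eqZero, _ => True
  | .formula, .gtZero, _ => True
  | .formula, .geZero, _ => True
  | .formula, .neg, r => 1 ≤ r.stack.length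
  | .formula, .conj, r => 2 ≤ r.stack.length
  | .formula, .disj, r => 2 ≤ r.stack.length
  | .terms, .item, _ => True
  | .terms, .close, _ => True
  | .sign, .plus, _ => True
  | .sign, .minus, _ => True
  | .coeff, .bit _, _ => True
  | .coeff, .close, _ => True
  | .factors, .item, _ => True
  | .factors, .close, _ => True
  | .index, .tally, _ => True
  | .index, .close, _ => True
  | .expo, .bit _, _ => True
  | .expo, .close, _ => True
  | _, _, _ => False

/-- The evaluation of a word, from right to left. -/
noncomputable def evalWord (x : ℕ → ℝ) : Lex → ℕ → List Symbol → Registers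
  | _, _, [] => ⟨[], 0, 0, 0, 0⟩
  | q, j, t :: w => evalStep (x j) q t (evalWord x (q.next t) (q.nextIndex t j) w)

/-- Every symbol of the word is admissible. -/
def WordOK (x : ℕ → ℝ) : Lex → ℕ → List Symbol → Prop
  | q, _, [] => q = .formula
  | q, j, t :: w => StepOK q t (evalWord x (q.next t) (q.nextIndex t j) w) ∧
      WordOK x (q.next t) (q.nextIndex t j) w

/-- The word is admissible in state `q`, and its evaluation has the property `φ`. -/
def Evaluates (x : ℕ → ℝ) (q : Lex) (j : ℕ) (w : List Symbol) (φ : Registers → Prop) : Prop :=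
  WordOK x q j w ∧ φ (evalWord x q j w)

theorem Evaluates.cons {x : ℕ → ℝ} {q q' : Lex} {j j' : ℕ} {t : Symbol} {w : List Symbol}
    {φ ψ : Registers → Prop} (h : Evaluates x q' j' w φ) (hq : q.next t = q')
    (hj : q.nextIndex t j = j') (hok : ∀ r, φ r → StepOK q t r)
    (hψ : ∀ r, φ r → ψ (evalStep (x j) q t r)) : Evaluates x q j (t :: w) ψ := by
  subst hq hj
  exact ⟨⟨hok _ h.2, h.1⟩, hψ _ h.2⟩

/-! ### Correctness of the evaluation from right to left -/

section EvalEncodings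

variable {x : ℕ → ℝ} {s : List Bool} {a m : ℝ} {w : List Symbol}

/-- The least significant digit comes first, so reading from the right is Horner's rule. -/
theorem evaluates_coeff (l : List Bool) {j : ℕ}
    (h : Evaluates x .factors j w fun r => r.stack = s ∧ r.sum = a ∧ r.prod = m) :
    Evaluates x .coeff j (l.map Symbol.bit ++ Symbol.close :: w)
      fun r => r.stack = s ∧ r.sum = a ∧ r.prod = m ∧ r.coeff = ofBits l := by
  induction l with
  | nil =>
    refine h.cons rfl rfl (fun _ _ => trivial) ?_
    rintro r ⟨h1, h2, h3⟩
    exact ⟨h1, h2, h3, by simp [evalStep, ofBits]⟩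
  | cons b l ih =>
    refine ih.cons rfl rfl (fun _ _ => trivial) ?_
    rintro r ⟨h1, h2, h3, h4⟩
    exact ⟨h1, h2, h3, by simp [evalStep, ofBits, h4]⟩

theorem evaluates_sign (c : ℤ) {j : ℕ}
    (h : Evaluates x .factors j w fun r => r.stack = s ∧ r.sum = a ∧ r.prod = m) :
    Evaluates x .sign j (encodeInt c ++ w)
      fun r => r.stack = s ∧ r.sum = a ∧ r.prod = c * m := by
  have h' := evaluates_coeff (Computability.encodeNat c.natAbs) h
  rw [ofBits_encodeNat] at h'
  rw [encodeInt, encodeBinary, List.cons_append, List.append_assoc, List.singleton_append]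
  split_ifs with hc
  · refine h'.cons rfl rfl (fun _ _ => trivial) ?_
    rintro r ⟨h1, h2, h3, h4⟩
    refine ⟨h1, h2, ?_⟩
    have : ((c.natAbs : ℕ) : ℝ) = -(c : ℝ) := by
      rw [Nat.cast_natAbs, abs_of_neg hc, Int.cast_neg]
    simp [evalStep, h3, h4, this]
  · refine h'.cons rfl rfl (fun _ _ => trivial) ?_
    rintro r ⟨h1, h2, h3, h4⟩
    refine ⟨h1, h2, ?_⟩
    have : ((c.natAbs : ℕ) : ℝ) = (c : ℝ) := by
      rw [Nat.cast_natAbs, abs_of_nonneg (not_lt.1 hc)]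
    simp [evalStep, h3, h4, this]

/-- Repeated squaring: a digit `b` in front of an exponent `e` gives `b + 2 * e`, that is, the
square of the power so far, times the variable if `b` is set. -/
theorem evaluates_expo (l : List Bool) {j : ℕ}
    (h : Evaluates x .factors j w fun r => r.stack = s ∧ r.sum = a ∧ r.prod = m) :
    Evaluates x .expo j (l.map Symbol.bit ++ Symbol.close :: w)
      fun r => r.stack = s ∧ r.sum = a ∧ r.prod = m ∧ r.power = x j ^ ofBits l := by
  induction l with
  | nil =>
    refine h.cons rfl rfl (fun _ _ => trivial) ?_
    rintro r ⟨h1, h2, h3⟩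
    exact ⟨h1, h2, h3, by simp [evalStep, ofBits]⟩
  | cons b l ih =>
    refine ih.cons rfl rfl (fun _ _ => trivial) ?_
    rintro r ⟨h1, h2, h3, h4⟩
    cases b with
    | false =>
      refine ⟨h1, h2, h3, ?_⟩
      simp only [evalStep, ofBits, h4, Bool.toNat_false]
      ring
    | true =>
      refine ⟨h1, h2, h3, ?_⟩
      simp only [evalStep, ofBits, h4, Bool.toNat_true]
      ring

/-- The index is counted from left to right, against the direction of the evaluation; it is `j + k`
where the exponent begins. The hypothesis is needed at every index because it changes on the way. -/
theorem evaluates_index (k : ℕ) (l : List Bool) {j : ℕ}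
    (h : ∀ i, Evaluates x .factors i w fun r => r.stack = s ∧ r.sum = a ∧ r.prod = m) :
    Evaluates x .index j (List.replicate k Symbol.tally ++
        Symbol.close :: (l.map Symbol.bit ++ Symbol.close :: w))
      fun r => r.stack = s ∧ r.sum = a ∧ r.prod = m ∧ r.power = x (j + k) ^ ofBits l := by
  induction k generalizing j with
  | zero => exact (evaluates_expo l (h j)).cons rfl rfl (fun _ _ => trivial) fun r h => h
  | succ k ih =>
    have := ih (j := j + 1)
    rw [Nat.add_right_comm] at this
    exact this.cons rfl rfl (fun _ _ => trivial) fun r h => h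

theorem evaluates_factors (l : List (ℕ × ℕ)) {j : ℕ}
    (h : ∀ i, Evaluates x .terms i w fun r => r.stack = s ∧ r.sum = a) :
    Evaluates x .factors j (encodeList encodePower l ++ w)
      fun r => r.stack = s ∧ r.sum = a ∧ r.prod = (l.map fun q => x q.1 ^ q.2).prod := by
  induction l generalizing j with
  | nil =>
    refine (h j).cons rfl rfl (fun _ _ => trivial) ?_
    rintro r ⟨h1, h2⟩
    exact ⟨h1, h2, rfl⟩
  | cons q l ih =>
    have := evaluates_index q.1 (Computability.encodeNat q.2) (j := 0) fun i => ih (j := i)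
    rw [ofBits_encodeNat, Nat.zero_add] at this
    simp only [encodeList, encodePower, encodeUnary, encodeBinary, List.append_assoc,
      List.cons_append, List.nil_append]
    refine this.cons rfl rfl (fun _ _ => trivial) ?_
    rintro r ⟨h1, h2, h3, h4⟩
    exact ⟨h1, h2, by simp [evalStep, h3, h4]⟩

theorem evaluates_terms (p : NatPoly) {j : ℕ}
    (h : ∀ i, Evaluates x .formula i w fun r => r.stack = s) :
    Evaluates x .terms j (encodeNatPoly p ++ w) fun r => r.stack = s ∧ r.sum = p.eval x := by
  induction p generalizing j with
  | nil =>
    refine (h j).cons rfl rfl (fun _ _ => trivial) ?_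
    intro r h1
    exact ⟨h1, rfl⟩
  | cons b p ih =>
    have := evaluates_sign b.1 (j := j) (evaluates_factors b.2 (j := j) fun i => ih (j := i))
    simp only [encodeNatPoly, encodeList, encodeNatMono, List.append_assoc, List.cons_append]
    refine this.cons rfl rfl (fun _ _ => trivial) ?_
    rintro r ⟨h1, h2, h3⟩
    refine ⟨h1, ?_⟩
    rw [NatPoly.eval_cons]
    simp [evalStep, h2, h3, add_comm]

open Classical in
-- From right to left a connective in prefix notation comes after its operands, whose values then
-- lie on top of the stack, the left one uppermost. The word `w` and the stack `s` vary in the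
-- induction because the left operand is evaluated on top of the result of the right one.
theorem evaluates_formula {n : ℕ} {v : Fin n → ℝ} (hv : ∀ i : Fin n, x i = v i) (φ : Formula n)
    {s : List Bool} {w : List Symbol}
    (h : ∀ i, Evaluates x .formula i w fun r => r.stack = s) (j : ℕ) :
    Evaluates x .formula j (encodeFormula φ ++ w) fun r => r.stack = decide (φ.Holds v) :: s := by
  induction φ generalizing s w j with
  | eqZero p | gtZero p | geZero p =>
    rw [encodeFormula, encodePoly_eq]
    refine (evaluates_terms p.toNatPoly h).cons rfl rfl (fun _ _ => trivial) ?_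
    rintro r ⟨h1, h2⟩
    simp [evalStep, h1, h2, Formula.Holds, Poly.eval_eq p v x hv]
  | neg φ ih =>
    refine (ih h j).cons rfl rfl (fun r hr => by simp [StepOK, hr]) ?_
    rintro ⟨l, S, M, V, P⟩ rfl
    by_cases h1 : φ.Holds v <;> simp [evalStep, Formula.Holds, h1]
  | conj φ ψ ihφ ihψ | disj φ ψ ihφ ihψ =>
    rw [encodeFormula, List.cons_append, List.append_assoc]
    refine (ihφ (fun i => ihψ h i) j).cons rfl rfl (fun r hr => by simp [StepOK, hr]) ?_
    rintro ⟨l, S, M, V, P⟩ rfl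
    by_cases h1 : φ.Holds v <;> by_cases h2 : ψ.Holds v <;> simp [evalStep, Formula.Holds, h1, h2]

open Classical in
theorem evaluates_encodeFormula {n : ℕ} {v : Fin n → ℝ} (hv : ∀ i : Fin n, x i = v i)
    (φ : Formula n) (j : ℕ) :
    Evaluates x .formula j (encodeFormula φ) fun r => r.stack = [decide (φ.Holds v)] := by
  have := evaluates_formula hv φ (s := []) (w := []) (fun i => ⟨rfl, rfl⟩) j
  rwa [List.append_nil] at this

end EvalEncodings

/-! ### Polynomial constraints between the registers before and after a symbol -/

/-- The variables of a local constraint: the registers before and after a symbol, and the variable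
whose power is being read. -/
inductive LocalVar
  | cur (c : ℕ)
  | nxt (c : ℕ)
  | look
  deriving DecidableEq

/-- Polynomials in the variables of a local constraint. -/
abbrev LocalPoly : Type := List (ℤ × List LocalVar)

/-- The value of a variable. -/
def LocalVar.eval (b b' : ℕ → ℝ) (x : ℝ) : LocalVar → ℝ
  | cur c => b c
  | nxt c => b' c
  | look => x

/-- The value of a polynomial. -/
noncomputable def LocalPoly.eval (e : LocalVar → ℝ) (p : LocalPoly) : ℝ :=
  (p.map fun a => (a.1 : ℝ) * (a.2.map e).prod).sum

open LocalVar

/-- The value `src` is the code of a stack with top `z` and remainder `s`, where `a` and `b` bear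
witness that `s` lies between `0` and `1`. -/
def popConstraints (src z s a b : LocalVar) : List LocalPoly :=
  [[(4, [src]), (-2, [z]), (-1, [s])], [(1, [z, z]), (-1, [z])], [(1, [s]), (-1, [a, a])],
    [(1, []), (-1, [s]), (-1, [b, b])]]

/-- The value of the sum is the difference of two squares, one of which vanishes. -/
def signConstraints : List LocalPoly :=
  [[(1, [nxt 1]), (-1, [cur 6, cur 6]), (1, [cur 7, cur 7])], [(1, [cur 6, cur 7])],
    [(4, [cur 0]), (-2, [cur 5]), (-1, [nxt 0])]]

/-- The registers with the given numbers do not change. -/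
def keep (l : List ℕ) : List LocalPoly := l.map fun c => [(1, [cur c]), (-1, [nxt c])]

/-- The constraints that belong to a symbol. The registers are the code of the stack (`0`), the
sum (`1`), the product (`2`), the coefficient (`3`) and the power (`4`); the remaining ones are
auxiliary. -/
def constraints : Lex → Symbol → List LocalPoly
  | .header, .close => [[(4, [nxt 0]), (-2, [])]]
  | .formula, .eqZero => signConstraints ++
      [[(1, [cur 6, cur 8]), (1, [cur 7, cur 8]), (-1, []), (1, [cur 5])],
        [(1, [cur 5, cur 6]), (1, [cur 5, cur 7])]]
  | .formula, .gtZero => signConstraints ++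
      [[(1, [cur 6, cur 8]), (-1, [cur 5])], [(1, [cur 6]), (-1, [cur 5, cur 6])]]
  | .formula, .geZero => signConstraints ++
      [[(1, [cur 7, cur 8]), (-1, []), (1, [cur 5])], [(1, [cur 5, cur 7])]]
  | .formula, .neg => popConstraints (nxt 0) (cur 5) (cur 7) (cur 9) (cur 10) ++
      [[(4, [cur 0]), (-2, []), (2, [cur 5]), (-1, [cur 7])]]
  | .formula, .conj => popConstraints (nxt 0) (cur 5) (cur 7) (cur 9) (cur 10) ++
      popConstraints (cur 7) (cur 6) (cur 8) (cur 11) (cur 12) ++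
      [[(4, [cur 0]), (-2, [cur 5, cur 6]), (-1, [cur 8])]]
  | .formula, .disj => popConstraints (nxt 0) (cur 5) (cur 7) (cur 9) (cur 10) ++
      popConstraints (cur 7) (cur 6) (cur 8) (cur 11) (cur 12) ++
      [[(4, [cur 0]), (-2, [cur 5]), (-2, [cur 6]), (2, [cur 5, cur 6]), (-1, [cur 8])]]
  | .terms, .item => [(1, [cur 1]), (-1, [nxt 1]), (-1, [nxt 2])] :: keep [0]
  | .terms, .close => [(1, [cur 1])] :: keep [0]
  | .sign, .plus => [(1, [cur 2]), (-1, [nxt 3, nxt 2])] :: keep [0, 1]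
  | .sign, .minus => [(1, [cur 2]), (1, [nxt 3, nxt 2])] :: keep [0, 1]
  | .coeff, .bit b => [(1, [cur 3]), (-b.toNat, []), (-2, [nxt 3])] :: keep [0, 1, 2]
  | .coeff, .close => [(1, [cur 3])] :: keep [0, 1, 2]
  | .factors, .item => [(1, [cur 2]), (-1, [nxt 4, nxt 2])] :: keep [0, 1]
  | .factors, .close => [(1, [cur 2]), (-1, [])] :: keep [0, 1]
  | .index, _ => keep [0, 1, 2, 4]
  | .expo, .bit true => [(1, [cur 4]), (-1, [nxt 4, nxt 4, look])] :: keep [0, 1, 2]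
  | .expo, .bit false => [(1, [cur 4]), (-1, [nxt 4, nxt 4])] :: keep [0, 1, 2]
  | .expo, .close => [(1, [cur 4]), (-1, [])] :: keep [0, 1, 2]
  | _, _ => []

/-- A stack of truth values, coded as a real number. -/
noncomputable def stackCode : List Bool → ℝ
  | [] => 0
  | b :: l => (2 * b.toNat + stackCode l) / 4

theorem stackCode_mem (l : List Bool) : 0 ≤ stackCode l ∧ stackCode l ≤ 1 := by
  induction l with
  | nil => simp [stackCode]
  | cons b l ih => cases b <;> simp [stackCode] <;> constructor <;> linarith [ih.1, ih.2]

/-- The numbers `b 0, b 1, …` are the contents of those registers that matter in state `q`. -/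
def Represents (r : Registers) (b : ℕ → ℝ) : Lex → Prop
  | .header => True
  | .formula => b 0 = stackCode r.stack
  | .terms => b 0 = stackCode r.stack ∧ b 1 = r.sum
  | .sign => b 0 = stackCode r.stack ∧ b 1 = r.sum ∧ b 2 = r.prod
  | .factors => b 0 = stackCode r.stack ∧ b 1 = r.sum ∧ b 2 = r.prod
  | .coeff => b 0 = stackCode r.stack ∧ b 1 = r.sum ∧ b 2 = r.prod ∧ b 3 = r.coeff
  | .index => b 0 = stackCode r.stack ∧ b 1 = r.sum ∧ b 2 = r.prod ∧ b 4 = r.power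
  | .expo => b 0 = stackCode r.stack ∧ b 1 = r.sum ∧ b 2 = r.prod ∧ b 4 = r.power

/-- The remainder `s` lies in `[0, 1]`, since `s` and `1 - s` are squares. Thus `4 * src` lies in
`[0, 1]` if the top is false and in `[2, 3]` if it is true; the intervals are disjoint, so the top
and then the remainder are determined. -/
theorem eq_of_popConstraints {c : Bool} {l : List Bool} {src z s a b : ℝ}
    (hsrc : src = stackCode (c :: l)) (h1 : 4 * src + (-(2 * z) + -s) = 0)
    (h2 : z * z + -z = 0) (h3 : s + -(a * a) = 0) (h4 : 1 + (-s + -(b * b)) = 0) : z = c.toNat ∧ s = stackCode l := by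
  have hl := stackCode_mem l
  have hs0 : 0 ≤ s := by nlinarith [mul_self_nonneg a]
  have hs1 : s ≤ 1 := by nlinarith [mul_self_nonneg b]
  rw [stackCode] at hsrc
  have hz : z = 0 ∨ z = 1 := by
    have : z * (z - 1) = 0 := by linarith
    rcases mul_eq_zero.1 this with h | h
    · exact Or.inl h
    · exact Or.inr (by linarith)
  rcases hz with rfl | rfl <;> cases c <;> simp at hsrc ⊢ <;> linarith [hl.1, hl.2]

/-- Soundness: the constraints leave no freedom in the registers that matter in state `q`, whatever
the auxiliary ones are. -/
theorem represents_of_constraints {q : Lex} {t : Symbol} {r : Registers} {b b' : ℕ → ℝ} {x : ℝ}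
    (hok : StepOK q t r) (hr : Represents r b' (q.next t))
    (h : ∀ p ∈ constraints q t, LocalPoly.eval (LocalVar.eval b b' x) p = 0) :
    Represents (evalStep x q t r) b q := by
  cases q <;> cases t <;> first | exact hok.elim | skip
  case expo.bit c =>
    cases c <;>
    simp [constraints, keep, LocalPoly.eval, LocalVar.eval, Lex.next, Represents, evalStep]
      at h hr ⊢ <;> grind
  case formula.neg =>
    obtain ⟨_ | ⟨c, l⟩, S, M, V, P⟩ := r
    · simp [StepOK] at hok
    simp [constraints, popConstraints, LocalPoly.eval, LocalVar.eval, Lex.next, Represents,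
      evalStep] at h hr ⊢
    obtain ⟨h1, h2, h3, h4, h5⟩ := h
    obtain ⟨e1, e2⟩ := eq_of_popConstraints hr h1 h2 h3 h4
    rw [stackCode]
    cases c <;> simp at e1 ⊢ <;> linarith
  case formula.conj | formula.disj =>
    obtain ⟨_ | ⟨c, _ | ⟨d, l⟩⟩, S, M, V, P⟩ := r
    · simp [StepOK] at hok
    · simp [StepOK] at hok
    simp [constraints, popConstraints, LocalPoly.eval, LocalVar.eval, Lex.next, Represents,
      evalStep] at h hr ⊢
    obtain ⟨h1, h2, h3, h4, h5, h6, h7, h8, h9⟩ := h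
    obtain ⟨e1, e2⟩ := eq_of_popConstraints hr h1 h2 h3 h4
    obtain ⟨e3, e4⟩ := eq_of_popConstraints e2 h5 h6 h7 h8
    rw [stackCode]
    rw [e1, e3] at h9
    cases c <;> cases d <;> simp at h9 ⊢ <;> linarith
  case formula.eqZero | formula.gtZero | formula.geZero =>
    simp [constraints, signConstraints, LocalPoly.eval, LocalVar.eval, Lex.next, Represents,
      evalStep] at h hr ⊢
    obtain ⟨h1, h2, h3, h4, h5⟩ := h
    rw [stackCode]
    -- As the product of registers 6 and 7 is zero, it is decided by which of them vanishes whether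
    -- the sum is positive, negative or zero. The remaining two constraints then force register 5 to
    -- be the truth value.
    have e : r.sum = b 6 * b 6 - b 7 * b 7 := by linarith
    have p6 := mul_self_nonneg (b 6)
    have p7 := mul_self_nonneg (b 7)
    rw [e]
    by_cases h6 : b 6 = 0 <;> by_cases h7 : b 7 = 0
    all_goals simp_all
    all_goals
      first
      | linarith
      | (rw [decide_eq_false (not_lt.2 p7)]; simp; linarith)
      | (rw [decide_eq_false (not_le.2 (mul_self_pos.2 h7))]; simp; linarith)
      | (have : b 5 = 1 := mul_right_cancel₀ h6 (by linarith)
         linarith)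
  all_goals
    simp [constraints, keep, LocalPoly.eval, LocalVar.eval, Lex.next, Represents, evalStep]
      at h hr ⊢
    grind


/-- A sequence with thirteen given initial terms. -/
def block (k s m v p z a b u w₁ w₂ w₃ w₄ : ℝ) : ℕ → ℝ
  | 0 => k
  | 1 => s
  | 2 => m
  | 3 => v
  | 4 => p
  | 5 => z
  | 6 => a
  | 7 => b
  | 8 => u
  | 9 => w₁
  | 10 => w₂
  | 11 => w₃
  | 12 => w₄
  | _ => 0

/-- Solvability, with the next block given. That it represents the registers matters only for pops:
a real number in register 0 that is not the code of a stack need not be decomposable. -/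
theorem exists_constraints {q : Lex} {t : Symbol} {r : Registers} {b' : ℕ → ℝ} {x : ℝ}
    (hok : StepOK q t r) (hr : Represents r b' (q.next t)) :
    ∃ b : ℕ → ℝ, ∀ p ∈ constraints q t, LocalPoly.eval (LocalVar.eval b b' x) p = 0 := by
  -- For the symbols inside a polynomial, the evaluation step itself, applied to the numbers in the
  -- next block, yields the block sought.
  obtain ⟨s, hs⟩ : ∃ s, s = evalStep x q t ⟨[], b' 1, b' 2, b' 3, b' 4⟩ := ⟨_, rfl⟩
  cases q <;> cases t <;> first | exact hok.elim | skip
  case formula.neg =>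
    obtain ⟨_ | ⟨c, l⟩, S, M, V, P⟩ := r
    · simp [StepOK] at hok
    have hl := stackCode_mem l
    -- The square roots witness that the remainder of the stack lies between `0` and `1`.
    refine ⟨block (stackCode ((!c) :: l)) 0 0 0 0 c.toNat 0 (stackCode l) 0 (√(stackCode l))
      (√(1 - stackCode l)) 0 0, ?_⟩
    simp [constraints, popConstraints, LocalPoly.eval, LocalVar.eval, Lex.next, Represents,
      block] at hr ⊢
    rw [Real.mul_self_sqrt hl.1, Real.mul_self_sqrt (sub_nonneg.2 hl.2), hr]
    cases c <;> simp [stackCode] <;> ring_nf <;> simp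
  case formula.conj | formula.disj =>
    obtain ⟨_ | ⟨c, _ | ⟨d, l⟩⟩, S, M, V, P⟩ := r
    · simp [StepOK] at hok
    · simp [StepOK] at hok
    have hl := stackCode_mem l
    have hd := stackCode_mem (d :: l)
    first
    | refine ⟨block (stackCode ((c && d) :: l)) 0 0 0 0 c.toNat d.toNat (stackCode (d :: l))
        (stackCode l) (√(stackCode (d :: l))) (√(1 - stackCode (d :: l))) (√(stackCode l))
        (√(1 - stackCode l)), ?_⟩
      simp [constraints, popConstraints, LocalPoly.eval, LocalVar.eval, Lex.next, Represents,
        block] at hr ⊢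
      rw [Real.mul_self_sqrt hl.1, Real.mul_self_sqrt (sub_nonneg.2 hl.2), Real.mul_self_sqrt hd.1,
        Real.mul_self_sqrt (sub_nonneg.2 hd.2), hr]
      cases c <;> cases d <;> simp [stackCode] <;> ring_nf <;> simp; done
    | refine ⟨block (stackCode ((c || d) :: l)) 0 0 0 0 c.toNat d.toNat (stackCode (d :: l))
        (stackCode l) (√(stackCode (d :: l))) (√(1 - stackCode (d :: l))) (√(stackCode l))
        (√(1 - stackCode l)), ?_⟩
      simp [constraints, popConstraints, LocalPoly.eval, LocalVar.eval, Lex.next, Represents,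
        block] at hr ⊢
      rw [Real.mul_self_sqrt hl.1, Real.mul_self_sqrt (sub_nonneg.2 hl.2), Real.mul_self_sqrt hd.1,
        Real.mul_self_sqrt (sub_nonneg.2 hd.2), hr]
      cases c <;> cases d <;> simp [stackCode] <;> ring_nf <;> simp; done
  case formula.eqZero | formula.gtZero | formula.geZero =>
    -- Registers 6 and 7 are the roots of the positive and the negative part of the sum, and
    -- register 8 is the inverse of the nonzero one, if any. For a negative sum all three relations
    -- fail, so one block serves them all; otherwise the truth value depends on the relation, and
    -- two blocks are tried.
    rcases lt_trichotomy (b' 1) 0 with h | h | h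
    · have h' : √(-b' 1) * √(-b' 1) = - b' 1 := Real.mul_self_sqrt (by linarith)
      have h0 : √(-b' 1) ≠ 0 := Real.sqrt_ne_zero'.2 (by linarith)
      · refine ⟨block (b' 0 / 4) 0 0 0 0 0 0 (√(-b' 1)) (√(-b' 1))⁻¹ 0 0 0 0, ?_⟩
        simp [constraints, signConstraints, LocalPoly.eval, LocalVar.eval, block, h', h0]
        ring_nf; done
    · first
      | refine ⟨block ((2 + b' 0) / 4) 0 0 0 0 1 0 0 0 0 0 0 0, ?_⟩
        simp [constraints, signConstraints, LocalPoly.eval, LocalVar.eval, block, h]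
        ring_nf; done
      | refine ⟨block (b' 0 / 4) 0 0 0 0 0 0 0 0 0 0 0 0, ?_⟩
        simp [constraints, signConstraints, LocalPoly.eval, LocalVar.eval, block, h]
        ring_nf; done
    · have h' : √(b' 1) * √(b' 1) = b' 1 := Real.mul_self_sqrt (by linarith)
      have h0 : √(b' 1) ≠ 0 := Real.sqrt_ne_zero'.2 (by linarith)
      first
      | refine ⟨block (b' 0 / 4) 0 0 0 0 0 (√(b' 1)) 0 (√(b' 1))⁻¹ 0 0 0 0, ?_⟩
        simp [constraints, signConstraints, LocalPoly.eval, LocalVar.eval, block, h', h0]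
        ring_nf; done
      | refine ⟨block ((2 + b' 0) / 4) 0 0 0 0 1 (√(b' 1)) 0 (√(b' 1))⁻¹ 0 0 0 0, ?_⟩
        simp [constraints, signConstraints, LocalPoly.eval, LocalVar.eval, block, h', h0]
        ring_nf; done
  case expo.bit c =>
    refine ⟨block (b' 0) s.sum s.prod s.coeff s.power 0 0 0 0 0 0 0 0, ?_⟩
    subst hs
    cases c <;> simp [constraints, keep, LocalPoly.eval, LocalVar.eval, evalStep, block] <;> ring
  all_goals
    refine ⟨block (b' 0) s.sum s.prod s.coeff s.power 0 0 0 0 0 0 0 0, ?_⟩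
    subst hs
    simp [constraints, keep, LocalPoly.eval, LocalVar.eval, evalStep, block]
    try ring

/-! ### The constraints for a word -/

/-- The blocks of registers `B 0, B 1, …` satisfy the constraints that belong to a word. -/
def Satisfies (x : ℕ → ℝ) : Lex → ℕ → List Symbol → (ℕ → ℕ → ℝ) → Prop
  | _, _, [], B => B 0 0 = 0
  | q, j, t :: w, B =>
    (∀ p ∈ constraints q t, LocalPoly.eval (LocalVar.eval (B 0) (B 1) (x j)) p = 0) ∧
      Satisfies x (q.next t) (q.nextIndex t j) w fun i => B (i + 1)

/-- The last block is tied to the empty stack by `B 0 0 = 0`, and correctness spreads from there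
towards the front, in the direction of the evaluation. -/
theorem represents_of_satisfies {x : ℕ → ℝ} {q : Lex} {j : ℕ} {w : List Symbol} {B : ℕ → ℕ → ℝ}
    (hok : WordOK x q j w) (h : Satisfies x q j w B) :
    Represents (evalWord x q j w) (B 0) q := by
  induction w generalizing q j B with
  | nil =>
    obtain rfl : q = .formula := hok
    exact h
  | cons t w ih => exact represents_of_constraints hok.1 (ih hok.2 h.2) h.1

/-- Blocks are chosen from the last to the first. Those already chosen represent the true registers,
as `exists_constraints` requires. -/
theorem exists_satisfies {x : ℕ → ℝ} {q : Lex} {j : ℕ} {w : List Symbol}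
    (hok : WordOK x q j w) : ∃ B, Satisfies x q j w B := by
  induction w generalizing q j with
  | nil => exact ⟨fun _ _ => 0, rfl⟩
  | cons t w ih =>
    obtain ⟨B, hB⟩ := ih hok.2
    obtain ⟨b, hb⟩ := exists_constraints (x := x j) hok.1 (represents_of_satisfies hok.2 hB)
    exact ⟨fun i => i.casesOn b B, hb, hB⟩

/-- The end of the list of variables is where truth is asserted: the block after it must hold `1 /
2`, the code of a stack with the single entry `true`. The tallies before it impose nothing. -/
theorem satisfies_header {x : ℕ → ℝ} (n j : ℕ) (w : List Symbol) (B : ℕ → ℕ → ℝ) :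
    Satisfies x .header j (encodeUnary n ++ w) B ↔
      B (n + 1) 0 = 1 / 2 ∧ Satisfies x .formula j w fun i => B (i + n + 1) := by
  induction n generalizing B with
  | zero =>
    simp only [encodeUnary, List.replicate_zero, List.nil_append, List.singleton_append, Satisfies,
      Lex.next, Lex.nextIndex]
    refine and_congr_left' ?_
    simp [constraints, LocalPoly.eval, LocalVar.eval]
    constructor <;> intro h <;> linarith
  | succ n ih => exact (and_iff_right (by simp [constraints])).trans (ih fun i => B (i + 1))

theorem exists_satisfies_encodeSentence (S : ExistentialSentence) (x : ℕ → ℝ) :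
    (∃ B, Satisfies x .header 0 (encodeSentence S) B) ↔ S.formula.Holds fun i => x i := by
  classical
  obtain ⟨hok, hst⟩ := evaluates_encodeFormula (x := x) (fun _ => rfl) S.formula 0
  have key : ∀ B, Satisfies x .formula 0 (encodeFormula S.formula) B →
      (B 0 0 = 1 / 2 ↔ S.formula.Holds fun i => x i) := by
    intro B hB
    have h : B 0 0 = _ := represents_of_satisfies hok hB
    rw [h, hst]
    by_cases hS : S.formula.Holds fun i => x i <;> simp [stackCode, hS]
    norm_num
  constructor
  · rintro ⟨B, hB⟩
    obtain ⟨h1, h2⟩ := (satisfies_header S.n 0 _ B).1 hB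
    exact (key _ h2).1 (by simpa using h1)
  · intro hS
    obtain ⟨B, hB⟩ := exists_satisfies hok
    -- Truncated subtraction repeats the first block over the header, where the contents are
    -- unconstrained.
    refine ⟨fun i => B (i - (S.n + 1)), (satisfies_header S.n 0 _ _).2 ⟨?_, ?_⟩⟩
    · simpa using (key B hB).2 hS
    · simpa [Nat.add_assoc] using hB

/-- The numbers of the registers in a local constraint are less than `13`. -/
def LocalVar.IsSmall : LocalVar → Prop
  | cur c => c < 13
  | nxt c => c < 13
  | look => True

instance : DecidablePred LocalVar.IsSmall := fun v => by
  cases v <;> unfold LocalVar.IsSmall <;> infer_instance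

theorem isSmall_of_mem_constraints {q : Lex} {t : Symbol} :
    ∀ p ∈ constraints q t, ∀ a ∈ p, ∀ v ∈ a.2, v.IsSmall := by
  cases q <;> cases t <;> first | decide | (rename_i c; cases c <;> decide)

theorem LocalPoly.eval_congr {e e' : LocalVar → ℝ} {p : LocalPoly}
    (h : ∀ a ∈ p, ∀ v ∈ a.2, e v = e' v) : p.eval e = p.eval e' := by
  unfold LocalPoly.eval
  congr 1
  refine List.map_congr_left fun a ha => ?_
  congr 2
  exact List.map_congr_left fun v hv => h a ha v hv

/-- Only thirteen registers of a block occur in constraints; together with one variable of the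
sentence a block fills fourteen places. -/
theorem Satisfies.congr {x : ℕ → ℝ} {q : Lex} {j : ℕ} {w : List Symbol} {B B' : ℕ → ℕ → ℝ}
    (h : Satisfies x q j w B) (hB : ∀ i c, c < 13 → B i c = B' i c) :
    Satisfies x q j w B' := by
  induction w generalizing q j B B' with
  | nil => exact (hB 0 0 (by norm_num)).symm.trans h
  | cons t w ih =>
    refine ⟨fun p hp => ?_, ih h.2 fun i c hc => hB _ c hc⟩
    rw [← h.1 p hp]
    refine LocalPoly.eval_congr fun a ha v hv => ?_
    have := isSmall_of_mem_constraints p hp a ha v hv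
    cases v with
    | cur c => exact (hB 0 c this).symm
    | nxt c => exact (hB 1 c this).symm
    | look => rfl

/-! ### The constraints as one sum of negative squares -/

/-- The negative of the square of a polynomial. -/
def LocalPoly.negSq (p : LocalPoly) : LocalPoly :=
  p.flatMap fun a => p.map fun b => (-(a.1 * b.1), a.2 ++ b.2)

theorem LocalPoly.eval_append (e : LocalVar → ℝ) (p q : LocalPoly) :
    LocalPoly.eval e (p ++ q) = p.eval e + q.eval e := by
  simp [LocalPoly.eval]

theorem LocalPoly.eval_negSq (e : LocalVar → ℝ) (p : LocalPoly) :
    p.negSq.eval e = -(p.eval e) ^ 2 := by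
  have h1 : ∀ (a : ℤ × List LocalVar) (p : LocalPoly),
      LocalPoly.eval e (p.map fun b => (-(a.1 * b.1), a.2 ++ b.2)) =
        -(a.1 * (a.2.map e).prod) * p.eval e := by
    intro a p
    rw [LocalPoly.eval, LocalPoly.eval, List.map_map, ← List.sum_map_mul_left]
    congr 1
    refine List.map_congr_left fun b _ => ?_
    simp
    ring
  have h2 : ∀ p' : LocalPoly,
      LocalPoly.eval e (p'.flatMap fun a => p.map fun b => (-(a.1 * b.1), a.2 ++ b.2)) =
        -(p'.eval e) * p.eval e := by
    intro p'
    induction p' with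
    | nil => simp [LocalPoly.eval]
    | cons a p' ih =>
      rw [List.flatMap_cons, LocalPoly.eval_append, ih, h1]
      simp only [LocalPoly.eval, List.map_cons, List.sum_cons]
      ring
  rw [LocalPoly.negSq, h2]
  ring

/-- A polynomial that has the value `0` if the constraints for a symbol are satisfied, and
negative values otherwise. -/
def penalty (q : Lex) (t : Symbol) : LocalPoly := (constraints q t).flatMap LocalPoly.negSq

/-- A sum of nonpositive terms vanishes only if each of them does. -/
theorem eval_penalty (e : LocalVar → ℝ) (q : Lex) (t : Symbol) :
    (penalty q t).eval e ≤ 0 ∧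
      ((penalty q t).eval e = 0 ↔ ∀ p ∈ constraints q t, LocalPoly.eval e p = 0) := by
  unfold penalty
  induction constraints q t with
  | nil => simp [LocalPoly.eval]
  | cons p l ih =>
    rw [List.flatMap_cons, LocalPoly.eval_append, LocalPoly.eval_negSq, List.forall_mem_cons,
      ← ih.2]
    refine ⟨by nlinarith [ih.1, sq_nonneg (p.eval e)], fun h => ?_, fun h => by simp [h.1, h.2]⟩
    have h1 : p.eval e ^ 2 = 0 := by nlinarith [ih.1, sq_nonneg (p.eval e)]
    exact ⟨by simpa using h1, by nlinarith⟩

/-- The number of the variable that stands for a local variable at position `i`, if `j` is the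
index of the variable whose power is being read. -/
def LocalVar.toGlobal (i j : ℕ) : LocalVar → ℕ
  | cur c => 14 * i + (c + 1)
  | nxt c => 14 * i + (c + 15)
  | look => 14 * j

/-- The polynomial at position `i` that is given by a local polynomial. -/
def LocalPoly.toGlobal (i j : ℕ) (p : LocalPoly) : NatPoly :=
  p.map fun a => (a.1, a.2.map fun v => (v.toGlobal i j, 1))

theorem LocalPoly.eval_toGlobal (i j : ℕ) (p : LocalPoly) (y : ℕ → ℝ) :
    (p.toGlobal i j).eval y = p.eval fun v => y (v.toGlobal i j) := by
  simp [LocalPoly.toGlobal, NatPoly.eval, LocalPoly.eval, Function.comp_def]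

/-- The polynomial that tests the last block. -/
def finalPenalty : LocalPoly := [(-1, [cur 0, cur 0])]

/-- The sum of the polynomials for the symbols of a word. -/
def wordPenalty : Lex → ℕ → ℕ → List Symbol → NatPoly
  | _, i, j, [] => finalPenalty.toGlobal i j
  | q, i, j, t :: w =>
    (penalty q t).toGlobal i j ++ wordPenalty (q.next t) (i + 1) (q.nextIndex t j) w

/-- Layout of the variables: `14 * j` stands for the variable `x_j` of the sentence, and `14 * i +
(c + 1)` for register `c` of block `i`. The first register of the next block thus has offset `15`.
-/
theorem eval_wordPenalty (y : ℕ → ℝ) (q : Lex) (i j : ℕ) (w : List Symbol) :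
    (wordPenalty q i j w).eval y ≤ 0 ∧ ((wordPenalty q i j w).eval y = 0 ↔
      Satisfies (fun j => y (14 * j)) q j w fun k c => y (14 * (i + k) + (c + 1))) := by
  induction w generalizing q i j with
  | nil =>
    have : (wordPenalty q i j []).eval y = -(y (14 * i + 1) * y (14 * i + 1)) := by
      simp [wordPenalty, LocalPoly.eval_toGlobal, finalPenalty, LocalPoly.eval, LocalVar.toGlobal]
    rw [this]
    refine ⟨by nlinarith [mul_self_nonneg (y (14 * i + 1))], ?_⟩
    simp [Satisfies]
  | cons t w ih =>
    obtain ⟨h1, h2⟩ := ih (q.next t) (i + 1) (q.nextIndex t j)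
    obtain ⟨h3, h4⟩ := eval_penalty (fun v => y (v.toGlobal i j)) q t
    have e : (fun v : LocalVar => y (v.toGlobal i j)) =
        LocalVar.eval (fun c => y (14 * (i + 0) + (c + 1))) (fun c => y (14 * (i + 1) + (c + 1)))
          (y (14 * j)) := by
      funext v
      cases v with
      | cur c => rfl
      | nxt c => exact congrArg y (by simp only [LocalVar.toGlobal]; omega)
      | look => rfl
    have e' : (fun k c => y (14 * (i + (k + 1)) + (c + 1))) =
        fun k c => y (14 * (i + 1 + k) + (c + 1)) := by
      funext k c
      exact congrArg y (by omega)
    rw [wordPenalty, NatPoly.eval_append, LocalPoly.eval_toGlobal, Satisfies, e', ← h2, ← e, ← h4]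
    refine ⟨by linarith, fun h => ⟨by linarith, by linarith⟩, fun h => by linarith [h.1, h.2]⟩

theorem lt_of_mem_toGlobal {p : LocalPoly} {i j n : ℕ}
    (h : ∀ a ∈ p, ∀ v ∈ a.2, v.toGlobal i j < n) : ∀ a ∈ p.toGlobal i j, ∀ q ∈ a.2, q.1 < n := by
  intro a ha q hq
  obtain ⟨b, hb, rfl⟩ := List.mem_map.1 ha
  obtain ⟨v, hv, rfl⟩ := List.mem_map.1 hq
  exact h b hb v hv

theorem nextIndex_le (q : Lex) (t : Symbol) (j : ℕ) : q.nextIndex t j ≤ j + 1 := by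
  unfold Lex.nextIndex
  split <;> omega

/-- The index being read grows by at most one per symbol and so never exceeds the position `i`; the
place `14 * j` therefore exists as soon as the blocks do. -/
theorem lt_of_mem_wordPenalty {q : Lex} {i j n : ℕ} {w : List Symbol} (hj : j ≤ i)
    (hn : 14 * (i + w.length + 1) ≤ n) :
    ∀ a ∈ wordPenalty q i j w, ∀ s ∈ a.2, s.1 < n := by
  induction w generalizing q i j with
  | nil =>
    refine lt_of_mem_toGlobal fun a ha v hv => ?_
    simp only [List.length_nil] at hn
    simp [finalPenalty] at ha
    subst ha
    simp at hv
    subst hv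
    simp only [LocalVar.toGlobal]
    omega
  | cons t w ih =>
    have hn' : 14 * (i + 1 + w.length + 1) ≤ n := by simp only [List.length_cons] at hn; omega
    intro a ha
    rcases List.mem_append.1 ha with ha | ha
    · refine lt_of_mem_toGlobal (fun b hb v hv => ?_) a ha
      obtain ⟨p, hp, hb⟩ := List.mem_flatMap.1 hb
      obtain ⟨c, hc, hb⟩ := List.mem_flatMap.1 hb
      obtain ⟨c', hc', rfl⟩ := List.mem_map.1 hb
      have hv : v.IsSmall := by
        rcases List.mem_append.1 hv with hv | hv
        · exact isSmall_of_mem_constraints p hp c hc v hv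
        · exact isSmall_of_mem_constraints p hp c' hc' v hv
      cases v <;> simp only [LocalVar.IsSmall] at hv <;> simp only [LocalVar.toGlobal] <;> omega
    · exact ih ((nextIndex_le q t j).trans (by omega)) hn' a ha

theorem NatPoly.eval_congr {p : NatPoly} {y y' : ℕ → ℝ}
    (h : ∀ a ∈ p, ∀ q ∈ a.2, y q.1 = y' q.1) : p.eval y = p.eval y' := by
  unfold NatPoly.eval
  congr 1
  refine List.map_congr_left fun a ha => ?_
  congr 2
  exact List.map_congr_left fun q hq => by rw [h a ha q hq]

/-! ### Existential sentences as clustering instances -/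

/-- The polynomial that attains the value `1` if and only if the sentence with the given encoding
is true. -/
def rewardPoly (w : List Symbol) : NatPoly := (1, []) :: wordPenalty .header 0 0 w

theorem lt_of_mem_rewardPoly {w : List Symbol} {n : ℕ} (hn : 14 * (w.length + 1) ≤ n) :
    ∀ a ∈ rewardPoly w, ∀ s ∈ a.2, s.1 < n := by
  intro a ha
  rcases List.mem_cons.1 ha with rfl | ha
  · simp
  · exact lt_of_mem_wordPenalty le_rfl (by omega) a ha

theorem one_le_eval_rewardPoly (y : ℕ → ℝ) (w : List Symbol) :
    1 ≤ (rewardPoly w).eval y ↔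
      Satisfies (fun j => y (14 * j)) .header 0 w fun k c => y (14 * k + (c + 1)) := by
  obtain ⟨h1, h2⟩ := eval_wordPenalty y .header 0 0 w
  simp only [Nat.zero_add] at h2
  rw [rewardPoly, NatPoly.eval_cons, ← h2]
  simp only [Int.cast_one, List.map_nil, List.prod_nil, mul_one]
  constructor <;> intro h <;> linarith

/-- The clustering instance for a sentence. -/
def clusteringOfSentence (S : ExistentialSentence) : CMRCInstance where
  d := 14 * ((encodeSentence S).length + 1) + 1
  k := 2
  θ := 1
  δ := 1
  f := (rewardPoly (encodeSentence S)).toPoly _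
  one_le_k := by norm_num
  θ_pos := by norm_num
  δ_pos := by norm_num


theorem yes_clusteringOfSentence (S : ExistentialSentence) :
    ETR.Yes S ↔ CMRC.Yes (clusteringOfSentence S) := by
  set w := encodeSentence S with hw
  set n := 14 * (w.length + 1) with hn
  have hlt := lt_of_mem_rewardPoly (w := w) (n := n) le_rfl
  have hlt' : ∀ a ∈ rewardPoly w, ∀ s ∈ a.2, s.1 < n + 1 :=
    fun a ha s hs => (hlt a ha s hs).trans (Nat.lt_succ_self n)
  have hyes : CMRC.Yes (clusteringOfSentence S) ↔ ∃ p : Fin 2 → EuclideanSpace ℝ (Fin (n + 1)),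
      (∀ k, ((1 : ℚ) : ℝ) ≤ ((rewardPoly w).toPoly (n + 1)).eval (p k).ofLp) ∧
        ∀ k l, k ≠ l → ((1 : ℚ) : ℝ) ≤ ‖p k - p l‖ := Iff.rfl
  rw [hyes]
  constructor
  · rintro ⟨x, hx⟩
    set x' : ℕ → ℝ := fun i => if h : i < S.n then x ⟨i, h⟩ else 0 with hx'
    obtain ⟨B, hB⟩ := (exists_satisfies_encodeSentence S x').2 (by simpa [hx'] using hx)
    -- The values of the variables and the registers of the blocks are interleaved according to the
    -- residue modulo `14`.
    set y : ℕ → ℝ := fun m =>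
      if m % 14 = 0 then x' (m / 14) else B (m / 14) (m % 14 - 1) with hy
    have hyx : (fun j => y (14 * j)) = x' := by
      funext j
      simp [hy]
    have h1 : 1 ≤ (rewardPoly w).eval y := by
      rw [one_le_eval_rewardPoly, hyx]
      refine hB.congr fun i c hc => ?_
      have e1 : (14 * i + (c + 1)) / 14 = i := by omega
      have e2 : (14 * i + (c + 1)) % 14 = c + 1 := by omega
      simp [hy, e1, e2]
    -- The coordinate `n` does not occur in the polynomial; it is `0` at one point and `1` at the
    -- other, so the two points are at distance at least `1`.
    refine ⟨fun k => WithLp.toLp 2 fun i => update y n (k : ℕ) i, fun k => ?_, fun k l hkl => ?_⟩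
    · rw [NatPoly.eval_toPoly hlt' _ (update y n (k : ℕ)) fun _ => rfl, NatPoly.eval_congr
        (y' := y) fun a ha s hs => update_of_ne (hlt a ha s hs).ne _ _]
      simpa using h1
    · refine le_trans ?_ (PiLp.norm_apply_le _ (Fin.last n))
      have : ((k : ℕ) : ℝ) - ((l : ℕ) : ℝ) = ((k : ℤ) - (l : ℤ) : ℤ) := by push_cast; rfl
      simp only [PiLp.sub_apply, Fin.val_last, update_self, Real.norm_eq_abs, this, ← Int.cast_abs,
        Rat.cast_one]
      have : (k : ℤ) - (l : ℤ) ≠ 0 := by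
        intro h
        exact hkl (Fin.ext (by omega))
      exact_mod_cast Int.one_le_abs this
  -- One of the two points already encodes a solution; their distance is irrelevant.
  · rintro ⟨p, hp, -⟩
    set y : ℕ → ℝ := fun i => if h : i < n + 1 then p 0 ⟨i, h⟩ else 0 with hy
    have h1 := hp 0
    rw [NatPoly.eval_toPoly hlt' _ y fun i => dif_pos i.2, Rat.cast_one,
      one_le_eval_rewardPoly] at h1
    exact ⟨_, (exists_satisfies_encodeSentence S _).1 ⟨_, h1⟩⟩

theorem encode_clusteringOfSentence (S : ExistentialSentence) :
    encodeCMRC (clusteringOfSentence S) =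
      encodeUnary (14 * ((encodeSentence S).length + 1) + 1) ++ (encodeUnary 2 ++
        (encodeRat 1 ++ (encodeRat 1 ++ encodeNatPoly (rewardPoly (encodeSentence S))))) := by
  rw [← encodePoly_toPoly (n := 14 * ((encodeSentence S).length + 1) + 1)
    (lt_of_mem_rewardPoly (Nat.le_succ _))]
  rfl


/-! ### A program for the reduction of the existential theory of the reals to clustering -/

instance : Inhabited Symbol := ⟨.tally⟩

/-- The contribution of a list of monomials to the encoding of a polynomial. -/
def encodeMonos (p : NatPoly) : List Symbol := p.flatMap fun a => Symbol.item :: encodeNatMono a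

theorem encodeNatPoly_eq (p : NatPoly) : encodeNatPoly p = encodeMonos p ++ [Symbol.close] :=
  encodeList_eq_flatMap _ _

namespace StackProg

variable {R A : Type} (ρ : R → List A)

theorem expand_append (s t : List (A ⊕ R)) : expand ρ (s ++ t) = expand ρ s ++ expand ρ t :=
  List.flatMap_append

theorem expand_inl (a : A) (t : List (A ⊕ R)) : expand ρ (.inl a :: t) = a :: expand ρ t := rfl

theorem expand_inr (r : R) (t : List (A ⊕ R)) :
    expand ρ (.inr r :: t) = (ρ r).reverse ++ expand ρ t := rfl

theorem expand_nil : expand ρ ([] : List (A ⊕ R)) = [] := rfl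

theorem expand_map_inl (l : List A) : expand ρ (l.map .inl) = l := by
  simp [expand, List.flatMap_map]

theorem run_seq [DecidableEq R] (p q : StackProg R A) : (seq p q).run ρ = q.run (p.run ρ) := rfl

theorem run_loop [DecidableEq R] (r : R) (f : A → StackProg R A) :
    (loop r f).run ρ = loopRun r (fun a => (f a).run) (ρ r) ρ := rfl

theorem loopRun_skip [DecidableEq R] (r : R) (l : List A) :
    loopRun r (fun _ => (skip : StackProg R A).run) l ρ = update ρ r [] := by
  induction l generalizing ρ with
  | nil => rfl
  | cons a l ih => rw [loopRun, ih]; simp [run]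

theorem expand_replicate_inl (n : ℕ) (a : A) :
    expand ρ (List.replicate n (.inl a)) = List.replicate n a := by
  rw [← List.map_replicate, expand_map_inl]

theorem expand_flatMap {α : Type} (l : List α) (f : α → List (A ⊕ R)) :
    expand ρ (l.flatMap f) = l.flatMap fun a => expand ρ (f a) :=
  List.flatMap_assoc

end StackProg

/-- The stacks of the program that translates sentences. -/
inductive SentenceReg
  | input
  | state
  | pos
  | idx
  | acc
  | result
  | output
  deriving DecidableEq

instance : Fintype SentenceReg :=
  ⟨{.input, .state, .pos, .idx, .acc, .result, .output}, fun r => by cases r <;> decide⟩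

/-! ### The translation of sentences and its correctness -/

namespace SentenceReg

open StackProg

/-- The ranks of the stacks. -/
def rank : SentenceReg → ℕ
  | input => 0
  | state => 1
  | pos => 1
  | idx => 1
  | acc => 2
  | result => 3
  | output => 4

/-- The states of the automaton as symbols. -/
def code : Lex → Symbol
  | .header => .tally
  | .formula => .plus
  | .terms => .minus
  | .sign => .item
  | .coeff => .close
  | .factors => .neg
  | .index => .conj
  | .expo => .disj

/-- The state that belongs to a symbol. -/
def decode : Option Symbol → Lex
  | some .plus => .formula
  | some .minus => .terms
  | some .item => .sign
  | some .close => .coeff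
  | some .neg => .factors
  | some .conj => .index
  | some .disj => .expo
  | _ => .header

theorem decode_code (q : Lex) : decode (some (code q)) = q := by cases q <;> rfl

/-- The index of a variable, in unary. -/
def indexTemplate : LocalVar → List (Symbol ⊕ SentenceReg)
  | .cur c => .inr pos :: List.replicate (c + 1) (.inl .tally)
  | .nxt c => .inr pos :: List.replicate (c + 15) (.inl .tally)
  | .look => [.inr idx]

/-- The encodings of the monomials of a polynomial. -/
def template (p : LocalPoly) : List (Symbol ⊕ SentenceReg) :=
  p.flatMap fun a => .inl .item :: ((encodeInt a.1).map .inl ++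
    (a.2.flatMap (fun v => .inl .item :: (indexTemplate v ++
      [.inl .close, .inl (.bit true), .inl .close])) ++ [.inl .close]))

/-- The contents of the stacks while the sentence is read. -/
def contents (q : Lex) (i j : ℕ) (a l : List Symbol) : SentenceReg → List Symbol
  | input => l
  | state => [code q]
  | pos => List.replicate (14 * i) .tally
  | idx => List.replicate (14 * j) .tally
  | acc => a
  | result => []
  | output => []

theorem expand_template (p : LocalPoly) (q : Lex) (i j : ℕ) (a l : List Symbol) :
    expand (contents q i j a l) (template p) = encodeMonos (p.toGlobal i j) := by
  have hv : ∀ v : LocalVar, expand (contents q i j a l) (indexTemplate v) =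
      List.replicate (v.toGlobal i j) .tally := by
    intro v
    cases v <;> simp only [indexTemplate, expand_inr, expand_nil, expand_replicate_inl, contents,
      LocalVar.toGlobal, List.reverse_replicate, ← List.replicate_add, List.append_nil]
  simp [template, expand_flatMap, expand_append, expand_inl, expand_nil, expand_map_inl, hv,
    encodeMonos, LocalPoly.toGlobal, encodeNatMono, encodeList_eq_flatMap, encodePower,
    List.flatMap_map, encodeUnary, encodeBinary_one]

/-- The update of the index of the variable whose power is being read. -/
def indexStep : Lex → Symbol → StackProg SentenceReg Symbol
  | .factors, .item => .loop idx fun _ => .skip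
  | .index, .tally => write idx (List.replicate 14 (.inl .tally))
  | _, _ => .skip

/-- The program for one symbol of the sentence. -/
def step (t : Symbol) (q : Lex) : StackProg SentenceReg Symbol :=
  .seq (write acc (template (penalty q t))) <|
  .seq (.pop state) <|
  .seq (.push state (code (q.next t))) <|
  .seq (write pos (List.replicate 14 (.inl .tally))) (indexStep q t)

theorem run_indexStep (q' : Lex) (t : Symbol) (q : Lex) (i j : ℕ) (a l : List Symbol) :
    (indexStep q t).run (contents q' i j a l) = contents q' i (q.nextIndex t j) a l := by
  unfold indexStep
  split
  · rw [run, loopRun_skip]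
    funext r
    cases r <;> simp [contents, Lex.nextIndex]
  · rw [run_write (by simp), expand_replicate_inl, Lex.nextIndex]
    funext r
    cases r <;> simp only [contents, List.reverse_replicate, ← List.replicate_add, update_self,
      ne_eq, reduceCtorEq, not_false_eq_true, update_of_ne]
    congr 1
    omega
  · rename_i h1 h2
    have : q.nextIndex t j = j := by
      unfold Lex.nextIndex
      split
      · exact (h1 rfl rfl).elim
      · exact (h2 rfl rfl).elim
      · rfl
    rw [this, run]

theorem eq_of_mem_template {p : LocalPoly} {r : SentenceReg} (h : .inr r ∈ template p) :
    r = pos ∨ r = idx := by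
  simp only [template, List.mem_flatMap, List.mem_cons, List.mem_append, List.mem_map] at h
  obtain ⟨a, -, h⟩ := h
  simp at h
  obtain ⟨v, -, h⟩ := h
  cases v <;> simp [indexTemplate, List.mem_replicate] at h <;> simp [h]

theorem run_write_template (p : LocalPoly) (q : Lex) (i j : ℕ) (a l : List Symbol) :
    (write acc (template p)).run (contents q i j a l) =
      contents q i j ((encodeMonos (p.toGlobal i j)).reverse ++ a) l := by
  rw [run_write, expand_template]
  · funext r
    cases r <;> simp [contents]
  · intro r hr
    rcases eq_of_mem_template hr with rfl | rfl <;> decide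

theorem run_step (t : Symbol) (q : Lex) (i j : ℕ) (a l : List Symbol) :
    (step t q).run (contents q i j a l) = contents (q.next t) (i + 1) (q.nextIndex t j)
      ((encodeMonos ((penalty q t).toGlobal i j)).reverse ++ a) l := by
  simp only [step, run, run_write_template]
  rw [run_write (by simp), expand_replicate_inl, ← run_indexStep]
  congr 1
  funext r
  cases r <;> simp only [contents, List.reverse_replicate, ← List.replicate_add, update_self,
    ne_eq, reduceCtorEq, not_false_eq_true, update_of_ne, List.tail_cons]
  congr 1
  omega

/-- The program that translates sentences. -/
def translate : StackProg SentenceReg Symbol :=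
  .seq (.push state (code .header)) <|
  .seq (.loop input fun t => .cases state fun o => step t (decode o)) <|
  .seq (write acc (template finalPenalty)) <|
  .seq (write result (.inr pos :: ((List.replicate 15 Symbol.tally ++ Symbol.close :: (encodeUnary 2 ++
      (encodeRat 1 ++ (encodeRat 1 ++ Symbol.item :: encodeNatMono (1, []))))).map .inl ++
      [.inr acc, .inl .close]))) <|
  .loop result fun a => .push output a

/-- The stack `acc` holds the text written so far in reverse. The final index `j'` need not be
known, because the test of the last block, written next, turns the text into that of `wordPenalty`.
-/
theorem run_loop_input (w : List Symbol) (q : Lex) (i j : ℕ) (a : List Symbol) :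
    ∃ q' j' a', loopRun input (fun t => (StackProg.cases state fun o => step t (decode o)).run) w
        (contents q i j a w) = contents q' (i + w.length) j' a' [] ∧
      (encodeMonos (finalPenalty.toGlobal (i + w.length) j')).reverse ++ a' =
        (encodeMonos (wordPenalty q i j w)).reverse ++ a := by
  induction w generalizing q i j a with
  | nil => exact ⟨q, j, a, by funext r; cases r <;> simp [loopRun, contents], rfl⟩
  | cons t w ih =>
    obtain ⟨q', j', a', h1, h2⟩ := ih (q.next t) (i + 1) (q.nextIndex t j)
      ((encodeMonos ((penalty q t).toGlobal i j)).reverse ++ a)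
    have e : i + (t :: w).length = i + 1 + w.length := by simp only [List.length_cons]; omega
    have e' : update (contents q i j a (t :: w)) input w = contents q i j a w := by
      funext r; cases r <;> simp [contents]
    refine ⟨q', j', a', ?_, ?_⟩
    · rw [loopRun, e', e, ← h1, run]
      congr 1
      change (step t (decode (some (code q)))).run _ = _
      rw [decode_code, run_step]
    · rw [e, h2, wordPenalty, encodeMonos, encodeMonos, encodeMonos, List.flatMap_append]
      simp

theorem run_translate (S : ExistentialSentence) :
    translate.run (update (fun _ => []) input (encodeSentence S)) output =
      encodeCMRC (clusteringOfSentence S) := by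
  have e : (StackProg.push state (code .header)).run
      (update (fun _ => []) input (encodeSentence S)) =
      contents .header 0 0 [] (encodeSentence S) := by
    funext r; cases r <;> simp [run, contents]
  obtain ⟨q', j', a', h1, h2⟩ := run_loop_input (encodeSentence S) .header 0 0 []
  have e' : contents .header 0 0 [] (encodeSentence S) input = encodeSentence S := rfl
  rw [translate, run_seq, e, run_seq, run_loop, e', h1, run_seq, run_write_template, h2, run_seq,
    run_write (by simp), run_loop, loopRun_push (by decide)]
  simp only [expand_inr, expand_append, expand_map_inl, expand_inl, expand_nil, contents,
    update_self, ne_eq, reduceCtorEq, not_false_eq_true, update_of_ne, List.append_nil,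
    List.reverse_reverse, List.reverse_replicate]
  rw [encode_clusteringOfSentence, rewardPoly, encodeNatPoly_eq, encodeMonos, encodeMonos,
    List.flatMap_cons]
  -- At the end `pos` holds `14` tallies per symbol; the `15` further ones account for the final
  -- block and the free coordinate.
  have e2 : 14 * ((encodeSentence S).length + 1) + 1 = 14 * (0 + (encodeSentence S).length) + 15 :=
    by omega
  rw [e2, encodeUnary, encodeUnary, List.replicate_add (14 * (0 + (encodeSentence S).length)) 15]
  simp only [List.append_assoc, List.cons_append, List.nil_append]

theorem writesAbove_step (t : Symbol) (q : Lex) : (step t q).WritesAbove rank 0 := by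
  refine ⟨writesAbove_write (by decide) _, ?_, ?_, writesAbove_write (by decide) _, ?_⟩
  · show 0 < 1; decide
  · show 0 < 1; decide
  · unfold indexStep
    split
    · exact ⟨by decide, fun _ => trivial⟩
    · exact writesAbove_write (by decide) _
    · trivial

theorem wellRanked_step (t : Symbol) (q : Lex) : (step t q).WellRanked rank := by
  refine ⟨wellRanked_write fun r hr => ?_, trivial, trivial, wellRanked_write (by simp), ?_⟩
  · rcases eq_of_mem_template hr with rfl | rfl <;> decide
  · unfold indexStep
    split
    · exact fun _ => ⟨trivial, trivial⟩
    · exact wellRanked_write (by simp)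
    · trivial

theorem wellRanked_translate : translate.WellRanked rank := by
  refine ⟨trivial, fun t => ⟨fun o => wellRanked_step t _, fun o => writesAbove_step t _⟩,
    wellRanked_write fun r hr => ?_, wellRanked_write fun r hr => ?_,
    fun _ => ⟨trivial, by show 3 < 4; decide⟩⟩
  · rcases eq_of_mem_template hr with rfl | rfl <;> decide
  · simp at hr
    rcases hr with rfl | rfl <;> decide

end SentenceReg

theorem etr_polyReducible_cmrcTwo : PolyReducible ETR CMRCTwo :=
  ⟨fun S => ⟨clusteringOfSentence S, rfl, rfl, rfl⟩,
    StackProg.computableInPolyTime SentenceReg.translate SentenceReg.wellRanked_translate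
      .input .output SentenceReg.run_translate, yes_clusteringOfSentence⟩


/-! ### Hardness -/

theorem existsRealHard_cmrcTwo : ExistsRealHard CMRCTwo := fun _ hQ =>
  PolyReducible.trans hQ etr_polyReducible_cmrcTwo

/-- Both problems use the same words, so a machine for the identity computes the inclusion. -/
theorem polyReducible_restrict (P : DecisionProblem) (S : P.Instance → Prop) :
    PolyReducible (P.restrict S) P := by
  let _ := P.alphabetFintype
  let c := idComputableInPolyTime P.encode
  exact ⟨Subtype.val, ⟨{ c with outputsFun := fun a => c.outputsFun a.1 }⟩, fun _ => Iff.rfl⟩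

theorem existsRealHard_cmrc : ExistsRealHard CMRC := fun Q hQ =>
  (existsRealHard_cmrcTwo Q hQ).trans (polyReducible_restrict CMRC _)

/-! ### The reduction of Feas to the existential theory of the reals -/

/-- The stacks of the program that translates instances of Feas. -/
inductive FeasReg
  | input
  | flag
  | result
  | output
  deriving DecidableEq

instance : Fintype FeasReg :=
  ⟨{.input, .flag, .result, .output}, fun r => by cases r <;> decide⟩

namespace FeasReg

open StackProg

/-- The ranks of the stacks. -/
def rank : FeasReg → ℕ
  | input => 0
  | flag => 1
  | result => 1
  | output => 2

/-- The program for one symbol; the flag is set when the list of variables has been read. -/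
def step (t : Symbol) : StackProg FeasReg Symbol :=
  .cases flag fun o => match o, t with
    | none, .close => .seq (write result [.inl .close, .inl .eqZero]) (.push flag .tally)
    | _, t => .push result t

/-- The program that inserts the relation symbol. -/
def translate : StackProg FeasReg Symbol :=
  .seq (.loop input step) (.loop result fun a => .push output a)

/-- The contents of the stacks while the instance is read. -/
def contents (b a l : List Symbol) : FeasReg → List Symbol
  | input => l
  | flag => b
  | result => a
  | output => []

theorem loopRun_step_of_flag (b : Symbol) (a l : List Symbol) :
    loopRun input (fun t => (step t).run) l (contents [b] a l) =
      contents [b] (l.reverse ++ a) [] := by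
  induction l generalizing a with
  | nil => funext r; cases r <;> simp [loopRun, contents]
  | cons t l ih =>
    have e : (step t).run (update (contents [b] a (t :: l)) input l) = contents [b] (t :: a) l := by
      funext r; cases r <;> simp [step, run, contents]
    rw [loopRun, e, ih]
    simp

/-- An instance of Feas and the corresponding sentence differ only by `eqZero` after the list of
variables, that is, after the first `close`. -/
theorem loopRun_step (n : ℕ) (a l : List Symbol) :
    loopRun input (fun t => (step t).run) (encodeUnary n ++ l) (contents [] a (encodeUnary n ++ l)) =
      contents [.tally] ((encodeUnary n ++ .eqZero :: l).reverse ++ a) [] := by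
  induction n generalizing a with
  | zero =>
    have e : (step .close).run (update (contents [] a (.close :: l)) input l) =
        contents [.tally] (.eqZero :: .close :: a) l := by
      funext r; cases r <;> simp [step, run, contents, write]
    change loopRun input _ (.close :: l) (contents [] a (.close :: l)) = _
    rw [loopRun, e, loopRun_step_of_flag]
    simp [encodeUnary]
  | succ n ih =>
    have e : (step .tally).run (update (contents [] a (.tally :: (encodeUnary n ++ l))) input
        (encodeUnary n ++ l)) = contents [] (.tally :: a) (encodeUnary n ++ l) := by
      funext r; cases r <;> simp [step, run, contents]
    change loopRun input _ (.tally :: (encodeUnary n ++ l))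
      (contents [] a (.tally :: (encodeUnary n ++ l))) = _
    rw [loopRun, e, ih]
    simp [encodeUnary, List.replicate_succ]

theorem run_translate (I : FeasInstance) :
    translate.run (update (fun _ => []) input (encodeFeas I)) output =
      encodeSentence ⟨I.m, .eqZero I.r⟩ := by
  have e : update (fun _ => []) input (encodeFeas I) =
      contents [] [] (encodeUnary I.m ++ encodePoly I.r) := by
    funext r; cases r <;> simp [contents, encodeFeas]
  have h : (loop input step).run (contents [] [] (encodeUnary I.m ++ encodePoly I.r)) = _ :=
    loopRun_step I.m [] (encodePoly I.r)
  rw [translate, run_seq, e, h, run_loop, loopRun_push (by decide)]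
  simp [contents, encodeSentence, encodeFormula]

theorem wellRanked_translate : translate.WellRanked rank := by
  refine ⟨fun t => ⟨fun o => ?_, fun o => ?_⟩, fun a => ⟨trivial, by show 1 < 2; decide⟩⟩
  · dsimp only
    split
    · exact ⟨wellRanked_write (by simp), trivial⟩
    · trivial
  · dsimp only
    split
    · exact ⟨writesAbove_write (by decide) _, by show 0 < 1; decide⟩
    · show 0 < 1; decide

end FeasReg

theorem feas_polyReducible_etr : PolyReducible Feas ETR :=
  ⟨fun I => ⟨I.m, .eqZero I.r⟩, StackProg.computableInPolyTime FeasReg.translate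
    FeasReg.wellRanked_translate .input .output FeasReg.run_translate, fun _ => Iff.rfl⟩

theorem feas_polyReducible_cmrcTwo : PolyReducible Feas CMRCTwo :=
  feas_polyReducible_etr.trans etr_polyReducible_cmrcTwo


/-! ### Clustering instances as existential sentences -/

/-- The conjunction of a list of formulas. -/
def conjAll {n : ℕ} (l : List (Formula n)) : Formula n := l.foldr .conj (.eqZero [])

theorem holds_conjAll {n : ℕ} (l : List (Formula n)) (x : Fin n → ℝ) :
    (conjAll l).Holds x ↔ ∀ φ ∈ l, φ.Holds x := by
  induction l with
  | nil => simp [conjAll, Formula.Holds, Poly.eval, Poly.toMvPolynomial]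
  | cons φ l ih =>
    rw [List.forall_mem_cons, ← ih]
    rfl

theorem encodeFormula_conjAll {n : ℕ} (l : List (Formula n)) :
    encodeFormula (conjAll l) =
      l.flatMap (fun φ => Symbol.conj :: encodeFormula φ) ++ [Symbol.eqZero, Symbol.close] := by
  induction l with
  | nil => rfl
  | cons φ l ih =>
    change Symbol.conj :: (encodeFormula φ ++ encodeFormula (conjAll l)) = _
    rw [ih]
    simp

/-- An equation or a weak inequality between a polynomial and zero. -/
inductive Clause
  | eqZero (p : NatPoly)
  | geZero (p : NatPoly)

namespace Clause

/-- The polynomial of a clause. -/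
def poly : Clause → NatPoly
  | eqZero p => p
  | geZero p => p

/-- Truth of a clause. -/
def Holds (y : ℕ → ℝ) : Clause → Prop
  | eqZero p => p.eval y = 0
  | geZero p => 0 ≤ p.eval y

/-- The formula that is given by a clause. -/
def toFormula (n : ℕ) [NeZero n] : Clause → Formula n
  | eqZero p => .eqZero (p.toPoly n)
  | geZero p => .geZero (p.toPoly n)

/-- The contribution of a clause to the encoding of a conjunction. -/
def encode : Clause → List Symbol
  | eqZero p => .conj :: .eqZero :: encodeNatPoly p
  | geZero p => .conj :: .geZero :: encodeNatPoly p

/-- The variables of the clause have indices less than `n`. -/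
def IsBelow (n : ℕ) (c : Clause) : Prop := ∀ a ∈ c.poly, ∀ q ∈ a.2, q.1 < n

theorem holds_toFormula {n : ℕ} [NeZero n] {c : Clause} (h : c.IsBelow n) (x : Fin n → ℝ)
    (y : ℕ → ℝ) (hy : ∀ i : Fin n, y i = x i) : (c.toFormula n).Holds x ↔ c.Holds y := by
  have e := NatPoly.eval_toPoly h x y hy
  cases c <;> simp only [poly] at e <;> simp only [toFormula, Formula.Holds, Holds, e]

theorem encode_toFormula {n : ℕ} [NeZero n] {c : Clause} (h : c.IsBelow n) :
    Symbol.conj :: encodeFormula (c.toFormula n) = c.encode := by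
  have e := encodePoly_toPoly h
  cases c <;> simp only [poly] at e <;> simp only [toFormula, encodeFormula, encode, e]

end Clause

/-- The polynomial with all indices of variables raised by `b`. -/
def NatPoly.shift (b : ℕ) (p : NatPoly) : NatPoly :=
  p.map fun a => (a.1, a.2.map fun q => (b + q.1, q.2))

theorem NatPoly.eval_shift (b : ℕ) (p : NatPoly) (y : ℕ → ℝ) :
    (p.shift b).eval y = p.eval fun i => y (b + i) := by
  simp [NatPoly.shift, NatPoly.eval, Function.comp_def]

/-- The variable `v` has the value `q`. -/
def valueClause (v : ℕ) (q : ℚ) : Clause := .eqZero [(-q.num, []), (q.den, [(v, 1)])]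

/-- Forcing a variable to equal a rational number by a linear equation keeps all coefficients
integral, so no coefficient of `f` has to be multiplied by a denominator. -/
theorem holds_valueClause (v : ℕ) (q : ℚ) (y : ℕ → ℝ) :
    (valueClause v q).Holds y ↔ y v = q := by
  have h : (q.den : ℝ) ≠ 0 := by exact_mod_cast q.den_nz
  have e : (q : ℝ) = q.num / q.den := Rat.cast_def q
  simp only [valueClause, Clause.Holds, NatPoly.eval, List.map_cons, List.map_nil, List.prod_nil,
    List.prod_cons, List.sum_cons, List.sum_nil]
  rw [e, eq_div_iff h]
  push_cast
  constructor <;> intro h <;> linarith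

/-- The polynomial `p` at the point with coordinates `b, b + 1, …` is at least the variable `0`. -/
def thresholdClause (p : NatPoly) (b : ℕ) : Clause := .geZero ((-1, [(0, 1)]) :: p.shift b)

theorem holds_thresholdClause (p : NatPoly) (b : ℕ) (y : ℕ → ℝ) :
    (thresholdClause p b).Holds y ↔ y 0 ≤ p.eval fun i => y (b + i) := by
  simp [thresholdClause, Clause.Holds, NatPoly.eval_cons, NatPoly.eval_shift]

/-- The square of the difference of two variables. -/
def sqDiff (a b : ℕ) : NatPoly := [(1, [(a, 2)]), (-2, [(a, 1), (b, 1)]), (1, [(b, 2)])]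

/-- The square of the distance of the points with coordinates `b, b + 1, …` and `b', b' + 1, …` is
at least the square of the variable `1`. -/
def distanceClause (d b b' : ℕ) : Clause :=
  .geZero ((-1, [(1, 2)]) :: (List.range d).flatMap fun a => sqDiff (b + a) (b' + a))

theorem holds_distanceClause (d b b' : ℕ) (y : ℕ → ℝ) :
    (distanceClause d b b').Holds y ↔
      y 1 ^ 2 ≤ ∑ a : Fin d, (y (b + a) - y (b' + a)) ^ 2 := by
  have h : ∀ l : List ℕ, NatPoly.eval (l.flatMap fun a => sqDiff (b + a) (b' + a)) y =
      (l.map fun a => (y (b + a) - y (b' + a)) ^ 2).sum := by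
    intro l
    induction l with
    | nil => rfl
    | cons a l ih =>
      rw [List.flatMap_cons, NatPoly.eval_append, ih, List.map_cons, List.sum_cons]
      simp [sqDiff, NatPoly.eval]
      ring
  rw [distanceClause, Clause.Holds, NatPoly.eval_cons, h, ← Finset.sum_range fun a =>
    (y (b + a) - y (b' + a)) ^ 2, ← List.sum_toFinset _ (List.nodup_range), List.toFinset_range]
  simp

/-- The clauses for a clustering instance. -/
def clusteringClauses (I : CMRCInstance) : List Clause :=
  valueClause 0 I.θ :: valueClause 1 I.δ :: (List.range I.k).flatMap fun i =>
    thresholdClause I.f.toNatPoly (2 + i * I.d) ::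
      (List.range i).map fun j => distanceClause I.d (2 + i * I.d) (2 + j * I.d)

theorem add_lt_of_lt {d i k a : ℕ} (hi : i < k) (ha : a < d) : 2 + i * d + a < 2 + k * d := by
  have : (i + 1) * d ≤ k * d := Nat.mul_le_mul_right d hi
  rw [Nat.add_mul] at this
  omega

theorem isBelow_of_mem_clusteringClauses {I : CMRCInstance} {c : Clause}
    (hc : c ∈ clusteringClauses I) : c.IsBelow (2 + I.k * I.d) := by
  simp only [clusteringClauses, List.mem_cons, List.mem_flatMap, List.mem_range, List.mem_map] at hc
  rcases hc with rfl | rfl | ⟨i, hi, rfl | ⟨j, hj, rfl⟩⟩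
  · simp [Clause.IsBelow, valueClause, Clause.poly]
  · simp [Clause.IsBelow, valueClause, Clause.poly]
    omega
  · intro a ha q hq
    rcases List.mem_cons.1 ha with rfl | ha
    · simp at hq
      subst hq
      simp only
      omega
    · obtain ⟨b, hb, rfl⟩ := List.mem_map.1 ha
      obtain ⟨s, hs, rfl⟩ := List.mem_map.1 hq
      obtain ⟨c, -, rfl⟩ := List.mem_map.1 hb
      obtain ⟨v, -, rfl⟩ := List.mem_map.1 hs
      exact add_lt_of_lt hi v.1.2
  · intro a ha q hq
    simp only [distanceClause, Clause.poly, List.mem_cons, List.mem_flatMap, List.mem_range] at ha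
    rcases ha with rfl | ⟨s, hs, ha⟩
    · simp at hq
      subst hq
      simp only
      omega
    · have h1 := add_lt_of_lt hi hs
      have h2 := add_lt_of_lt (hj.trans hi) hs
      simp only [sqDiff, List.mem_cons, List.not_mem_nil, or_false] at ha
      rcases ha with rfl | rfl | rfl <;> simp at hq
      · subst hq; exact h1
      · rcases hq with rfl | rfl
        · exact h1
        · exact h2
      · subst hq; exact h2

/-- The sentence for a clustering instance. -/
def sentenceOfClustering (I : CMRCInstance) : ExistentialSentence where
  n := 2 + I.k * I.d
  formula := conjAll ((clusteringClauses I).map (Clause.toFormula _))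

theorem encode_sentenceOfClustering (I : CMRCInstance) :
    encodeSentence (sentenceOfClustering I) = encodeUnary (2 + I.k * I.d) ++
      ((clusteringClauses I).flatMap Clause.encode ++ [Symbol.eqZero, Symbol.close]) := by
  rw [encodeSentence, sentenceOfClustering, encodeFormula_conjAll, List.flatMap_map]
  congr 2
  exact List.flatMap_congr fun c hc =>
    Clause.encode_toFormula (isBelow_of_mem_clusteringClauses hc)

theorem yes_sentenceOfClustering_iff (I : CMRCInstance) :
    ETR.Yes (sentenceOfClustering I) ↔ ∃ y : ℕ → ℝ, ∀ c ∈ clusteringClauses I, c.Holds y := by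
  have key : ∀ (x : Fin (2 + I.k * I.d) → ℝ) (y : ℕ → ℝ), (∀ i : Fin _, y i = x i) →
      ((sentenceOfClustering I).formula.Holds x ↔ ∀ c ∈ clusteringClauses I, c.Holds y) := by
    intro x y h
    refine (holds_conjAll _ x).trans (List.forall_mem_map.trans ?_)
    exact forall₂_congr fun c hc =>
      Clause.holds_toFormula (isBelow_of_mem_clusteringClauses hc) x y h
  constructor
  · rintro ⟨x, hx⟩
    exact ⟨fun i => if h : i < 2 + I.k * I.d then x ⟨i, h⟩ else 0,
      (key x _ fun i => dif_pos i.2).1 hx⟩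
  · rintro ⟨y, hy⟩
    exact ⟨fun i => y i, (key _ y fun _ => rfl).2 hy⟩

theorem le_norm_sub_iff {d : ℕ} {δ : ℝ} (hδ : 0 ≤ δ) (p q : EuclideanSpace ℝ (Fin d)) :
    δ ≤ ‖p - q‖ ↔ δ ^ 2 ≤ ∑ a, (p a - q a) ^ 2 := by
  rw [← abs_of_nonneg hδ, ← abs_norm (p - q), ← sq_le_sq, EuclideanSpace.norm_sq_eq]
  simp

theorem yes_sentenceOfClustering (I : CMRCInstance) :
    CMRC.Yes I ↔ ETR.Yes (sentenceOfClustering I) := by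
  have hδ : (0 : ℝ) ≤ (I.δ : ℝ) := by exact_mod_cast I.δ_pos.le
  have key : ∀ (p : Fin I.k → EuclideanSpace ℝ (Fin I.d)) (y : ℕ → ℝ), y 0 = I.θ → y 1 = I.δ →
      (∀ (i : Fin I.k) (a : Fin I.d), y (2 + i * I.d + a) = p i a) →
      (((∀ i, (I.θ : ℝ) ≤ I.f.eval (p i).ofLp) ∧ ∀ i j, i ≠ j → (I.δ : ℝ) ≤ ‖p i - p j‖) ↔
        ∀ c ∈ clusteringClauses I, c.Holds y) := by
    intro p y h0 h1 h
    have ht : ∀ i : Fin I.k, (thresholdClause I.f.toNatPoly (2 + i * I.d)).Holds y ↔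
        (I.θ : ℝ) ≤ I.f.eval (p i).ofLp := by
      intro i
      rw [holds_thresholdClause, h0, Poly.eval_eq I.f _ (fun a => y (2 + i * I.d + a)) (h i)]
    have hd : ∀ i j : Fin I.k, (distanceClause I.d (2 + i * I.d) (2 + j * I.d)).Holds y ↔
        (I.δ : ℝ) ≤ ‖p i - p j‖ := by
      intro i j
      rw [holds_distanceClause, h1, le_norm_sub_iff hδ]
      simp only [h]
    rw [clusteringClauses, List.forall_mem_cons, List.forall_mem_cons, holds_valueClause,
      holds_valueClause, and_iff_right h0, and_iff_right h1]
    simp only [List.mem_flatMap, List.mem_range, List.mem_cons, List.mem_map]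
    constructor
    · rintro ⟨ha, hb⟩ c ⟨i, hi, rfl | ⟨j, hj, rfl⟩⟩
      · exact (ht ⟨i, hi⟩).2 (ha _)
      · exact (hd ⟨i, hi⟩ ⟨j, hj.trans hi⟩).2 (hb _ _ (Fin.ne_of_val_ne hj.ne'))
    · intro hc
      refine ⟨fun i => (ht i).1 (hc _ ⟨i, i.2, Or.inl rfl⟩), fun i j hij => ?_⟩
      -- There are clauses only for pairs with `j < i`; symmetry of the distance supplies the
      -- others.
      rcases lt_or_gt_of_ne hij with hlt | hlt
      · rw [norm_sub_rev]
        exact (hd j i).1 (hc _ ⟨j, j.2, Or.inr ⟨i, hlt, rfl⟩⟩)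
      · exact (hd i j).1 (hc _ ⟨i, i.2, Or.inr ⟨j, hlt, rfl⟩⟩)
  rw [yes_sentenceOfClustering_iff]
  constructor
  · rintro ⟨p, hp⟩
    -- Coordinate `a` of point `i` has number `i * I.d + a`, so division with remainder recovers
    -- both; the second condition can fail only in dimension zero.
    let g : ℕ → ℝ := fun m => if h : m / I.d < I.k ∧ m % I.d < I.d then
      p ⟨m / I.d, h.1⟩ ⟨m % I.d, h.2⟩ else 0
    let y : ℕ → ℝ := fun m => match m with
      | 0 => I.θ
      | 1 => I.δ
      | m + 2 => g m
    refine ⟨y, (key p y rfl rfl fun i a => ?_).1 hp⟩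
    have e : 2 + i * I.d + a = (i * I.d + a) + 2 := by omega
    have hpos : 0 < I.d := a.pos
    have e1 : (i * I.d + a) / I.d = i := by
      rw [Nat.add_comm, Nat.add_mul_div_right _ _ hpos, Nat.div_eq_of_lt a.2, Nat.zero_add]
    have e2 : (i * I.d + a) % I.d = a := by
      rw [Nat.add_comm, Nat.add_mul_mod_self_right, Nat.mod_eq_of_lt a.2]
    rw [e]
    change g (i * I.d + a) = _
    simp [g, e1, e2]
  · rintro ⟨y, hy⟩
    refine ⟨fun i => WithLp.toLp 2 fun a => y (2 + i * I.d + a), (key _ y ?_ ?_ ?_).2 hy⟩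
    · exact (holds_valueClause 0 _ y).1 (hy _ (by simp [clusteringClauses]))
    · exact (holds_valueClause 1 _ y).1 (hy _ (by simp [clusteringClauses]))
    · intro i a
      rfl


/-! ### A program for the reduction of clustering to the existential theory of the reals -/

/-- The stacks of the program that translates clustering instances. -/
inductive ClusterReg
  | input
  | state
  | dim
  | count
  | poly
  | polyRev
  | polyCopy
  | base
  | done
  | doneCopy
  | base'
  | dimCopy
  | off
  | acc
  | result
  | output
  deriving DecidableEq

instance : Fintype ClusterReg :=
  ⟨{.input, .state, .dim, .count, .poly, .polyRev, .polyCopy, .base, .done, .doneCopy, .base',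
    .dimCopy, .off, .acc, .result, .output}, fun r => by cases r <;> decide⟩

/-- The states of the automaton that reads clustering instances. -/
inductive ClusterLex
  | dim
  | count
  | num
  | den
  | num'
  | den'
  | terms
  | sign
  | coeff
  | factors
  | index
  | expo
  deriving DecidableEq

/-! ### The automaton that reads clustering instances -/

namespace ClusterLex

/-- The transitions of the automaton. -/
def next : ClusterLex → Symbol → ClusterLex
  | dim, .close => count
  | count, .close => num
  | num, .close => den
  | den, .close => num'
  | num', .close => den'
  | den', .close => terms
  | terms, .item => sign
  | sign, _ => coeff
  | coeff, .close => factors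
  | factors, .item => index
  | factors, .close => terms
  | index, .close => expo
  | expo, .close => factors
  | q, _ => q

/-- The stack on which the automaton writes. -/
def target : ClusterLex → Symbol → ClusterReg
  | dim, .tally => .dim
  | count, .tally => .count
  | terms, _ => .poly
  | sign, _ => .poly
  | coeff, _ => .poly
  | factors, _ => .poly
  | index, _ => .poly
  | expo, _ => .poly
  | _, _ => .acc

/-- The word that is written by the automaton. The indices of variables are preceded by a mark. -/
def emit : ClusterLex → Symbol → List Symbol
  | dim, .close => []
  | count, .close => [.conj, .eqZero, .item, .minus]
  | num, .plus => []
  | num, .close => [.close, .close, .item, .plus]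
  | den, .close => [.close, .item, .close, .bit true, .close, .close, .close, .conj, .eqZero,
      .item, .minus]
  | num', .plus => []
  | num', .close => [.close, .close, .item, .plus]
  | den', .close => [.close, .item, .tally, .close, .bit true, .close, .close, .close]
  | factors, .item => [.item, .disj]
  | _, t => [t]

/-- The states of the automaton as symbols. -/
def code : ClusterLex → Symbol
  | dim => .tally
  | count => .plus
  | num => .minus
  | den => .item
  | num' => .close
  | den' => .neg
  | terms => .conj
  | sign => .disj
  | coeff => .eqZero
  | factors => .gtZero
  | index => .geZero
  | expo => .bit true

/-- The state that belongs to a symbol. -/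
def decode : Option Symbol → ClusterLex
  | some .plus => count
  | some .minus => num
  | some .item => den
  | some .close => num'
  | some .neg => den'
  | some .conj => terms
  | some .disj => sign
  | some .eqZero => coeff
  | some .gtZero => factors
  | some .geZero => index
  | some (.bit true) => expo
  | _ => dim

theorem decode_code (q : ClusterLex) : decode (some (code q)) = q := by cases q <;> rfl

/-- The word that is written on the stack `r` while a word is read. -/
def written (r : ClusterReg) : ClusterLex → List Symbol → List Symbol
  | _, [] => []
  | q, t :: w => (if r = q.target t then q.emit t else []) ++ written r (q.next t) w

theorem written_append {r : ClusterReg} (r' : ClusterReg) {q : ClusterLex} {l w : List Symbol}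
    (h : ∀ t ∈ l, q.next t = q ∧ q.target t = r' ∧ q.emit t = [t]) :
    written r q (l ++ w) = (if r = r' then l else []) ++ written r q w := by
  induction l with
  | nil => simp
  | cons t l ih =>
    obtain ⟨⟨h1, h2, h3⟩, h⟩ := List.forall_mem_cons.1 h
    rw [List.cons_append, written, h1, h2, h3, ih h]
    split_ifs <;> rfl

variable {r : ClusterReg} {w : List Symbol}

theorem written_bits (r' : ClusterReg) {q : ClusterLex} (l : List Bool)
    (h : ∀ b, q.next (.bit b) = q ∧ q.target (.bit b) = r' ∧ q.emit (.bit b) = [.bit b]) :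
    written r q (l.map .bit ++ w) = (if r = r' then l.map .bit else []) ++ written r q w :=
  written_append r' (List.forall_mem_map.2 fun b _ => h b)

theorem written_tallies (r' : ClusterReg) {q : ClusterLex} (n : ℕ)
    (h : q.next .tally = q ∧ q.target .tally = r' ∧ q.emit .tally = [.tally]) :
    written r q (List.replicate n .tally ++ w) =
      (if r = r' then List.replicate n .tally else []) ++ written r q w :=
  written_append r' fun _ ht => List.eq_of_mem_replicate ht ▸ h

theorem written_dim (n : ℕ) : written r dim (encodeUnary n ++ w) =
    (if r = .dim then List.replicate n .tally else []) ++ written r count w := by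
  rw [encodeUnary, List.append_assoc, written_tallies .dim _ ⟨rfl, rfl, rfl⟩]
  simp [written, next, emit]

theorem written_count (n : ℕ) : written r count (encodeUnary n ++ w) =
    (if r = .count then List.replicate n .tally else []) ++
      ((if r = .acc then [.conj, .eqZero, .item, .minus] else []) ++ written r num w) := by
  rw [encodeUnary, List.append_assoc, written_tallies .count _ ⟨rfl, rfl, rfl⟩]
  by_cases hr : r = .acc <;> simp [written, next, emit, target, hr]

theorem encodeClause_valueClause {v : ℕ} {q : ℚ} (hq : 0 < q) :
    (valueClause v q).encode = .conj :: .eqZero :: .item :: .minus ::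
      ((Computability.encodeNat q.num.natAbs).map .bit ++ .close :: .close :: .item :: .plus ::
        ((Computability.encodeNat q.den).map .bit ++ .close :: .item ::
          (List.replicate v .tally ++ [.close, .bit true, .close, .close, .close]))) := by
  have h : 0 < q.num := Rat.num_pos.2 hq
  simp [valueClause, Clause.encode, encodeNatPoly, encodeList, encodeNatMono, encodeInt,
    encodePower, encodeUnary, encodeBinary, h,
    show Computability.encodeNat 1 = [true] from rfl]

/-- The opening symbols of the first clause are written at the end of `count`, those of the second
at the end of the first denominator. They include the `minus` of the negated numerator, so the
`plus` that is read, guaranteed by positivity, is dropped. -/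
theorem written_num {θ δ : ℚ} (hθ : 0 < θ) (hδ : 0 < δ) :
    (if r = .acc then [.conj, .eqZero, .item, .minus] else []) ++
        written r num (encodeRat θ ++ (encodeRat δ ++ w)) =
      (if r = .acc then (valueClause 0 θ).encode ++ (valueClause 1 δ).encode else []) ++
        written r terms w := by
  have h1 : ¬ θ.num < 0 := not_lt.2 (Rat.num_pos.2 hθ).le
  have h2 : ¬ δ.num < 0 := not_lt.2 (Rat.num_pos.2 hδ).le
  simp only [encodeRat, encodeInt, encodeBinary, if_neg h1, if_neg h2, List.append_assoc,
    List.cons_append, List.nil_append]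
  rw [written, next, emit, written_bits .acc, written, next, emit, written_bits .acc, written, next, emit, written, next, emit,
    written_bits .acc, written, next, emit, written_bits .acc, written, next, emit, encodeClause_valueClause hθ,
    encodeClause_valueClause hδ]
  · by_cases hr : r = .acc <;> simp [hr, target]
  all_goals first | exact fun _ => ⟨rfl, rfl, rfl⟩ | simp

/-- The encoding of a power of a variable, preceded by a mark. -/
def markPower (q : ℕ × ℕ) : List Symbol := .disj :: encodePower q

/-- The encoding of a polynomial, with a mark before the index of every variable. -/
def markPoly (p : NatPoly) : List Symbol :=
  encodeList (fun a => encodeInt a.1 ++ encodeList markPower a.2) p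

theorem written_factors (l : List (ℕ × ℕ)) : written r factors (encodeList encodePower l ++ w) =
    (if r = .poly then encodeList markPower l else []) ++ written r terms w := by
  induction l with
  | nil => by_cases hr : r = .poly <;> simp [encodeList, written, next, target, emit, hr]
  | cons q l ih =>
    simp only [encodeList, encodePower, encodeUnary, encodeBinary, List.append_assoc,
      List.cons_append, List.nil_append]
    rw [written, next, emit, written_tallies .poly, written, next, emit, written_bits .poly,
      written, next, emit, ih]
    · by_cases hr : r = .poly <;>
        simp [hr, target, markPower, encodePower, encodeUnary, encodeBinary]
    all_goals first | exact fun _ => ⟨rfl, rfl, rfl⟩ | exact ⟨rfl, rfl, rfl⟩ | simp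

theorem written_sign (c : ℤ) : written r sign (encodeInt c ++ w) =
    (if r = .poly then encodeInt c else []) ++ written r factors w := by
  simp only [encodeInt, encodeBinary, List.append_assoc, List.cons_append, List.nil_append]
  rw [written, next, written_bits .poly, written, next, emit]
  · by_cases hr : r = .poly <;> by_cases hc : c < 0 <;> simp [hr, hc, target, emit]
  all_goals first | exact fun _ => ⟨rfl, rfl, rfl⟩ | simp

theorem written_terms (p : NatPoly) : written r terms (encodeNatPoly p) =
    if r = .poly then markPoly p else [] := by
  induction p with
  | nil =>
    by_cases hr : r = .poly <;>
      simp [encodeNatPoly, encodeList, written, target, emit, markPoly, hr]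
  | cons a p ih =>
    rw [encodeNatPoly] at ih
    simp only [encodeNatPoly, encodeList, encodeNatMono, List.append_assoc]
    rw [written, next, written_sign, written_factors, ih]
    by_cases hr : r = .poly <;> simp [hr, target, emit, markPoly, encodeList]

theorem written_encodeCMRC (r : ClusterReg) (I : CMRCInstance) :
    written r dim (encodeCMRC I) =
      (if r = .dim then List.replicate I.d .tally else []) ++
      ((if r = .count then List.replicate I.k .tally else []) ++
      ((if r = .acc then (valueClause 0 I.θ).encode ++ (valueClause 1 I.δ).encode else []) ++
      (if r = .poly then markPoly I.f.toNatPoly else []))) := by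
  rw [encodeCMRC, written_dim, written_count, written_num I.θ_pos I.δ_pos, encodePoly_eq,
    written_terms]

/-- The word in which every mark is replaced by the number `b` in unary. -/
def fill (b : ℕ) (l : List Symbol) : List Symbol :=
  l.flatMap fun s => if s = .disj then List.replicate b .tally else [s]

theorem fill_of_notMem {b : ℕ} {l : List Symbol} (h : .disj ∉ l) : fill b l = l := by
  rw [fill, List.flatMap_congr (g := fun s => [s]) fun s hs => if_neg (ne_of_mem_of_not_mem hs h)]
  simp

theorem fill_append (b : ℕ) (l m : List Symbol) : fill b (l ++ m) = fill b l ++ fill b m :=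
  List.flatMap_append

theorem fill_cons (b : ℕ) (s : Symbol) (l : List Symbol) :
    fill b (s :: l) = (if s = .disj then List.replicate b .tally else [s]) ++ fill b l := rfl

theorem fill_encodeList {α : Type} (b : ℕ) (e : α → List Symbol) (l : List α) :
    fill b (encodeList e l) = encodeList (fun a => fill b (e a)) l := by
  induction l with
  | nil => rfl
  | cons a l ih => simp [encodeList, fill_cons, fill_append, ih]

/-- Indices are unary, so raising one by `b` means writing `b` tallies in front of it. The mark
`disj` occurs nowhere in the encoding of a polynomial and thus identifies these places. -/
theorem fill_markPoly (b : ℕ) (p : NatPoly) :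
    fill b (markPoly p) = encodeNatPoly (p.shift b) := by
  have h1 : ∀ c : ℤ, fill b (encodeInt c) = encodeInt c := by
    intro c
    refine fill_of_notMem ?_
    by_cases hc : c < 0 <;> simp [encodeInt, encodeBinary, hc]
  have h2 : ∀ q : ℕ × ℕ, fill b (markPower q) = encodePower (b + q.1, q.2) := by
    intro q
    have : Symbol.disj ∉ encodePower q := by
      simp [encodePower, encodeUnary, encodeBinary, List.mem_replicate]
    rw [markPower, fill_cons, fill_of_notMem this]
    simp only [encodePower, encodeUnary, List.replicate_add, if_true, List.append_assoc]
  rw [markPoly, fill_encodeList, encodeNatPoly, NatPoly.shift, encodeList_map]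
  simp only [fill_append, h1, fill_encodeList, h2, encodeNatMono, encodeList_map]

end ClusterLex


/-! ### The translation of clustering instances and its correctness -/

namespace ClusterReg

open StackProg ClusterLex

/-- The ranks of the stacks. -/
def rank : ClusterReg → ℕ
  | input => 0
  | state => 1
  | dim => 1
  | count => 1
  | poly => 1
  | polyRev => 2
  | base => 2
  | done => 2
  | polyCopy => 3
  | doneCopy => 3
  | dimCopy => 4
  | base' => 5
  | off => 5
  | acc => 6
  | result => 7
  | output => 8

/-- The program for one symbol of the instance. -/
def scanStep (t : Symbol) (q : ClusterLex) : StackProg ClusterReg Symbol :=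
  .seq (write (q.target t) ((q.emit t).map .inl)) (.seq (.pop state) (.push state (q.next t).code))

theorem target_eq (q : ClusterLex) (t : Symbol) :
    q.target t = dim ∨ q.target t = count ∨ q.target t = poly ∨ q.target t = acc := by
  cases q <;> cases t <;> simp [target]

theorem target_ne (q : ClusterLex) (t : Symbol) : q.target t ≠ input ∧ q.target t ≠ state := by
  rcases target_eq q t with h | h | h | h <;> simp [h]

theorem run_scanStep (t : Symbol) (q : ClusterLex) (ρ : ClusterReg → List Symbol)
    (hq : ρ state = [q.code]) (r : ClusterReg) :
    (scanStep t q).run ρ r = if r = state then [(q.next t).code] else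
      (if r = q.target t then q.emit t else []).reverse ++ ρ r := by
  have h := (target_ne q t).2
  rw [scanStep, run_seq, run_write (by simp), expand_map_inl]
  simp only [run]
  by_cases h1 : r = state
  · subst h1
    simp [h.symm, hq]
  · by_cases h2 : r = q.target t
    · subst h2
      simp [h]
    · simp [h1, h2]

theorem loopRun_scanStep (w : List Symbol) (q : ClusterLex) (ρ : ClusterReg → List Symbol)
    (hq : ρ state = [q.code]) :
    ∃ c, loopRun input (fun t => (StackProg.cases state fun o => scanStep t (decode o)).run) w ρ =
      fun r => if r = input then [] else if r = state then [c] else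
        (written r q w).reverse ++ ρ r := by
  induction w generalizing q ρ with
  | nil =>
    refine ⟨q.code, ?_⟩
    funext r
    by_cases h1 : r = input
    · subst h1; simp [loopRun]
    · by_cases h2 : r = state
      · subst h2; simp [loopRun, hq]
      · simp [loopRun, h1, h2, written]
  | cons t w ih =>
    have hq' : update ρ input w state = [q.code] := by simp [hq]
    have e : (StackProg.cases state fun o => scanStep t (decode o)).run (update ρ input w) =
        (scanStep t q).run (update ρ input w) := by
      rw [run, hq', List.head?_cons, decode_code]
    obtain ⟨c, hc⟩ := ih (q.next t) ((scanStep t q).run (update ρ input w)) (by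
      rw [run_scanStep _ _ _ hq', if_pos rfl])
    refine ⟨c, ?_⟩
    rw [loopRun, e, hc]
    funext r
    by_cases h1 : r = input
    · subst h1; simp
    · by_cases h2 : r = state
      · subst h2; simp
      · rw [if_neg h1, if_neg h2, if_neg h1, if_neg h2, run_scanStep _ _ _ hq', if_neg h2, written,
          update_of_ne h1]
        simp

/-- The encodings of monomials whose variables have indices that are sums of numbers in unary. -/
def template (p : List (ℤ × List (List ClusterReg × ℕ))) : List (Symbol ⊕ ClusterReg) :=
  p.flatMap fun a => .inl .item :: ((encodeInt a.1).map .inl ++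
    (a.2.flatMap (fun v => .inl .item :: (v.1.map .inr ++ .inl .close ::
      (encodeBinary v.2).map .inl)) ++ [.inl .close]))

/-- The square of the difference of two coordinates. -/
def sqDiffTemplate : List (Symbol ⊕ ClusterReg) :=
  template [(1, [([base, off], 2)]), (-2, [([base, off], 1), ([base'], 1)]), (1, [([base'], 2)])]

/-- The program for a coordinate. -/
def coordStep : StackProg ClusterReg Symbol :=
  .seq (write acc sqDiffTemplate) (.seq (.push off .tally) (.push base' .tally))

/-- The program for a pair of points. -/
def pairStep : StackProg ClusterReg Symbol :=
  .seq (write acc ((.conj :: .geZero :: .item :: encodeNatMono (-1, [(1, 2)])).map .inl)) <|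
  .seq (.copy dim dimCopy) <|
  .seq (.loop dimCopy fun _ => coordStep) <|
  .seq (.loop off fun _ => .skip) (.push acc .close)

/-- The program for a symbol of the marked polynomial. -/
def fillStep (s : Symbol) : StackProg ClusterReg Symbol :=
  write acc [if s = .disj then .inr base else .inl s]

/-- The program for a point. -/
def pointStep : StackProg ClusterReg Symbol :=
  .seq (write acc ((.conj :: .geZero :: .item :: encodeNatMono (-1, [(0, 1)])).map .inl)) <|
  .seq (.copy polyRev polyCopy) <|
  .seq (.loop polyCopy fillStep) <|
  .seq (.copy done doneCopy) <|
  .seq (write base' [.inl .tally, .inl .tally]) <|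
  .seq (.loop doneCopy fun _ => pairStep) <|
  .seq (.loop base' fun _ => .skip) <|
  .seq (.push done .tally) (.copy dim base)

/-- The program that translates clustering instances. -/
def translate : StackProg ClusterReg Symbol :=
  .seq (.push state (code .dim)) <|
  .seq (.loop input fun t => .cases state fun o => scanStep t (decode o)) <|
  .seq (.loop poly fun s => .push polyRev s) <|
  .seq (write base [.inl .tally, .inl .tally]) <|
  .seq (.loop count fun _ => pointStep) <|
  .seq (write result [.inr base, .inl .close, .inr acc, .inl .eqZero, .inl .close]) <|
  .loop result fun s => .push output s

/-- A number in unary, without end mark. -/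
def tallies (n : ℕ) : List Symbol := List.replicate n .tally

/-- The contents of the stacks after the instance has been read. -/
def contents (c : Symbol) (d : ℕ) (g h a : List Symbol) (k b i i' b' d' o : ℕ) :
    ClusterReg → List Symbol
  | input => []
  | state => [c]
  | dim => tallies d
  | count => tallies k
  | poly => []
  | polyRev => g
  | polyCopy => h
  | base => tallies b
  | done => tallies i
  | doneCopy => tallies i'
  | base' => tallies b'
  | dimCopy => tallies d'
  | off => tallies o
  | acc => a
  | result => []
  | output => []

variable {c : Symbol} {d : ℕ} {g h a : List Symbol} {k b i i' b' d' o : ℕ}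

theorem reverse_tallies (n : ℕ) : (tallies n).reverse = tallies n := List.reverse_replicate

theorem tallies_append (m n : ℕ) : tallies m ++ tallies n = tallies (m + n) :=
  List.replicate_append_replicate

theorem tallies_cons (n : ℕ) : .tally :: tallies n = tallies (n + 1) := rfl

theorem expand_sqDiffTemplate :
    expand (contents c d g h a k b i i' b' d' o) sqDiffTemplate =
      encodeMonos (sqDiff (b + o) b') := by
  simp [sqDiffTemplate, template, expand_append, expand_inl, expand_inr, expand_nil,
    expand_map_inl, encodeMonos, sqDiff, encodeNatMono, encodeList, encodePower, encodeUnary,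
    contents, reverse_tallies]
  simp [tallies, List.replicate_append_replicate, ← List.append_assoc]

theorem write_acc {t : List (Symbol ⊕ ClusterReg)} (ht : .inr acc ∉ t) :
    (write acc t).run (contents c d g h a k b i i' b' d' o) =
      contents c d g h ((expand (contents c d g h a k b i i' b' d' o) t).reverse ++ a)
        k b i i' b' d' o := by
  rw [run_write fun r hr => by rintro rfl; exact ht hr]
  funext r
  cases r <;> simp [contents]

theorem run_coordStep : coordStep.run (contents c d g h a k b i i' b' d' o) =
    contents c d g h ((encodeMonos (sqDiff (b + o) b')).reverse ++ a) k b i i' (b' + 1) d'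
      (o + 1) := by
  rw [coordStep, run_seq, write_acc (by simp [sqDiffTemplate, template]), expand_sqDiffTemplate]
  funext r
  cases r <;> simp [run, contents, tallies_cons]

theorem loopRun_coordStep :
    loopRun dimCopy (fun _ => coordStep.run) (tallies d') (contents c d g h a k b i i' b' d' o) =
      contents c d g h ((encodeMonos ((List.range d').flatMap fun s =>
        sqDiff (b + (o + s)) (b' + s))).reverse ++ a) k b i i' (b' + d') 0 (o + d') := by
  induction d' generalizing a b' o with
  | zero => funext r; cases r <;> simp [loopRun, contents, tallies, encodeMonos]
  | succ n ih =>
    have e : update (contents c d g h a k b i i' b' (n + 1) o) dimCopy (tallies n) =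
        contents c d g h a k b i i' b' n o := by
      funext r; cases r <;> simp [contents]
    rw [← tallies_cons, loopRun, e, run_coordStep, ih, List.range_succ_eq_map]
    simp only [encodeMonos, List.flatMap_cons, List.flatMap_map, List.flatMap_append,
      List.reverse_append, List.append_assoc, Nat.add_zero]
    congr 1 <;> [skip; omega; omega]
    simp only [Nat.succ_eq_add_one, Nat.add_assoc, Nat.add_comm 1]

/-- The stack `base'` is left advanced by `d`, at the first coordinate of the next earlier point,
while `off` returns to zero. -/
theorem run_pairStep : pairStep.run (contents c d g h a k b i i' b' 0 0) =
    contents c d g h ((distanceClause d b b').encode.reverse ++ a) k b i i' (b' + d) 0 0 := by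
  have e : ∀ a, (copy dim dimCopy).run (contents c d g h a k b i i' b' 0 0) =
      contents c d g h a k b i i' b' d 0 := by
    intro a; funext r; cases r <;> simp [run, contents, tallies]
  have e' : ∀ a, contents c d g h a k b i i' b' d 0 dimCopy = tallies d := fun _ => rfl
  rw [pairStep, run_seq, write_acc (by simp), expand_map_inl, run_seq, e, run_seq, run_loop, e',
    loopRun_coordStep, run_seq, run_loop, loopRun_skip]
  funext r
  cases r <;> simp [run, contents, distanceClause, Clause.encode, encodeNatPoly_eq, encodeMonos,
    tallies]

theorem loopRun_pairStep :
    loopRun doneCopy (fun _ => pairStep.run) (tallies i') (contents c d g h a k b i i' b' 0 0) =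
      contents c d g h (((List.range i').flatMap fun j =>
        (distanceClause d b (b' + j * d)).encode).reverse ++ a) k b i 0 (b' + i' * d) 0 0 := by
  induction i' generalizing a b' with
  | zero => funext r; cases r <;> simp [loopRun, contents, tallies]
  | succ n ih =>
    have e : update (contents c d g h a k b i (n + 1) b' 0 0) doneCopy (tallies n) =
        contents c d g h a k b i n b' 0 0 := by
      funext r; cases r <;> simp [contents]
    rw [← tallies_cons, loopRun, e, run_pairStep, ih, List.range_succ_eq_map]
    simp only [List.flatMap_cons, List.flatMap_map,
      List.reverse_append, List.append_assoc, Nat.zero_mul, Nat.add_zero]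
    congr 1 <;> [skip; ring]
    simp only [Nat.succ_eq_add_one, Nat.add_assoc, Nat.add_mul, Nat.one_mul, Nat.add_comm d]

theorem loopRun_fillStep :
    loopRun polyCopy (fun s => (fillStep s).run) h (contents c d g h a k b i i' b' d' o) =
      contents c d g [] ((fill b h).reverse ++ a) k b i i' b' d' o := by
  induction h generalizing a with
  | nil => funext r; cases r <;> simp [loopRun, contents, fill]
  | cons s h ih =>
    have e : update (contents c d g (s :: h) a k b i i' b' d' o) polyCopy h =
        contents c d g h a k b i i' b' d' o := by
      funext r; cases r <;> simp [contents]
    rw [loopRun, e, fillStep, write_acc (by split_ifs <;> simp), ih, fill_cons]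
    congr 1
    split_ifs
    · simp [expand_inr, expand_nil, contents, tallies]
    · simp [expand_inl, expand_nil]

/-- The stack `done` counts the points treated before, so every point is compared with exactly its
predecessors. The coordinates of the first point begin at `2`, after the variables for `θ` and `δ`,
and this is where `base'` starts. -/
theorem run_pointStep (p : NatPoly) :
    pointStep.run (contents c d (markPoly p) [] a k b i 0 0 0 0) =
      contents c d (markPoly p) [] (((thresholdClause p b).encode ++ (List.range i).flatMap fun j =>
        (distanceClause d b (2 + j * d)).encode).reverse ++ a) k (b + d) (i + 1) 0 0 0 0 := by
  have e1 : ∀ a, (copy polyRev polyCopy).run (contents c d (markPoly p) [] a k b i 0 0 0 0) =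
      contents c d (markPoly p) (markPoly p) a k b i 0 0 0 0 := by
    intro a; funext r; cases r <;> simp [run, contents]
  have e2 : ∀ a, (copy done doneCopy).run (contents c d (markPoly p) [] a k b i 0 0 0 0) =
      contents c d (markPoly p) [] a k b i i 0 0 0 := by
    intro a; funext r; cases r <;> simp [run, contents, tallies]
  have e3 : ∀ a, (write base' [.inl .tally, .inl .tally]).run
      (contents c d (markPoly p) [] a k b i i 0 0 0) =
      contents c d (markPoly p) [] a k b i i 2 0 0 := by
    intro a; funext r; cases r <;> simp [run, write, contents, tallies]
  have e1' : ∀ a, contents c d (markPoly p) (markPoly p) a k b i 0 0 0 0 polyCopy = markPoly p :=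
    fun _ => rfl
  have e2' : ∀ a, contents c d (markPoly p) [] a k b i i 2 0 0 doneCopy = tallies i := fun _ => rfl
  rw [pointStep, run_seq, write_acc (by simp), expand_map_inl, run_seq, e1, run_seq, run_loop, e1',
    loopRun_fillStep, run_seq, e2, run_seq, e3, run_seq, run_loop, e2', loopRun_pairStep, run_seq,
    run_loop, loopRun_skip, fill_markPoly]
  funext r
  cases r <;> simp [run, contents, thresholdClause, Clause.encode, encodeNatPoly, encodeList,
    tallies_append, tallies_cons, Nat.add_comm]
  rfl

theorem loopRun_pointStep (p : NatPoly) :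
    loopRun count (fun _ => pointStep.run) (tallies k)
        (contents c d (markPoly p) [] a k b i 0 0 0 0) =
      contents c d (markPoly p) [] (((List.range k).flatMap fun m =>
        (thresholdClause p (b + m * d)).encode ++ (List.range (i + m)).flatMap fun j =>
          (distanceClause d (b + m * d) (2 + j * d)).encode).reverse ++ a)
        0 (b + k * d) (i + k) 0 0 0 0 := by
  induction k generalizing a b i with
  | zero => funext r; cases r <;> simp [loopRun, contents, tallies]
  | succ n ih =>
    have e : update (contents c d (markPoly p) [] a (n + 1) b i 0 0 0 0) count (tallies n) =
        contents c d (markPoly p) [] a n b i 0 0 0 0 := by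
      funext r; cases r <;> simp [contents]
    rw [← tallies_cons, loopRun, e, run_pointStep, ih, List.range_succ_eq_map]
    simp only [List.flatMap_cons, List.flatMap_map,
      List.reverse_append, List.append_assoc, Nat.zero_mul, Nat.add_zero]
    congr 1 <;> [skip; ring; ring]
    simp only [Nat.succ_eq_add_one, Nat.add_assoc, Nat.add_mul, Nat.one_mul, Nat.add_comm d,
      Nat.add_comm 1]

theorem run_translate (I : CMRCInstance) :
    translate.run (update (fun _ => []) input (encodeCMRC I)) output =
      encodeSentence (sentenceOfClustering I) := by
  have e1 : ∀ c, (loop poly fun s => push polyRev s).run (fun r => if r = input then [] else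
      if r = state then [c] else (written r .dim (encodeCMRC I)).reverse ++
        (push state (code .dim)).run (update (fun _ => []) input (encodeCMRC I)) r) =
      contents c I.d (markPoly I.f.toNatPoly) []
        ((valueClause 0 I.θ).encode ++ (valueClause 1 I.δ).encode).reverse I.k 0 0 0 0 0 0 := by
    intro c
    rw [run_loop, loopRun_push (by decide)]
    funext r
    cases r <;> simp [run, contents, written_encodeCMRC, tallies]
  have e2 : ∀ c d g a k, (write base [.inl .tally, .inl .tally]).run
      (contents c d g [] a k 0 0 0 0 0 0) = contents c d g [] a k 2 0 0 0 0 0 := by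
    intros; funext r; cases r <;> simp [run, write, contents, tallies]
  have e3 : (push state (code .dim)).run (update (fun _ => []) input (encodeCMRC I)) input =
      encodeCMRC I := by simp [run]
  obtain ⟨c, hc⟩ := loopRun_scanStep (encodeCMRC I) .dim
    ((push state (code .dim)).run (update (fun _ => []) input (encodeCMRC I))) (by simp [run])
  have e4 : ∀ d g a k, contents c d g [] a k 2 0 0 0 0 0 count = tallies k := fun _ _ _ _ => rfl
  -- After the last point `base` holds `2 + I.k * I.d`, the number of variables, and is used for the
  -- header of the sentence.
  rw [translate, run_seq, run_seq, run_loop, e3, hc, run_seq, e1, run_seq, e2, run_seq, run_loop,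
    e4, loopRun_pointStep, run_seq, run_write (by simp), run_loop, loopRun_push (by decide),
    encode_sentenceOfClustering]
  simp [contents, expand_inr, expand_inl, expand_nil, encodeUnary, reverse_tallies,
    clusteringClauses, List.flatMap_assoc, List.flatMap_map]
  rfl

theorem wellRanked_template_sqDiff : (write acc sqDiffTemplate).WellRanked rank := by
  refine wellRanked_write fun r hr => ?_
  simp [sqDiffTemplate, template] at hr
  have : r = base ∨ r = off ∨ r = base' := by tauto
  rcases this with rfl | rfl | rfl <;> decide

theorem writesAbove_scanStep (t : Symbol) (q : ClusterLex) : (scanStep t q).WritesAbove rank 0 := by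
  refine ⟨writesAbove_write ?_ _, by show 0 < 1; decide, by show 0 < 1; decide⟩
  rcases target_eq q t with h | h | h | h <;> simp [h, rank]

theorem writesAbove_coordStep {m : ℕ} (hm : m < 5) : coordStep.WritesAbove rank m :=
  ⟨writesAbove_write (hm.trans (by decide)) _, hm, hm⟩

theorem wellRanked_coordStep : coordStep.WellRanked rank :=
  ⟨wellRanked_template_sqDiff, trivial, trivial⟩

theorem writesAbove_pairStep {m : ℕ} (hm : m < 4) : pairStep.WritesAbove rank m :=
  ⟨writesAbove_write (hm.trans (by decide)) _, hm,
    ⟨hm, fun _ => writesAbove_coordStep (hm.trans (by decide))⟩,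
    ⟨hm.trans (by decide), fun _ => trivial⟩, hm.trans (by decide)⟩

theorem wellRanked_pairStep : pairStep.WellRanked rank :=
  ⟨wellRanked_write (by simp), by show 1 < 4; decide,
    fun _ => ⟨wellRanked_coordStep, writesAbove_coordStep (by decide)⟩,
    fun _ => ⟨trivial, trivial⟩, trivial⟩

theorem wellRanked_fillStep (s : Symbol) : (fillStep s).WellRanked rank := by
  refine wellRanked_write fun r hr => ?_
  split_ifs at hr <;> simp at hr
  subst hr
  decide

theorem writesAbove_pointStep : pointStep.WritesAbove rank 1 :=
  ⟨writesAbove_write (by decide) _, by show 1 < 3; decide,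
    ⟨by decide, fun _ => writesAbove_write (by decide) _⟩, by show 1 < 3; decide,
    writesAbove_write (by decide) _, ⟨by decide, fun _ => writesAbove_pairStep (by decide)⟩,
    ⟨by decide, fun _ => trivial⟩, by show 1 < 2; decide, by show 1 < 2; decide⟩

theorem wellRanked_pointStep : pointStep.WellRanked rank :=
  ⟨wellRanked_write (by simp), by show 2 < 3; decide,
    fun s => ⟨wellRanked_fillStep s, writesAbove_write (by decide) _⟩, by show 2 < 3; decide,
    wellRanked_write (by simp), fun _ => ⟨wellRanked_pairStep, writesAbove_pairStep (by decide)⟩,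
    fun _ => ⟨trivial, trivial⟩, trivial, by show 1 < 2; decide⟩

/-- Loops destroy their counters, so the inner loops run on copies of `polyRev`, `done` and `dim`.
The nesting of `count`, `doneCopy` and `dimCopy` with ranks `1`, `3` and `4` leaves the higher ranks
to the text and to the indices that are built on the way. -/
theorem wellRanked_translate : translate.WellRanked rank := by
  refine ⟨trivial, fun t => ⟨fun o => ⟨wellRanked_write (by simp), trivial, trivial⟩,
    fun o => writesAbove_scanStep t _⟩, fun s => ⟨trivial, by show 1 < 2; decide⟩,
    wellRanked_write (by simp), fun _ => ⟨wellRanked_pointStep, writesAbove_pointStep⟩,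
    wellRanked_write fun r hr => ?_, fun _ => ⟨trivial, by show 7 < 8; decide⟩⟩
  simp at hr
  rcases hr with rfl | rfl <;> decide

end ClusterReg

theorem cmrc_mem_existsReal : CMRC ∈ ExistsReal :=
  ⟨sentenceOfClustering, StackProg.computableInPolyTime ClusterReg.translate
    ClusterReg.wellRanked_translate .input .output ClusterReg.run_translate,
    yes_sentenceOfClustering⟩

end RealComplexity

theorem mainTheorem1 :
    RealComplexity.ExistsRealComplete RealComplexity.CMRC ∧
      RealComplexity.PolyReducible RealComplexity.Feas RealComplexity.CMRCTwo ∧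
      RealComplexity.ExistsRealHard RealComplexity.CMRCTwo :=
  ⟨⟨RealComplexity.cmrc_mem_existsReal, RealComplexity.existsRealHard_cmrc⟩,
    RealComplexity.feas_polyReducible_cmrcTwo, RealComplexity.existsRealHard_cmrcTwo⟩
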